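/- **Conventions.** Algorithms are deterministic word-RAM algorithms (unit-cost arithmetic, bitwise, comparison and indirect-addressing instructions). A dynamic algorithm works on a simple loopless digraph $G$ on a fixed set of $n$ vertices, undergoing $m\ge 1$ edge updates interleaved with arbitrarily many queries that arrive online. It consists of a preprocessing routine (which is given $n$, $m$ and the initial graph) and routines for edge insertion, edge deletion and queries that share one memory, with words of $O(\log(n+m))$ bits. *Fully dynamic*: $G$ is initially empty and the $m$ updates are insertions and deletions. *Incremental*: $G$ is initially empty and the $m$ updates are insertions. *Decremental*: $G$ initially has $m$ edges and the $m$ updates delete them all. *Partially dynamic* means incremental or decremental. Preprocessing time is polynomial if it is $O((n+m)^t)$ for some constant $t$. A query is about $G\setminus e$ for an edge $e$ currently in $G$ or, in the vertex version, about $G\setminus v$ for a vertex $v$ of $G$. SCC means strongly connected component. In query (iii) the SCCs are reported by a pointer to a linked list of linked lists in memory: each SCC occurs once, as a list of its vertices without repetition. **SETH.** For every $\epsilon>0$ there exists a $k$ such that satisfiability of $k$-CNF formulas on $n$ variables (at most $k$ literals per clause, no repeated clause) cannot be decided in $O(2^{(1-\epsilon)n}\,\mathrm{poly}(n))$ time on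 a word RAM with words of $O(n)$ bits. **Theorem.** Let $\epsilon>0$ and fix one of the following three query types, in its edge version or in its vertex version: - (i) report the total number of SCCs of $G\setminus e$ (resp., $G\setminus v$), for any query edge $e$ (resp., vertex $v$) in $G$; - (ii) report the size of the largest SCC of $G\setminus e$ (resp., $G\setminus v$), for any query edge $e$ (resp., vertex $v$) in $G$; - (iii) report all the SCCs of $G\setminus e$ (resp., $G\setminus v$), for any query edge $e$ (resp., vertex $v$) in $G$. Suppose that, after polynomial time preprocessing, some algorithm correctly answers queries of this type either - fully dynamically, with amortized update time $O(m^{1-\epsilon})$ and amortized query time $O(m^{1-\epsilon})$ (that is, the total time of any sequence of $m$ updates and $q$ queries, after the preprocessing, is $O((m+q)\,m^{1-\epsilon})$), or - incrementally, with worst-case update time $O(m^{1-\epsilon})$ and worst-case query time $O(m^{1-\epsilon})$, or - decrementally, with worst-case update time $O(m^{1-\epsilon})$ and worst-case query time $O(m^{1-\epsilon})$. Then SETH is false. -/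

import Mathlib

namespace DynSCC

/-! ## The machine model: a word RAM with unit cost -/

/-- The binary word operations: addition, subtraction (truncated at zero), multiplication,
integer division, remainder, bitwise operations and shifts. -/
inductive BinOp
  | add | sub | mul | div | mod | and | or | xor | shl | shr

/-- The value of a word operation on natural numbers. -/
def BinOp.eval : BinOp → ℕ → ℕ → ℕ
  | .add, a, b => a + b
  | .sub, a, b => a - b
  | .mul, a, b => a * b
  | .div, a, b => a / b
  | .mod, a, b => a % b
  | .and, a, b => Nat.land a b
  | .or, a, b => Nat.lor a b
  | .xor, a, b => Nat.xor a b
  | .shl, a, b => Nat.shiftLeft a b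
  | .shr, a, b => Nat.shiftRight a b

/-- The memory of the machine: one natural number in each cell. -/
abbrev Memory := ℕ → ℕ

/-- The instructions of the machine; `d`, `a`, `b` are addresses of cells.
* `const d k`: write the constant `k` into cell `d`;
* `op o d a b`: write the result of `o` on the contents of cells `a`, `b` into cell `d`;
* `load d a`: indirect read, copy into cell `d` the cell whose address is in cell `a`;
* `store a b`: indirect write, copy cell `b` into the cell whose address is in cell `a`;
* `jlt a b l`: go to line `l` if the content of cell `a` is less than that of cell `b`. -/
inductive Instr
  | const (d k : ℕ)
  | op (o : BinOp) (d a b : ℕ)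
  | load (d a : ℕ)
  | store (a b : ℕ)
  | jlt (a b l : ℕ)

/-- A program is a finite list of instructions; it halts when the program counter leaves it. -/
abbrev Program := List Instr

/-- The memory after an instruction. -/
def Instr.nextMem (μ : Memory) : Instr → Memory
  | .const d k => Function.update μ d k
  | .op o d a b => Function.update μ d (o.eval (μ a) (μ b))
  | .load d a => Function.update μ d (μ (μ a))
  | .store a b => Function.update μ (μ a) (μ b)
  | .jlt _ _ _ => μ

/-- The program counter after an instruction at line `pc`. -/
def Instr.nextPc (pc : ℕ) (μ : Memory) : Instr → ℕ
  | .jlt a b l => if μ a < μ b then l else pc + 1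
  | _ => pc + 1

/-- `RunsTo P B pc μ T μ'`: started at line `pc` on memory `μ`, the program `P` halts after exactly
`T` steps with memory `μ'`, and at every moment of the run every cell holds a number below `B`
(numbers below `B` are the words of the machine, and a run must not overflow). -/
inductive RunsTo (P : Program) (B : ℕ) : ℕ → Memory → ℕ → Memory → Prop
  | halt {pc : ℕ} {μ : Memory} (hpc : P.length ≤ pc) (hμ : ∀ a, μ a < B) : RunsTo P B pc μ 0 μ
  | step {pc : ℕ} {μ : Memory} {T : ℕ} {μ' : Memory} (i : Instr) (hi : P[pc]? = some i)
      (hμ : ∀ a, μ a < B) (h : RunsTo P B (i.nextPc pc μ) (i.nextMem μ) T μ') :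
      RunsTo P B pc μ (T + 1) μ'

/-- Place the numbers `xs` in the cells `0, 1, …, xs.length - 1`, leaving the other cells as they
are.  Inputs are handed over in this way; results are read off from cell `0`. -/
def writeArgs (xs : List ℕ) (μ : Memory) : Memory :=
  fun a => xs.getD a (μ a)

/-! ## `k`-SAT and the Strong Exponential Time Hypothesis -/

/-- A literal on `n` variables: a variable and the truth value that satisfies it. -/
abbrev Literal (n : ℕ) := Fin n × Bool

/-- A formula in conjunctive normal form: a list of clauses, each a list of literals. -/
abbrev CNF (n : ℕ) := List (List (Literal n))

/-- Every clause has at most `k` literals, and no clause is listed twice. -/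
def IsKCNF {n : ℕ} (k : ℕ) (φ : CNF n) : Prop :=
  (∀ c ∈ φ, c.length ≤ k) ∧ φ.Nodup

/-- Satisfiability. -/
def Satisfiable {n : ℕ} (φ : CNF n) : Prop :=
  ∃ a : Fin n → Bool, ∀ c ∈ φ, ∃ l ∈ c, a l.1 = l.2

/-- The code of a literal: `2 i` for the negation of variable `i`, `2 i + 1` for variable `i`. -/
def litCode {n : ℕ} (l : Literal n) : ℕ := 2 * l.1.val + l.2.toNat

/-- The input of the machine for a formula: the number of variables, the number of clauses, and for
each clause its length followed by the codes of its literals. -/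
def encodeCNF {n : ℕ} (φ : CNF n) : List ℕ :=
  n :: φ.length :: φ.flatMap (fun c => c.length :: c.map litCode)

/-- Satisfiability of `k`-CNF formulas on `n` variables can be decided in time
`O(2 ^ ((1 - ε) n) * poly(n))` by a word RAM with words of `O(n)` bits (cell `0` finally holds `1`
if the formula is satisfiable, and `0` if it is not). -/
def KSATSolvable (k : ℕ) (ε : ℝ) : Prop :=
  ∃ (P : Program) (C : ℝ) (d c : ℕ), ∀ (n : ℕ) (φ : CNF n), IsKCNF k φ →
    ∃ (T : ℕ) (μ : Memory),
      RunsTo P (2 ^ (c * (n + 1))) 0 (writeArgs (encodeCNF φ) 0) T μ ∧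
      ((Satisfiable φ ∧ μ 0 = 1) ∨ (¬ Satisfiable φ ∧ μ 0 = 0)) ∧
      (T : ℝ) ≤ C * (2 : ℝ) ^ ((1 - ε) * (n : ℝ)) * ((n : ℝ) + 1) ^ d

/-- The Strong Exponential Time Hypothesis: for every `ε > 0` there is a `k` such that SAT on
`k`-CNF formulas on `n` variables cannot be solved in time `O(2 ^ ((1 - ε) n) * poly(n))`. -/
def SETH : Prop := ∀ ε : ℝ, 0 < ε → ∃ k : ℕ, ¬ KSATSolvable k ε

/-! ## Strongly connected components of `G`, `G \ e` and `G \ v` -/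

/-- There is a directed path from `u` to `v`. -/
def Reaches {V : Type*} (G : Digraph V) (u v : V) : Prop := Relation.ReflTransGen G.Adj u v

/-- The vertex sets of the strongly connected components of `G`. -/
def sccs {V : Type*} (G : Digraph V) : Set (Set V) :=
  {S | ∃ u : V, S = {v | Reaches G u v ∧ Reaches G v u}}

/-- `G` with the edge `(u, v)` added. -/
def insertEdge {V : Type*} (G : Digraph V) (u v : V) : Digraph V :=
  ⟨fun a b => G.Adj a b ∨ (a = u ∧ b = v)⟩

/-- `G` with the edge `(u, v)` removed. -/
def deleteEdge {V : Type*} (G : Digraph V) (u v : V) : Digraph V :=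
  ⟨fun a b => G.Adj a b ∧ ¬ (a = u ∧ b = v)⟩

/-- `G` with the vertex `v` and all its incident edges removed. -/
def deleteVertex {V : Type*} (G : Digraph V) (v : V) : Digraph {x : V // x ≠ v} :=
  ⟨fun a b => G.Adj a.1 b.1⟩

/-- Queries concern the deletion of an edge or of a vertex. -/
inductive DeletionKind
  | edge | vertex

/-- An edge or a vertex, whose deletion a query asks about. -/
inductive Deletion (n : ℕ)
  | edge (u v : Fin n)
  | vertex (v : Fin n)

/-- Whether the deletion is one of an edge or of a vertex. -/
def Deletion.kind {n : ℕ} : Deletion n → DeletionKind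
  | .edge _ _ => .edge
  | .vertex _ => .vertex

/-- The strongly connected components of `G \ e` or `G \ v`, as sets of vertices of `G`. -/
def sccsAfter {n : ℕ} (G : Digraph (Fin n)) : Deletion n → Set (Set (Fin n))
  | .edge u v => sccs (deleteEdge G u v)
  | .vertex v => (fun S => Subtype.val '' S) '' sccs (deleteVertex G v)

/-! ## Queries and their answers -/

/-- The three types of queries: the number of strongly connected components, the size of the largest
one, and all of them. -/
inductive QueryType
  | number | largest | all

/-- In memory `μ`, the pointer `p` is the head of a linked list with entries `xs`: `0` is the null
pointer, and a pointer `p ≠ 0` has its entry in cell `p` and the pointer to the rest in cell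
`p + 1`. -/
def IsLinkedList (μ : Memory) : ℕ → List ℕ → Prop
  | p, [] => p = 0
  | p, x :: xs => p ≠ 0 ∧ μ p = x ∧ IsLinkedList μ (μ (p + 1)) xs

/-- In memory `μ`, cell `0` points to a linked list of linked lists that reports the family `F` of
sets of vertices: each member of `F` is listed once, through a list of its elements, each once. -/
def Reports {n : ℕ} (μ : Memory) (F : Set (Set (Fin n))) : Prop :=
  ∃ (heads : List ℕ) (L : List (List (Fin n))),
    IsLinkedList μ (μ 0) heads ∧
    List.Forall₂ (fun p l => IsLinkedList μ p (l.map Fin.val)) heads L ∧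
    (∀ l ∈ L, l.Nodup) ∧
    (L.map (fun l => {x | x ∈ l})).Nodup ∧
    {S | ∃ l ∈ L, S = {x | x ∈ l}} = F

/-- The memory `μ` holds the correct answer to the query of type `τ` on a graph whose strongly
connected components are `F`.  (The size of the largest component of a graph without vertices
is `0`.) -/
def IsAnswer {n : ℕ} (μ : Memory) (F : Set (Set (Fin n))) : QueryType → Prop
  | .number => μ 0 = F.ncard
  | .largest => μ 0 = sSup ((fun S => S.ncard) '' F)
  | .all => Reports μ F

/-! ## Sequences of operations -/

/-- An operation: the insertion or deletion of an edge, or a query. -/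
inductive Op (n : ℕ)
  | insert (u v : Fin n)
  | delete (u v : Fin n)
  | query (x : Deletion n)

/-- The graph after an operation. -/
def Op.apply {n : ℕ} (G : Digraph (Fin n)) : Op n → Digraph (Fin n)
  | .insert u v => insertEdge G u v
  | .delete u v => deleteEdge G u v
  | .query _ => G

/-- An operation makes sense for `G`: only edges between distinct vertices that are absent are
inserted, and only edges that are present are deleted or asked about. -/
def Op.Valid {n : ℕ} (G : Digraph (Fin n)) : Op n → Prop
  | .insert u v => u ≠ v ∧ ¬ G.Adj u v
  | .delete u v => G.Adj u v
  | .query (.edge u v) => G.Adj u v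
  | .query (.vertex _) => True

/-- Every operation of the sequence makes sense when it is carried out. -/
def ValidSeq {n : ℕ} : Digraph (Fin n) → List (Op n) → Prop
  | _, [] => True
  | G, o :: os => o.Valid G ∧ ValidSeq (o.apply G) os

/-- The numbers handed to the machine with an operation. -/
def Op.args {n : ℕ} : Op n → List ℕ
  | .insert u v => [u.val, v.val]
  | .delete u v => [u.val, v.val]
  | .query (.edge u v) => [u.val, v.val]
  | .query (.vertex v) => [v.val]

/-- The operation is an insertion. -/
def Op.IsInsert {n : ℕ} : Op n → Prop
  | .insert _ _ => True
  | _ => False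

/-- The operation is a deletion. -/
def Op.IsDelete {n : ℕ} : Op n → Prop
  | .delete _ _ => True
  | _ => False

/-- All queries in the sequence are about deletions of kind `κ`. -/
def QueriesOfKind {n : ℕ} (κ : DeletionKind) (os : List (Op n)) : Prop :=
  ∀ x : Deletion n, Op.query x ∈ os → x.kind = κ

/-- The number of updates (insertions and deletions) in the sequence. -/
def numUpdates {n : ℕ} : List (Op n) → ℕ
  | [] => 0
  | .insert _ _ :: os => numUpdates os + 1
  | .delete _ _ :: os => numUpdates os + 1
  | .query _ :: os => numUpdates os

/-! ## Dynamic algorithms -/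

/-- A dynamic graph algorithm: programs for the preprocessing, for the insertion and the deletion of
an edge, and for a query, that work one after another on the same memory. -/
structure DynAlg where
  init : Program
  insert : Program
  delete : Program
  query : Program

/-- The program that serves an operation. -/
def DynAlg.prog (A : DynAlg) {n : ℕ} : Op n → Program
  | .insert _ _ => A.insert
  | .delete _ _ => A.delete
  | .query _ => A.query

/-- `A.Serves B τ G μ os Ts`: from graph `G` and memory `μ`, the algorithm serves the operations `os`
one after another with words below `B`, spends `Ts` steps on them respectively, and answers each
query correctly, as a query of type `τ` about the graph of that moment.  Each operation becomes
known to the algorithm only when it is to be served. -/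
inductive DynAlg.Serves (A : DynAlg) (B : ℕ) (τ : QueryType) {n : ℕ} :
    Digraph (Fin n) → Memory → List (Op n) → List ℕ → Prop
  | nil (G : Digraph (Fin n)) (μ : Memory) : DynAlg.Serves A B τ G μ [] []
  | cons {G : Digraph (Fin n)} {μ μ' : Memory} {o : Op n} {os : List (Op n)} {T : ℕ} {Ts : List ℕ}
      (run : RunsTo (A.prog o) B 0 (writeArgs o.args μ) T μ')
      (correct : ∀ x : Deletion n, o = Op.query x → IsAnswer μ' (sccsAfter G x) τ)
      (rest : DynAlg.Serves A B τ (o.apply G) μ' os Ts) :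
      DynAlg.Serves A B τ G μ (o :: os) (T :: Ts)

/-- The digraph with edge list `E`. -/
def ofEdges {n : ℕ} (E : List (Fin n × Fin n)) : Digraph (Fin n) := ⟨fun u v => (u, v) ∈ E⟩

/-- `A.Performs τ m B E os T₀ Ts`: the algorithm, given `n`, `m` and the list `E` of the edges of the
initial graph, takes `T₀` steps of preprocessing, and then serves the operations `os` correctly in
`Ts` steps respectively; all words are below `B`. -/
def DynAlg.Performs (A : DynAlg) (τ : QueryType) {n : ℕ} (m B : ℕ) (E : List (Fin n × Fin n))
    (os : List (Op n)) (T₀ : ℕ) (Ts : List ℕ) : Prop :=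
  ∃ μ : Memory,
    RunsTo A.init B 0
      (writeArgs (n :: m :: E.flatMap (fun e => [e.1.val, e.2.val])) 0) T₀ μ ∧
    A.Serves B τ (ofEdges E) μ os Ts

/-- `A` is a fully dynamic algorithm: starting with the empty graph on `n` vertices, after polynomial
time preprocessing, it serves every sequence with `m` edge updates and any number of queries (of
type `τ`, about deletions of kind `κ`) with amortized time `O(m ^ (1 - ε))` per operation, on words
of `O(log (n + m))` bits. -/
def DynAlg.IsFullyDynamic (A : DynAlg) (τ : QueryType) (κ : DeletionKind) (ε : ℝ) : Prop :=
  ∃ (C : ℝ) (t c : ℕ), ∀ (n m : ℕ), 0 < m → ∀ os : List (Op n),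
    ValidSeq (ofEdges []) os → QueriesOfKind κ os → numUpdates os = m →
    ∃ (T₀ : ℕ) (Ts : List ℕ), A.Performs τ m ((n + m + 2) ^ c) [] os T₀ Ts ∧
      (T₀ : ℝ) ≤ C * ((n : ℝ) + m) ^ t ∧
      (Ts.sum : ℝ) ≤ os.length * (C * (m : ℝ) ^ (1 - ε))

/-- `A` is an incremental algorithm: starting with the empty graph on `n` vertices, after polynomial
time preprocessing, it serves every sequence with `m` edge insertions, no deletions, and any number
of queries with worst-case time `O(m ^ (1 - ε))` per operation. -/
def DynAlg.IsIncremental (A : DynAlg) (τ : QueryType) (κ : DeletionKind) (ε : ℝ) : Prop :=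
  ∃ (C : ℝ) (t c : ℕ), ∀ (n m : ℕ), 0 < m → ∀ os : List (Op n),
    ValidSeq (ofEdges []) os → QueriesOfKind κ os → (∀ o ∈ os, ¬ o.IsDelete) →
    numUpdates os = m →
    ∃ (T₀ : ℕ) (Ts : List ℕ), A.Performs τ m ((n + m + 2) ^ c) [] os T₀ Ts ∧
      (T₀ : ℝ) ≤ C * ((n : ℝ) + m) ^ t ∧
      ∀ T ∈ Ts, (T : ℝ) ≤ C * (m : ℝ) ^ (1 - ε)

/-- `A` is a decremental algorithm: starting with any graph without loops on `n` vertices, given by a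
list of its `m` edges, after polynomial time preprocessing, it serves every sequence that deletes
all `m` edges, without insertions and with any number of queries, with worst-case time
`O(m ^ (1 - ε))` per operation. -/
def DynAlg.IsDecremental (A : DynAlg) (τ : QueryType) (κ : DeletionKind) (ε : ℝ) : Prop :=
  ∃ (C : ℝ) (t c : ℕ), ∀ (n m : ℕ), 0 < m → ∀ (E : List (Fin n × Fin n)) (os : List (Op n)),
    E.Nodup → (∀ e ∈ E, e.1 ≠ e.2) → E.length = m →
    ValidSeq (ofEdges E) os → QueriesOfKind κ os → (∀ o ∈ os, ¬ o.IsInsert) →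
    numUpdates os = m →
    ∃ (T₀ : ℕ) (Ts : List ℕ), A.Performs τ m ((n + m + 2) ^ c) E os T₀ Ts ∧
      (T₀ : ℝ) ≤ C * ((n : ℝ) + m) ^ t ∧
      ∀ T ∈ Ts, (T : ℝ) ≤ C * (m : ℝ) ^ (1 - ε)

end DynSCC

/-! The proof is a fine-grained reduction from `k`-SAT. The variables are split into the first `p`
and the remaining `n - p`. A vertex is created for each clause and for each of the `w = 2 ^ p`
assignments `b` of the first group, besides a source `0` and some spare vertices. Every other vertex
has an edge to the source, and a clause has an edge to every `b` that does not satisfy it (leaves it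
open). For an assignment `x` of the second group, the source is linked to exactly the clauses that
`x` leaves open. All vertices reached from the source form one strongly connected component together
with it, and all others are singletons. A vertex `b` is missed by the source if and only if `x` and
`b` together satisfy the formula. As the number of unlinked clauses is known, the size of the
component of the source, or the number of components, tells whether `x` extends to a satisfying
assignment (`Layout.ncard_reached_lt_iff`, `Layout.answer`). The query deletes a spare vertex
without incoming edges, or its only edge, which does not affect any other component. When all
components are reported, only O(number of clauses) entries of the outer list have to be read
(`check`, `wp_check`).

Thus each `x` costs a number of updates linear in the number of clauses, plus one query: a trial. A
fully dynamic algorithm inserts the links, is queried, and deletes the links. An incremental or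
decremental algorithm can only go one way, but it is run by a simulator that logs overwritten cells,
so the memory is rolled back to the state for the start graph at a cost proportional to the time
spent. Worst-case bounds make a single trial cheap. An amortized bound only controls a whole
sequence, so `w` trials are served in one session before the rollback. The start state is computed
once: by determinism it is the same for all continuations (`DynAlg.supports_of`). Updates that only
bring a sequence to its announced length are never executed.

Up to factors polynomial in the number of clauses, preprocessing and construction of the start graph
cost `w ^ (t + 2)` and each trial costs `w ^ (1 - δ)`, with `δ = min ε 1`. For `p = ⌊n / (t + 3)⌋`
the first is at most `2 ^ ((1 - 1 / (t + 3)) n)`, and the `2 ^ (n - p)` trials cost `O(2 ^ ((1 - δ /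
(t + 3)) n))` (`two_pow_pow_le`, `two_pow_mul_rpow_le`). A `k`-CNF formula without repeated clauses
has at most `(2 n + 1) ^ k` clauses, polynomial in `n`. The saving `δ / (t + 3)` does not depend on
`k`, which contradicts SETH (`DynAlg.Serviceable.kSATSolvable`).

The rest of the work makes the reduction a concrete word RAM program. A small structured language is
compiled to the machine (`Exec.leads`), weakest preconditions give correctness, time and absence of
overflow, and `machine_run` moves the input out of the cells that the compiled code needs. -/

namespace DynSCC

/-! ## A structured language on top of the word RAM -/

/-- The registers of structured programs. -/
inductive Reg
  | out | n | m | p | w | nv | s | grp | ptr | len | j | i | mask | x | u | v | a | g | cnt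
  | flag | pc | addr | val | lp | q | h | lim | sv | ne
  deriving DecidableEq

/-- The cell of a register; cell `1` is reserved for the base address of the arrays. -/
def Reg.cell (r : Reg) : ℕ := if r.ctorIdx = 0 then 0 else r.ctorIdx + 1

theorem Reg.cell_lt (r : Reg) : r.cell < 32 := by cases r <;> decide

theorem Reg.cell_ne_one (r : Reg) : r.cell ≠ 1 := by cases r <;> decide

theorem Reg.cell_injective : Function.Injective Reg.cell := by
  have h : Function.Injective Reg.ctorIdx := by
    intro r r' hab
    cases r <;> cases r' <;> first | rfl | (exact absurd hab (by decide))
  intro r r' hab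
  apply h
  unfold Reg.cell at hab
  split_ifs at hab <;> omega

/-- The arrays of structured programs: the memory of a simulated machine, the log of its writes,
and a table of clauses. -/
inductive Arr
  | mem | logAddr | logVal | clause
  deriving DecidableEq

/-- The residue modulo `4` of the offsets of the cells of an array. -/
def Arr.idx : Arr → ℕ
  | .mem => 0
  | .logAddr => 1
  | .logVal => 2
  | .clause => 3

theorem Arr.idx_lt (r : Arr) : r.idx < 4 := by cases r <;> decide

/-- The array whose cells have offsets with residue `k`. -/
def Arr.ofIdx : ℕ → Arr
  | 0 => .mem
  | 1 => .logAddr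
  | 2 => .logVal
  | _ => .clause

theorem Arr.ofIdx_idx (r : Arr) : Arr.ofIdx r.idx = r := by cases r <;> rfl

theorem Arr.idx_ofIdx {k : ℕ} (h : k < 4) : (Arr.ofIdx k).idx = k := by
  interval_cases k <;> rfl

/-- A state of a structured program: registers, arrays and elapsed time. -/
structure State where
  reg : Reg → ℕ
  arr : Arr → ℕ → ℕ
  time : ℕ

/-- What stays fixed in a run: the base address of the arrays, the bound on words, and the
read-only part of the memory. -/
structure Env where
  base : ℕ
  bound : ℕ
  inp : ℕ → ℕ

/-- Assign a register; this takes one unit of time. -/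
def State.set (s : State) (d : Reg) (v : ℕ) : State :=
  ⟨Function.update s.reg d v, s.arr, s.time + 1⟩

/-- Assign an array cell; this takes one unit of time. -/
def State.setArr (s : State) (r : Arr) (i v : ℕ) : State :=
  ⟨s.reg, Function.update s.arr r (Function.update (s.arr r) i v), s.time + 1⟩

/-- Let one unit of time pass. -/
def State.tick (s : State) : State := ⟨s.reg, s.arr, s.time + 1⟩

/-- Expressions. -/
inductive Expr
  | var (r : Reg)
  | base
  | const (k : ℕ)
  | op (o : BinOp) (a b : Expr)
  | lt (a b : Expr)
  | arr (r : Arr) (i : Expr)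
  | inp (i : Expr)

/-- The value of an expression; a comparison has value `0` or `1`. -/
def Expr.eval (E : Env) (s : State) : Expr → ℕ
  | .var r => s.reg r
  | .base => E.base
  | .const k => k
  | .op o a b => o.eval (a.eval E s) (b.eval E s)
  | .lt a b => if a.eval E s < b.eval E s then 1 else 0
  | .arr r i => s.arr r (i.eval E s)
  | .inp i => E.inp (i.eval E s)

/-- No overflow occurs in the evaluation of an expression. -/
def Expr.Ok (E : Env) (s : State) : Expr → Prop
  | .var _ => True
  | .base => True
  | .const k => k < E.bound
  | .op o a b => a.Ok E s ∧ b.Ok E s ∧ o.eval (a.eval E s) (b.eval E s) < E.bound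
  | .lt a b => a.Ok E s ∧ b.Ok E s
  | .arr _ i => i.Ok E s ∧ E.base + 4 * i.eval E s + 3 < E.bound
  | .inp i => i.Ok E s ∧ 64 ≤ i.eval E s ∧ i.eval E s < E.base

/-- The number of cells that the evaluation of an expression occupies. -/
def Expr.depth : Expr → ℕ
  | .var _ => 1
  | .base => 1
  | .const _ => 1
  | .op _ a b => max a.depth (b.depth + 1)
  | .lt a b => max a.depth (b.depth + 1)
  | .arr _ i => max i.depth 2
  | .inp i => i.depth

/-- Machine code that turns the index in cell `t` into the address of an array cell. -/
def addrCode (r : Arr) (t : ℕ) : List Instr :=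
  [.const (t + 1) 4, .op .mul t t (t + 1), .const (t + 1) r.idx, .op .add t t (t + 1),
    .op .add t t 1]

/-- Machine code that leaves the value of an expression in cell `t`. -/
def Expr.code : Expr → ℕ → List Instr
  -- The machine has no direct copy instruction between fixed cells; the bitwise or of a cell with
  -- itself copies it.
  | .var r, t => [.op .or t r.cell r.cell]
  | .base, t => [.op .or t 1 1]
  | .const k, t => [.const t k]
  | .op o a b, t => a.code t ++ (b.code (t + 1) ++ [.op o t t (t + 1)])
  -- The truncated difference `b - a` is positive exactly if `a < b`; divided by itself it gives the
  -- bit, since `0 / 0 = 0` on the machine.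
  | .lt a b, t => a.code t ++ (b.code (t + 1) ++ [.op .sub t (t + 1) t, .op .div t t t])
  | .arr r i, t => i.code t ++ (addrCode r t ++ [.load t t])
  | .inp i, t => i.code t ++ [.load t t]

/-- Structured programs. -/
inductive Cmd
  | skip
  | assign (d : Reg) (e : Expr)
  | store (r : Arr) (i e : Expr)
  | seq (c₁ c₂ : Cmd)
  | ite (e : Expr) (c₁ c₂ : Cmd)
  | while (e : Expr) (c : Cmd)

/-- Big-step semantics without overflow. -/
inductive Exec (E : Env) : Cmd → State → State → Prop
  | skip (s : State) : Exec E .skip s s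
  | assign {s : State} {d : Reg} {e : Expr} (h : e.Ok E s) :
      Exec E (.assign d e) s (s.set d (e.eval E s))
  | store {s : State} {r : Arr} {i e : Expr} (hi : i.Ok E s) (he : e.Ok E s)
      (ha : E.base + 4 * i.eval E s + 3 < E.bound) :
      Exec E (.store r i e) s (s.setArr r (i.eval E s) (e.eval E s))
  | seq {s₁ s₂ s₃ : State} {c₁ c₂ : Cmd} (h₁ : Exec E c₁ s₁ s₂) (h₂ : Exec E c₂ s₂ s₃) :
      Exec E (.seq c₁ c₂) s₁ s₃
  | ite_true {s s' : State} {e : Expr} {c₁ c₂ : Cmd} (h : e.Ok E s) (he : e.eval E s ≠ 0)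
      (h₁ : Exec E c₁ s.tick s') : Exec E (.ite e c₁ c₂) s s'
  | ite_false {s s' : State} {e : Expr} {c₁ c₂ : Cmd} (h : e.Ok E s) (he : e.eval E s = 0)
      (h₂ : Exec E c₂ s.tick s') : Exec E (.ite e c₁ c₂) s s'
  | while_true {s s' s'' : State} {e : Expr} {c : Cmd} (h : e.Ok E s) (he : e.eval E s ≠ 0)
      (h₁ : Exec E c s.tick s') (h₂ : Exec E (.while e c) s' s'') : Exec E (.while e c) s s''
  | while_false {s : State} {e : Expr} {c : Cmd} (h : e.Ok E s) (he : e.eval E s = 0) :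
      Exec E (.while e c) s s.tick

/-- All expressions of the program fit into the cells for temporary values. -/
def Cmd.Shallow : Cmd → Prop
  | .skip => True
  | .assign _ e => e.depth ≤ 28
  | .store _ i e => i.depth ≤ 28 ∧ e.depth ≤ 28
  | .seq c₁ c₂ => c₁.Shallow ∧ c₂.Shallow
  | .ite e c₁ c₂ => e.depth ≤ 28 ∧ c₁.Shallow ∧ c₂.Shallow
  | .while e c => e.depth ≤ 28 ∧ c.Shallow

/-- Machine code for a jump to line `l`. -/
def gotoCode (l : ℕ) : List Instr := [.const 32 0, .const 33 1, .jlt 32 33 l]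

/-- Machine code for a structured program, to be placed from line `p` on. -/
def Cmd.code : Cmd → ℕ → List Instr
  | .skip, _ => []
  | .assign d e, _ => e.code 32 ++ [.op .or d.cell 32 32]
  -- The value is moved to cell `35` because the computation of the address overwrites cell `33`.
  | .store r i e, _ => i.code 32 ++ (e.code 33 ++ ([.op .or 35 33 33] ++
      (addrCode r 32 ++ [.store 32 35])))
  | .seq c₁ c₂, p => c₁.code p ++ c₂.code (p + (c₁.code p).length)
  | .ite e c₁ c₂, p =>
      let l₂ := c₂.code (p + (e.code 32).length + 2)
      let p₁ := p + (e.code 32).length + 2 + l₂.length + 3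
      let l₁ := c₁.code p₁
      e.code 32 ++ ([.const 33 0, .jlt 33 32 p₁] ++ (l₂ ++ (gotoCode (p₁ + l₁.length) ++ l₁)))
  | .while e c, p =>
      let p₁ := p + (e.code 32).length + 2 + 3
      let l := c.code p₁
      e.code 32 ++ ([.const 33 0, .jlt 33 32 p₁] ++
        (gotoCode (p₁ + l.length + 3) ++ (l ++ gotoCode p)))

/-! ### Correctness of the translation -/

/-- A run from line `q` on memory `μ'` extends to a run from line `p` on memory `μ` that is longer
by `T` steps. -/
def Leads (P : Program) (B p : ℕ) (μ : Memory) (T q : ℕ) (μ' : Memory) : Prop :=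
  ∀ T' μ'', RunsTo P B q μ' T' μ'' → RunsTo P B p μ (T + T') μ''

theorem Leads.refl {P : Program} {B p : ℕ} {μ : Memory} : Leads P B p μ 0 p μ :=
  fun T' μ'' h => by simpa using h

theorem Leads.trans {P : Program} {B p q r T T' : ℕ} {μ μ' μ'' : Memory}
    (h : Leads P B p μ T q μ') (h' : Leads P B q μ' T' r μ'') :
    Leads P B p μ (T + T') r μ'' := fun T₂ ν hν => by
  rw [Nat.add_assoc]; exact h _ _ (h' _ _ hν)

/-- The list `l` is the part of the program that starts at line `p`. -/
def CodeAt (P : Program) (p : ℕ) (l : List Instr) : Prop :=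
  ∀ i, i < l.length → P[p + i]? = l[i]?

theorem CodeAt.left {P : Program} {p : ℕ} {l l' : List Instr} (h : CodeAt P p (l ++ l')) :
    CodeAt P p l := fun i hi => by
  rw [h i (by simp; omega), List.getElem?_append_left hi]

theorem CodeAt.right {P : Program} {p : ℕ} {l l' : List Instr} (h : CodeAt P p (l ++ l')) :
    CodeAt P (p + l.length) l' := fun i hi => by
  rw [Nat.add_assoc, h (l.length + i) (by simp; omega), List.getElem?_append_right (by omega)]
  simp

theorem CodeAt.head {P : Program} {p : ℕ} {i : Instr} {l : List Instr}
    (h : CodeAt P p (i :: l)) : P[p]? = some i := by simpa using h 0 (by simp)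

theorem CodeAt.tail {P : Program} {p : ℕ} {i : Instr} {l : List Instr}
    (h : CodeAt P p (i :: l)) : CodeAt P (p + 1) l := CodeAt.right (l := [i]) h

theorem Leads.cons {P : Program} {B p q T : ℕ} {μ μ' : Memory} {i : Instr}
    (hi : P[p]? = some i) (hμ : ∀ a, μ a < B)
    (h : Leads P B (i.nextPc p μ) (i.nextMem μ) T q μ') : Leads P B p μ (T + 1) q μ' :=
  fun T' ν hν => by
    have := RunsTo.step i hi hμ (h T' ν hν)
    convert this using 1; omega

theorem update_lt {μ : Memory} {B d v : ℕ} (hμ : ∀ a, μ a < B) (hv : v < B) :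
    ∀ a, Function.update μ d v a < B := fun a => by
  by_cases h : a = d
  · subst h; simpa
  · simpa [h] using hμ a

/-- The content of the cells from `64` on. -/
def Env.high (E : Env) (s : State) (x : ℕ) : ℕ :=
  if x < E.base then E.inp x else s.arr (Arr.ofIdx ((x - E.base) % 4)) ((x - E.base) / 4)

theorem Env.high_arr (E : Env) (s : State) (r : Arr) (i : ℕ) :
    E.high s (E.base + 4 * i + r.idx) = s.arr r i := by
  have := r.idx_lt
  rw [Env.high, if_neg (by omega)]
  rw [show (E.base + 4 * i + r.idx - E.base) % 4 = r.idx by omega,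
    show (E.base + 4 * i + r.idx - E.base) / 4 = i by omega, Arr.ofIdx_idx]

/-- The memory `μ` represents the state `s`. -/
structure Env.Rep (E : Env) (μ : Memory) (s : State) : Prop where
  reg : ∀ r, μ r.cell = s.reg r
  base : μ 1 = E.base
  high : ∀ x, 64 ≤ x → μ x = E.high s x
  lt : ∀ x, μ x < E.bound
  le : 64 ≤ E.base

theorem Env.Rep.congr {E : Env} {μ μ' : Memory} {s : State} (h : E.Rep μ s)
    (h' : ∀ x, x < 32 ∨ 64 ≤ x → μ' x = μ x) (hb : ∀ x, μ' x < E.bound) : E.Rep μ' s where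
  reg r := by rw [h' _ (Or.inl r.cell_lt), h.reg]
  base := by rw [h' _ (by omega), h.base]
  high x hx := by rw [h' _ (by omega), h.high x hx]
  lt := hb
  le := h.le

theorem Env.Rep.tick {E : Env} {μ : Memory} {s : State} (h : E.Rep μ s) : E.Rep μ s.tick :=
  ⟨h.reg, h.base, h.high, h.lt, h.le⟩

theorem addrCode_leads {P : Program} {B p t : ℕ} {μ : Memory} {r : Arr} (ht : 32 ≤ t)
    (hc : CodeAt P p (addrCode r t)) (hμ : ∀ x, μ x < B) (hB : 4 < B)
    (hb : μ 1 + 4 * μ t + 3 < B) :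
    ∃ μ', Leads P B p μ 5 (p + 5) μ' ∧ μ' t = μ 1 + 4 * μ t + r.idx ∧
      (∀ x, x ≠ t → x ≠ t + 1 → μ' x = μ x) ∧ ∀ x, μ' x < B := by
  have hr := r.idx_lt
  refine ⟨_, Leads.cons hc.head hμ <| Leads.cons hc.tail.head ?_ <|
    Leads.cons hc.tail.tail.head ?_ <| Leads.cons hc.tail.tail.tail.head ?_ <|
    Leads.cons hc.tail.tail.tail.tail.head ?_ Leads.refl, ?_, ?_, ?_⟩
  any_goals
    simp only [Instr.nextMem, BinOp.eval]
    repeat refine update_lt ?_ ?_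
    any_goals assumption
  any_goals
    have h1 : (1 : ℕ) ≠ t := by omega
    have h2 : t ≠ 0 := by omega
    simp [h1, h2, Function.update_apply, Instr.nextMem, BinOp.eval]
    try omega
  intro x h3 h4
  simp [h3, h4]

/-- Evaluation into cell `t` changes only temporary cells from `t` on. This frame condition carries
the induction: the value of a first operand survives in cell `t` while the second one is computed in
`t + 1`, and the represented state is not disturbed. -/
theorem Expr.code_leads {E : Env} {P : Program} {s : State} (e : Expr) : ∀ {p t : ℕ} {μ : Memory},
    32 ≤ t → t + e.depth ≤ 64 → CodeAt P p (e.code t) → E.Rep μ s → e.Ok E s →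
    ∃ μ', Leads P E.bound p μ (e.code t).length (p + (e.code t).length) μ' ∧
      μ' t = e.eval E s ∧ (∀ x, x < t ∨ 64 ≤ x → μ' x = μ x) ∧ ∀ x, μ' x < E.bound := by
  have key : ∀ {p t : ℕ} {μ : Memory} {i : Instr} {v : ℕ}, 32 ≤ t → t + 1 ≤ 64 →
      CodeAt P p [i] → (∀ x, μ x < E.bound) → i.nextMem μ = Function.update μ t v →
      i.nextPc p μ = p + 1 → v < E.bound →
      ∃ μ', Leads P E.bound p μ 1 (p + 1) μ' ∧
      μ' t = v ∧ (∀ x, x < t ∨ 64 ≤ x → μ' x = μ x) ∧ ∀ x, μ' x < E.bound := by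
    intro p t μ i v ht ht' hc hμ h1 h2 hv
    refine ⟨Function.update μ t v, Leads.cons hc.head hμ ?_, ?_, ?_, ?_⟩
    · rw [h1, h2]; exact Leads.refl
    · simp
    · intro x hx
      exact Function.update_of_ne (by omega) _ _
    · exact update_lt hμ hv
  induction e with
  | var r =>
    intro p t μ ht hd hc hR hok
    have hor : Nat.lor (μ r.cell) (μ r.cell) = s.reg r := by
      rw [← hR.reg r]; exact Nat.or_self _
    exact key ht hd hc hR.lt (v := s.reg r)
      (by simp only [Instr.nextMem, BinOp.eval, hor]) rfl (hR.reg r ▸ hR.lt _)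
  | base =>
    intro p t μ ht hd hc hR hok
    have hor : Nat.lor (μ 1) (μ 1) = E.base := by
      rw [← hR.base]; exact Nat.or_self _
    exact key ht hd hc hR.lt (v := E.base)
      (by simp only [Instr.nextMem, BinOp.eval, hor]) rfl (hR.base ▸ hR.lt _)
  | const k =>
    intro p t μ ht hd hc hR hok
    exact key ht hd hc hR.lt rfl rfl hok
  | op o a b iha ihb =>
    intro p t μ ht hd hc hR hok
    simp only [Expr.depth] at hd
    obtain ⟨hoka, hokb, hv⟩ := hok
    obtain ⟨μ₁, l₁, e₁, f₁, b₁⟩ := iha ht (by omega) hc.left hR hoka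
    have hR₁ := hR.congr (μ' := μ₁) (fun x hx => f₁ x (by omega)) b₁
    obtain ⟨μ₂, l₂, e₂, f₂, b₂⟩ := ihb (by omega) (by omega) hc.right.left hR₁ hokb
    obtain ⟨μ₃, l₃, e₃, f₃, b₃⟩ := key ht (by omega) hc.right.right b₂ (i := .op o t t (t + 1))
      (v := o.eval (a.eval E s) (b.eval E s))
      (by simp [Instr.nextMem, e₂, f₂ t (by omega), e₁]) rfl hv
    refine ⟨μ₃, ?_, e₃, ?_, b₃⟩
    · have := (l₁.trans l₂).trans l₃
      simp only [Expr.code, List.length_append, List.length_cons, List.length_nil]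
      convert this using 1 <;> omega
    · intro x hx
      rw [f₃ x hx, f₂ x (by omega), f₁ x hx]
  | lt a b iha ihb =>
    intro p t μ ht hd hc hR hok
    simp only [Expr.depth] at hd
    obtain ⟨hoka, hokb⟩ := hok
    obtain ⟨μ₁, l₁, e₁, f₁, b₁⟩ := iha ht (by omega) hc.left hR hoka
    have hR₁ := hR.congr (μ' := μ₁) (fun x hx => f₁ x (by omega)) b₁
    obtain ⟨μ₂, l₂, e₂, f₂, b₂⟩ := ihb (by omega) (by omega) hc.right.left hR₁ hokb
    have hc₃ := hc.right.right
    have b3 : b.eval E s < E.bound := e₂ ▸ b₂ _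
    have b4 : 64 < E.bound := lt_of_le_of_lt hR.le (hR.base ▸ hR.lt 1)
    obtain ⟨μ₃, l₃, e₃, f₃, b₃⟩ := key ht (by omega) (CodeAt.left (l := [_]) hc₃) b₂
      (v := b.eval E s - a.eval E s)
      (by simp [Instr.nextMem, e₂, f₂ t (by omega), e₁, BinOp.eval]) rfl (by omega)
    obtain ⟨μ₄, l₄, e₄, f₄, b₄⟩ := key ht (by omega) (hc₃.tail) b₃
      (v := (Expr.lt a b).eval E s)
      (by
        simp only [Instr.nextMem, e₃, BinOp.eval, Expr.eval]
        congr 1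
        split_ifs with h
        · exact Nat.div_self (by omega)
        · rw [Nat.sub_eq_zero_of_le (by omega)]) rfl
        (by simp only [Expr.eval]; split_ifs <;> omega)
    refine ⟨μ₄, ?_, e₄, ?_, b₄⟩
    · have := ((l₁.trans l₂).trans l₃).trans l₄
      simp only [Expr.code, List.length_append, List.length_cons, List.length_nil]
      convert this using 1 <;> omega
    · intro x hx
      rw [f₄ x hx, f₃ x hx, f₂ x (by omega), f₁ x hx]
  | arr r i ih =>
    intro p t μ ht hd hc hR hok
    simp only [Expr.depth] at hd
    obtain ⟨hoki, hv⟩ := hok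
    obtain ⟨μ₁, l₁, e₁, f₁, b₁⟩ := ih ht (by omega) hc.left hR hoki
    have hR₁ := hR.congr (μ' := μ₁) (fun x hx => f₁ x (by omega)) b₁
    obtain ⟨μ₂, l₂, e₂, f₂, b₂⟩ := addrCode_leads ht hc.right.left b₁
      (lt_of_lt_of_le (by have := hR.le; omega) hv.le)
      (by rw [hR₁.base, e₁]; exact hv)
    have hval : μ₂ (μ₂ t) = s.arr r (i.eval E s) := by
      have hle := hR.le
      rw [e₂, hR₁.base, e₁, f₂ _ (by omega) (by omega), hR₁.high _ (by omega), Env.high_arr]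
    obtain ⟨μ₃, l₃, e₃, f₃, b₃⟩ := key ht (by omega) hc.right.right b₂
      (v := s.arr r (i.eval E s)) (by simp [Instr.nextMem, hval]) rfl (hval ▸ b₂ _)
    refine ⟨μ₃, ?_, e₃, ?_, b₃⟩
    · have := (l₁.trans l₂).trans l₃
      simp only [Expr.code, List.length_append, List.length_cons, List.length_nil]
      convert this using 1 <;> (try simp [addrCode]) <;> omega
    · intro x hx
      rw [f₃ x hx, f₂ x (by omega) (by omega), f₁ x hx]
  | inp i ih =>
    intro p t μ ht hd hc hR hok
    simp only [Expr.depth] at hd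
    obtain ⟨hoki, hv, hv'⟩ := hok
    obtain ⟨μ₁, l₁, e₁, f₁, b₁⟩ := ih ht (by omega) hc.left hR hoki
    have hR₁ := hR.congr (μ' := μ₁) (fun x hx => f₁ x (by omega)) b₁
    have hdep : ∀ e : Expr, 0 < e.depth := by
      intro e; induction e <;> simp [Expr.depth] <;> omega
    have := hdep i
    have hval : μ₁ (μ₁ t) = E.inp (i.eval E s) := by
      rw [e₁, hR₁.high _ hv, Env.high, if_pos hv']
    obtain ⟨μ₃, l₃, e₃, f₃, b₃⟩ := key ht (by omega) hc.right b₁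
      (v := E.inp (i.eval E s)) (by simp [Instr.nextMem, hval]) rfl (hval ▸ b₁ _)
    refine ⟨μ₃, ?_, e₃, ?_, b₃⟩
    · have := l₁.trans l₃
      simp only [Expr.code, List.length_append, List.length_cons, List.length_nil]
      convert this using 1 <;> omega
    · intro x hx
      rw [f₃ x hx, f₁ x hx]

end DynSCC

/-! ### Translation of commands: jumps, writes and simulation of whole programs. -/

namespace DynSCC

/-- Jump targets are absolute, so code depends on its position, but only through those targets. That
the length does not makes the offsets in `Cmd.code` consistent. -/
theorem Cmd.code_length (c : Cmd) : ∀ p q, (c.code p).length = (c.code q).length := by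
  induction c with
  | skip => intro p q; rfl
  | assign d e => intro p q; rfl
  | store r i e => intro p q; rfl
  | seq c₁ c₂ h₁ h₂ =>
    intro p q
    simp only [Cmd.code, List.length_append]
    rw [h₁ p q, h₂ _ (q + (c₁.code q).length)]
  | ite e c₁ c₂ h₁ h₂ =>
    intro p q
    simp only [Cmd.code, List.length_append, gotoCode, List.length_cons, List.length_nil]
    rw [h₂ _ (q + (e.code 32).length + 2), h₁ _ (q + (e.code 32).length + 2 +
      (c₂.code (q + (e.code 32).length + 2)).length + 3)]
  | _ e c h =>
    intro p q
    simp only [Cmd.code, List.length_append, gotoCode, List.length_cons, List.length_nil]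
    rw [h _ (q + (e.code 32).length + 2 + 3)]

theorem Env.Rep.write {E : Env} {μ : Memory} {s : State} {d : Reg} {v : ℕ} (h : E.Rep μ s)
    (hv : v < E.bound) : E.Rep (Function.update μ d.cell v) (s.set d v) where
  reg r := by
    by_cases hr : r = d
    · subst hr; simp [State.set]
    · have : r.cell ≠ d.cell := fun hc => hr (Reg.cell_injective hc)
      simp [State.set, hr, this, h.reg]
  base := by
    rw [Function.update_of_ne d.cell_ne_one.symm, h.base]
  high x hx := by
    have := d.cell_lt
    rw [Function.update_of_ne (by omega), h.high x hx]; rfl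
  lt := update_lt h.lt hv
  le := h.le

/-- The arrays are interleaved: an offset from the base determines the array by its residue modulo
`4` and the index by its quotient, so one write changes one entry of one array. -/
theorem Env.Rep.writeArr {E : Env} {μ : Memory} {s : State} {r : Arr} {i v : ℕ} (h : E.Rep μ s)
    (hv : v < E.bound) :
    E.Rep (Function.update μ (E.base + 4 * i + r.idx) v) (s.setArr r i v) where
  reg r' := by
    have := r'.cell_lt
    have := h.le
    rw [Function.update_of_ne (by omega), h.reg]; rfl
  base := by
    have := h.le
    rw [Function.update_of_ne (by omega), h.base]
  high x hx := by
    have hr := r.idx_lt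
    by_cases hx' : x = E.base + 4 * i + r.idx
    · subst hx'
      rw [Env.high_arr]; simp [State.setArr]
    · rw [Function.update_of_ne hx', h.high x hx, Env.high, Env.high]
      split_ifs with hlt
      · rfl
      · simp only [State.setArr, Function.update_apply]
        split_ifs with h1
        · by_cases h2 : (x - E.base) / 4 = i
          · exfalso
            have h3 := Arr.idx_ofIdx (k := (x - E.base) % 4) (by omega)
            rw [h1] at h3
            omega
          · simp [h1, h2]
        · rfl
  lt := update_lt h.lt hv
  le := h.le

theorem goto_leads {P : Program} {E : Env} {p l : ℕ} {μ : Memory} {s : State}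
    (hc : CodeAt P p (gotoCode l)) (hR : E.Rep μ s) :
    ∃ μ', Leads P E.bound p μ 3 l μ' ∧ E.Rep μ' s := by
  have hB : 64 < E.bound := lt_of_le_of_lt hR.le (hR.base ▸ hR.lt 1)
  have h1 := update_lt (d := 32) hR.lt (show 0 < E.bound by omega)
  have h2 := update_lt (d := 33) h1 (show 1 < E.bound by omega)
  refine ⟨Function.update (Function.update μ 32 0) 33 1, Leads.cons hc.head hR.lt <|
    Leads.cons hc.tail.head h1 <| Leads.cons hc.tail.tail.head h2 ?_, ?_⟩
  · have : Instr.nextPc (p + 1 + 1) (Function.update (Function.update μ 32 0) 33 1)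
        (.jlt 32 33 l) = l := by
      simp [Instr.nextPc]
    change Leads P E.bound (Instr.nextPc (p + 1 + 1)
      (Function.update (Function.update μ 32 0) 33 1) (.jlt 32 33 l)) _ 0 l _
    rw [this]
    exact Leads.refl
  · refine hR.congr (fun x hx => ?_) h2
    rw [Function.update_of_ne (by omega), Function.update_of_ne (by omega)]

theorem test_leads {P : Program} {E : Env} {p l : ℕ} {μ : Memory} {s : State} {e : Expr}
    (hd : e.depth ≤ 28) (hc : CodeAt P p (e.code 32 ++ [.const 33 0, .jlt 33 32 l]))
    (hR : E.Rep μ s) (hok : e.Ok E s) :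
    ∃ μ', Leads P E.bound p μ ((e.code 32).length + 2)
      (if e.eval E s = 0 then p + (e.code 32).length + 2 else l) μ' ∧ E.Rep μ' s.tick := by
  have hB : 64 < E.bound := lt_of_le_of_lt hR.le (hR.base ▸ hR.lt 1)
  obtain ⟨μ₁, l₁, e₁, f₁, b₁⟩ := e.code_leads le_rfl (by omega) hc.left hR hok
  have b₂ := update_lt (d := 33) b₁ (show 0 < E.bound by omega)
  refine ⟨Function.update μ₁ 33 0, l₁.trans <| Leads.cons hc.right.head b₁ <|
    Leads.cons hc.right.tail.head b₂ ?_, ?_⟩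
  · have : Instr.nextPc (p + (e.code 32).length + 1) (Function.update μ₁ 33 0) (.jlt 33 32 l)
        = if e.eval E s = 0 then p + (e.code 32).length + 2 else l := by
      simp only [Instr.nextPc]
      by_cases h0 : e.eval E s = 0 <;> simp [e₁, h0]
    change Leads P E.bound (Instr.nextPc (p + (e.code 32).length + 1)
      (Function.update μ₁ 33 0) (.jlt 33 32 l)) _ 0 _ _
    rw [this]
    exact Leads.refl
  · refine (hR.congr (fun x hx => ?_) b₂).tick
    rw [Function.update_of_ne (by omega), f₁ x (by omega)]

/-- The translation is correct, and a unit of time of the structured program amounts to at most as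
many steps as the program has lines. -/
theorem Exec.leads {E : Env} {P : Program} {c : Cmd} {s s' : State} (h : Exec E c s s') :
    ∀ {p : ℕ} {μ : Memory} {W : ℕ}, c.Shallow → CodeAt P p (c.code p) → (c.code p).length ≤ W →
    E.Rep μ s → ∃ T μ', Leads P E.bound p μ T (p + (c.code p).length) μ' ∧ E.Rep μ' s' ∧
      T + W * s.time ≤ W * s'.time := by
  induction h with
  | skip s =>
    intro p μ W _ _ _ hR
    exact ⟨0, μ, Leads.refl, hR, by simp⟩
  | @assign s d e hok =>
    intro p μ W hd hc hW hR
    obtain ⟨μ₁, l₁, e₁, f₁, b₁⟩ := e.code_leads le_rfl (by simp [Cmd.Shallow] at hd; omega)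
      hc.left hR hok
    have hR₁ := (hR.congr (μ' := μ₁) (fun x hx => f₁ x (by omega)) b₁)
    have l₂ := l₁.trans (Leads.cons hc.right.head b₁ Leads.refl)
    refine ⟨_, _, by
      simp only [Cmd.code, List.length_append, List.length_cons, List.length_nil]; exact l₂,
      ?_, ?_⟩
    · have : Nat.lor (μ₁ 32) (μ₁ 32) = e.eval E s := by rw [e₁]; exact Nat.or_self _
      simp only [Instr.nextMem, BinOp.eval, this]
      exact hR₁.write (e₁ ▸ b₁ _)
    · simp only [Cmd.code, List.length_append, List.length_cons, List.length_nil] at hW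
      simp only [State.set, Nat.mul_add]; omega
  | @store s r i e hi he ha =>
    intro p μ W hd hc hW hR
    simp only [Cmd.Shallow] at hd
    have hB : 64 < E.bound := lt_of_le_of_lt hR.le (hR.base ▸ hR.lt 1)
    obtain ⟨μ₁, l₁, e₁, f₁, b₁⟩ := i.code_leads le_rfl (by omega) hc.left hR hi
    have hR₁ := (hR.congr (μ' := μ₁) (fun x hx => f₁ x (by omega)) b₁)
    obtain ⟨μ₂, l₂, e₂, f₂, b₂⟩ := e.code_leads (t := 33) (by omega) (by omega)
      hc.right.left hR₁ he
    have hR₂ := (hR₁.congr (μ' := μ₂) (fun x hx => f₂ x (by omega)) b₂)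
    have l₃ := Leads.cons hc.right.right.left.head b₂ Leads.refl
    have hor : Nat.lor (μ₂ 33) (μ₂ 33) = e.eval E s := by rw [e₂]; exact Nat.or_self _
    simp only [Instr.nextMem, BinOp.eval, hor, Instr.nextPc] at l₃
    have b₃ := update_lt (d := 35) b₂ (show e.eval E s < E.bound from e₂ ▸ b₂ _)
    have hR₃ := (hR₂.congr (μ' := Function.update μ₂ 35 (e.eval E s))
      (fun x hx => by rw [Function.update_of_ne (by omega)]) b₃)
    obtain ⟨μ₄, l₄, e₄, f₄, b₄⟩ := addrCode_leads (r := r) le_rfl hc.right.right.right.left b₃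
      (by omega) (by
        rw [hR₃.base, Function.update_of_ne (by omega), f₂ 32 (by omega), e₁]; exact ha)
    have hR₄ := (hR₃.congr (μ' := μ₄) (fun x hx => f₄ x (by omega) (by omega)) b₄)
    have l₅ := Leads.cons hc.right.right.right.right.head b₄ Leads.refl
    have h35 : μ₄ 35 = e.eval E s := by rw [f₄ 35 (by omega) (by omega)]; simp
    have h32 : μ₄ 32 = E.base + 4 * i.eval E s + r.idx := by
      rw [e₄, hR₃.base, Function.update_of_ne (by omega), f₂ 32 (by omega), e₁]
    simp only [Instr.nextMem, Instr.nextPc, h35, h32] at l₅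
    have := (((l₁.trans l₂).trans l₃).trans l₄).trans l₅
    simp only [Cmd.code, List.length_append, List.length_cons, List.length_nil, addrCode] at hW
    refine ⟨(i.code 32).length + (e.code 33).length + (0 + 1) + 5 + (0 + 1), _, ?_,
      hR₄.writeArr (h35 ▸ b₄ _), ?_⟩
    · convert this using 1
      simp only [Cmd.code, List.length_append, List.length_cons, List.length_nil, addrCode]
      omega
    · simp only [State.setArr, Nat.mul_add]; omega
  | seq h₁ h₂ ih₁ ih₂ =>
    intro p μ W hd hc hW hR
    simp only [Cmd.code, List.length_append] at hW
    obtain ⟨T₁, μ₁, l₁, R₁, t₁⟩ := ih₁ (W := W) hd.1 hc.left (by omega) hR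
    obtain ⟨T₂, μ₂, l₂, R₂, t₂⟩ := ih₂ (W := W) hd.2 hc.right (by omega) R₁
    refine ⟨T₁ + T₂, _, ?_, R₂, ?_⟩
    · have := l₁.trans l₂
      simp only [Cmd.code, List.length_append]
      rwa [Nat.add_assoc] at this
    · omega
  | @ite_true s s' e c₁ c₂ hok he h₁ ih =>
    intro p μ W hd hc hW hR
    simp only [Cmd.code] at hc
    have hg := hc.right.right.right.right
    rw [← List.append_assoc] at hc
    obtain ⟨μ₁, l₁, R₁⟩ := test_leads hd.1 hc.left hR hok
    rw [if_neg he] at l₁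
    simp only [Cmd.code, List.length_append, gotoCode, List.length_cons, List.length_nil] at hW
    obtain ⟨T₂, μ₂, l₂, R₂, t₂⟩ := ih (W := W) hd.2.1 hg (by
      rw [c₁.code_length _ 0] at hW ⊢; omega) R₁
    refine ⟨(e.code 32).length + 2 + T₂, _, ?_, R₂, ?_⟩
    · have := l₁.trans l₂
      convert this using 1
      obtain ⟨L, hL⟩ : ∃ L, ∀ q, (c₁.code q).length = L := ⟨_, fun q => c₁.code_length q 0⟩
      simp only [Cmd.code, List.length_append, gotoCode, List.length_cons, List.length_nil, hL]
      omega
    · simp only [State.tick, Nat.mul_add] at t₂; omega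
  | @ite_false s s' e c₁ c₂ hok he h₁ ih =>
    intro p μ W hd hc hW hR
    simp only [Cmd.code] at hc
    have hg := hc.right.right.left
    have hj := hc.right.right.right.left
    rw [← List.append_assoc] at hc
    obtain ⟨μ₁, l₁, R₁⟩ := test_leads hd.1 hc.left hR hok
    rw [if_pos he] at l₁
    simp only [Cmd.code, List.length_append, gotoCode, List.length_cons, List.length_nil] at hW
    obtain ⟨T₂, μ₂, l₂, R₂, t₂⟩ := ih (W := W) hd.2.2 hg (by
      rw [c₂.code_length _ 0] at hW ⊢; omega) R₁
    obtain ⟨μ₃, l₃, R₃⟩ := goto_leads hj R₂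
    refine ⟨(e.code 32).length + 2 + T₂ + 3, _, ?_, R₃, ?_⟩
    · have := (l₁.trans l₂).trans l₃
      convert this using 1
      simp only [Cmd.code, List.length_append, gotoCode, List.length_cons, List.length_nil]
      omega
    · simp only [State.tick, Nat.mul_add] at t₂; omega
  | @while_true s s' s'' e c hok he h₁ h₂ ih₁ ih₂ =>
    intro p μ W hd hc hW hR
    have hc' := hc
    simp only [Cmd.code] at hc
    have hg := hc.right.right.right.left
    have hj := hc.right.right.right.right
    rw [← List.append_assoc] at hc
    obtain ⟨μ₁, l₁, R₁⟩ := test_leads hd.1 hc.left hR hok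
    rw [if_neg he] at l₁
    have hW' := hW
    simp only [Cmd.code, List.length_append, gotoCode, List.length_cons, List.length_nil] at hW
    obtain ⟨T₂, μ₂, l₂, R₂, t₂⟩ := ih₁ (W := W) hd.2 hg (by
      rw [c.code_length _ 0] at hW ⊢; omega) R₁
    obtain ⟨μ₃, l₃, R₃⟩ := goto_leads hj R₂
    -- The closing jump returns to the first line of the loop, so the remaining iterations run on
    -- the same code. The unit of time for the test, worth `W` steps, pays for the test and the
    -- jump.
    obtain ⟨T₄, μ₄, l₄, R₄, t₄⟩ := ih₂ (W := W) hd hc' hW' R₃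
    exact ⟨_, _, ((l₁.trans l₂).trans l₃).trans l₄, R₄, by
      simp only [State.tick, Nat.mul_add] at t₂; omega⟩
  | @while_false s e c hok he =>
    intro p μ W hd hc hW hR
    simp only [Cmd.code] at hc
    have hg := hc.right.right.left
    rw [← List.append_assoc] at hc
    obtain ⟨μ₁, l₁, R₁⟩ := test_leads hd.1 hc.left hR hok
    rw [if_pos he] at l₁
    simp only [Cmd.code, List.length_append, gotoCode, List.length_cons, List.length_nil] at hW
    obtain ⟨μ₃, l₃, R₃⟩ := goto_leads hg R₁
    refine ⟨(e.code 32).length + 2 + 3, _, ?_, R₃, ?_⟩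
    · convert l₁.trans l₃ using 1
      simp only [Cmd.code, List.length_append, gotoCode, List.length_cons, List.length_nil]
      omega
    · simp only [State.tick, Nat.mul_add]; omega

end DynSCC

namespace DynSCC

/-! ### Notation for expressions -/

instance : Coe Reg Expr := ⟨Expr.var⟩
instance (k : ℕ) : OfNat Expr k := ⟨Expr.const k⟩
instance : Add Expr := ⟨Expr.op .add⟩
instance : Sub Expr := ⟨Expr.op .sub⟩
instance : Mul Expr := ⟨Expr.op .mul⟩
instance : Div Expr := ⟨Expr.op .div⟩
instance : Mod Expr := ⟨Expr.op .mod⟩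
instance : AndOp Expr := ⟨Expr.op .and⟩
instance : OrOp Expr := ⟨Expr.op .or⟩
instance : HShiftLeft Expr Expr Expr := ⟨Expr.op .shl⟩

infixr:40 " ;; " => Cmd.seq

section Eval

variable (E : Env) (s : State) (a b : Expr)

@[simp] theorem Expr.eval_var (r : Reg) : (r : Expr).eval E s = s.reg r := rfl
@[simp] theorem Expr.eval_base : Expr.base.eval E s = E.base := rfl
@[simp] theorem Expr.eval_const (k : ℕ) : (Expr.const k).eval E s = k := rfl
@[simp] theorem Expr.eval_ofNat (k : ℕ) : (ofNat(k) : Expr).eval E s = OfNat.ofNat k := rfl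
@[simp] theorem Expr.eval_add : (a + b).eval E s = a.eval E s + b.eval E s := rfl
@[simp] theorem Expr.eval_sub : (a - b).eval E s = a.eval E s - b.eval E s := rfl
@[simp] theorem Expr.eval_mul : (a * b).eval E s = a.eval E s * b.eval E s := rfl
@[simp] theorem Expr.eval_div : (a / b).eval E s = a.eval E s / b.eval E s := rfl
@[simp] theorem Expr.eval_mod : (a % b).eval E s = a.eval E s % b.eval E s := rfl
@[simp] theorem Expr.eval_and : (a &&& b).eval E s = a.eval E s &&& b.eval E s := rfl
@[simp] theorem Expr.eval_or : (a ||| b).eval E s = a.eval E s ||| b.eval E s := rfl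
@[simp] theorem Expr.eval_shl : (a <<< b).eval E s = a.eval E s * 2 ^ b.eval E s :=
  Nat.shiftLeft_eq _ _
@[simp] theorem Expr.eval_lt :
    (Expr.lt a b).eval E s = if a.eval E s < b.eval E s then 1 else 0 := rfl
@[simp] theorem Expr.eval_arr (r : Arr) :
    (Expr.arr r a).eval E s = s.arr r (a.eval E s) := rfl
@[simp] theorem Expr.eval_inp : (Expr.inp a).eval E s = E.inp (a.eval E s) := rfl

@[simp] theorem Expr.ok_var (r : Reg) : (r : Expr).Ok E s := trivial
@[simp] theorem Expr.ok_base : Expr.base.Ok E s := trivial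
@[simp] theorem Expr.ok_const (k : ℕ) : (Expr.const k).Ok E s ↔ k < E.bound := Iff.rfl
@[simp] theorem Expr.ok_ofNat (k : ℕ) : (ofNat(k) : Expr).Ok E s ↔ OfNat.ofNat k < E.bound := Iff.rfl
@[simp] theorem Expr.ok_add : (a + b).Ok E s ↔
    a.Ok E s ∧ b.Ok E s ∧ a.eval E s + b.eval E s < E.bound := Iff.rfl
@[simp] theorem Expr.ok_sub : (a - b).Ok E s ↔
    a.Ok E s ∧ b.Ok E s ∧ a.eval E s - b.eval E s < E.bound := Iff.rfl
@[simp] theorem Expr.ok_mul : (a * b).Ok E s ↔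
    a.Ok E s ∧ b.Ok E s ∧ a.eval E s * b.eval E s < E.bound := Iff.rfl
@[simp] theorem Expr.ok_div : (a / b).Ok E s ↔
    a.Ok E s ∧ b.Ok E s ∧ a.eval E s / b.eval E s < E.bound := Iff.rfl
@[simp] theorem Expr.ok_mod : (a % b).Ok E s ↔
    a.Ok E s ∧ b.Ok E s ∧ a.eval E s % b.eval E s < E.bound := Iff.rfl
@[simp] theorem Expr.ok_and : (a &&& b).Ok E s ↔
    a.Ok E s ∧ b.Ok E s ∧ a.eval E s &&& b.eval E s < E.bound := Iff.rfl
@[simp] theorem Expr.ok_or : (a ||| b).Ok E s ↔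
    a.Ok E s ∧ b.Ok E s ∧ a.eval E s ||| b.eval E s < E.bound := Iff.rfl
@[simp] theorem Expr.ok_shl : (a <<< b).Ok E s ↔
    a.Ok E s ∧ b.Ok E s ∧ a.eval E s * 2 ^ b.eval E s < E.bound := by
  rw [← Nat.shiftLeft_eq]; exact Iff.rfl
@[simp] theorem Expr.ok_lt : (Expr.lt a b).Ok E s ↔ a.Ok E s ∧ b.Ok E s := Iff.rfl
@[simp] theorem Expr.ok_arr (r : Arr) : (Expr.arr r a).Ok E s ↔
    a.Ok E s ∧ E.base + 4 * a.eval E s + 3 < E.bound := Iff.rfl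
@[simp] theorem Expr.ok_inp : (Expr.inp a).Ok E s ↔
    a.Ok E s ∧ 64 ≤ a.eval E s ∧ a.eval E s < E.base := Iff.rfl

@[simp] theorem Expr.depth_var (r : Reg) : (r : Expr).depth = 1 := rfl
@[simp] theorem Expr.depth_base : Expr.base.depth = 1 := rfl
@[simp] theorem Expr.depth_const (k : ℕ) : (Expr.const k).depth = 1 := rfl
@[simp] theorem Expr.depth_ofNat (k : ℕ) : (ofNat(k) : Expr).depth = 1 := rfl
@[simp] theorem Expr.depth_add : (a + b).depth = max a.depth (b.depth + 1) := rfl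
@[simp] theorem Expr.depth_sub : (a - b).depth = max a.depth (b.depth + 1) := rfl
@[simp] theorem Expr.depth_mul : (a * b).depth = max a.depth (b.depth + 1) := rfl
@[simp] theorem Expr.depth_div : (a / b).depth = max a.depth (b.depth + 1) := rfl
@[simp] theorem Expr.depth_mod : (a % b).depth = max a.depth (b.depth + 1) := rfl
@[simp] theorem Expr.depth_and : (a &&& b).depth = max a.depth (b.depth + 1) := rfl
@[simp] theorem Expr.depth_or : (a ||| b).depth = max a.depth (b.depth + 1) := rfl
@[simp] theorem Expr.depth_shl : (a <<< b).depth = max a.depth (b.depth + 1) := rfl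
@[simp] theorem Expr.depth_lt : (Expr.lt a b).depth = max a.depth (b.depth + 1) := rfl
@[simp] theorem Expr.depth_arr (r : Arr) : (Expr.arr r a).depth = max a.depth 2 := rfl
@[simp] theorem Expr.depth_inp : (Expr.inp a).depth = a.depth := rfl

end Eval

@[simp] theorem State.set_reg (s : State) (d : Reg) (v : ℕ) (r : Reg) :
    (s.set d v).reg r = if r = d then v else s.reg r := by
  simp [State.set, Function.update_apply]
@[simp] theorem State.set_arr (s : State) (d : Reg) (v : ℕ) : (s.set d v).arr = s.arr := rfl
@[simp] theorem State.set_time (s : State) (d : Reg) (v : ℕ) :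
    (s.set d v).time = s.time + 1 := rfl
@[simp] theorem State.setArr_reg (s : State) (r : Arr) (i v : ℕ) :
    (s.setArr r i v).reg = s.reg := rfl
@[simp] theorem State.setArr_arr (s : State) (r : Arr) (i v : ℕ) (r' : Arr) :
    (s.setArr r i v).arr r' = if r' = r then Function.update (s.arr r) i v else s.arr r' := by
  simp only [State.setArr, Function.update_apply]
@[simp] theorem State.setArr_time (s : State) (r : Arr) (i v : ℕ) :
    (s.setArr r i v).time = s.time + 1 := rfl
@[simp] theorem State.tick_reg (s : State) : s.tick.reg = s.reg := rfl
@[simp] theorem State.tick_arr (s : State) : s.tick.arr = s.arr := rfl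
@[simp] theorem State.tick_time (s : State) : s.tick.time = s.time + 1 := rfl

/-! ### Weakest preconditions -/

/-- The program, started in state `s`, halts without overflow in a state that satisfies `Q`. -/
def WP (E : Env) (c : Cmd) (s : State) (Q : State → Prop) : Prop := ∃ s', Exec E c s s' ∧ Q s'

theorem WP.mono {E : Env} {c : Cmd} {s : State} {Q Q' : State → Prop} (h : WP E c s Q)
    (hQ : ∀ s', Q s' → Q' s') : WP E c s Q' := by
  obtain ⟨s', h, h'⟩ := h
  exact ⟨s', h, hQ _ h'⟩

@[simp] theorem wp_skip {E : Env} {s : State} {Q : State → Prop} : WP E .skip s Q ↔ Q s :=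
  ⟨fun ⟨_, h, hQ⟩ => by cases h; exact hQ, fun h => ⟨s, .skip s, h⟩⟩

@[simp] theorem wp_assign {E : Env} {s : State} {d : Reg} {e : Expr} {Q : State → Prop} :
    WP E (.assign d e) s Q ↔ e.Ok E s ∧ Q (s.set d (e.eval E s)) :=
  ⟨fun ⟨_, h, hQ⟩ => by cases h with | assign h => exact ⟨h, hQ⟩,
    fun h => ⟨_, .assign h.1, h.2⟩⟩

@[simp] theorem wp_store {E : Env} {s : State} {r : Arr} {i e : Expr} {Q : State → Prop} :
    WP E (.store r i e) s Q ↔ i.Ok E s ∧ e.Ok E s ∧ E.base + 4 * i.eval E s + 3 < E.bound ∧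
      Q (s.setArr r (i.eval E s) (e.eval E s)) :=
  ⟨fun ⟨_, h, hQ⟩ => by cases h with | store h h' h'' => exact ⟨h, h', h'', hQ⟩,
    fun h => ⟨_, .store h.1 h.2.1 h.2.2.1, h.2.2.2⟩⟩

@[simp] theorem wp_seq {E : Env} {s : State} {c₁ c₂ : Cmd} {Q : State → Prop} :
    WP E (c₁ ;; c₂) s Q ↔ WP E c₁ s (fun s' => WP E c₂ s' Q) :=
  ⟨fun ⟨_, h, hQ⟩ => by cases h with | seq h h' => exact ⟨_, h, _, h', hQ⟩,
    fun ⟨_, h, _, h', hQ⟩ => ⟨_, .seq h h', hQ⟩⟩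

@[simp] theorem wp_ite {E : Env} {s : State} {e : Expr} {c₁ c₂ : Cmd} {Q : State → Prop} :
    WP E (.ite e c₁ c₂) s Q ↔ e.Ok E s ∧ (e.eval E s ≠ 0 → WP E c₁ s.tick Q) ∧
      (e.eval E s = 0 → WP E c₂ s.tick Q) := by
  constructor
  · rintro ⟨_, h, hQ⟩
    cases h with
    | ite_true h h' h'' => exact ⟨h, fun _ => ⟨_, h'', hQ⟩, fun h0 => absurd h0 h'⟩
    | ite_false h h' h'' => exact ⟨h, fun h0 => absurd h' h0, fun _ => ⟨_, h'', hQ⟩⟩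
  · rintro ⟨h, h₁, h₂⟩
    by_cases h0 : e.eval E s = 0
    · obtain ⟨_, h', hQ⟩ := h₂ h0
      exact ⟨_, .ite_false h h0 h', hQ⟩
    · obtain ⟨_, h', hQ⟩ := h₁ h0
      exact ⟨_, .ite_true h h0 h', hQ⟩

/-- Total correctness with the number of iterations fixed in advance: all loops of the reduction
have a known count, so the invariant is indexed by the iteration and no variant is needed. -/
theorem wp_while {E : Env} {s : State} {e : Expr} {c : Cmd} {Q : State → Prop} (n : ℕ)
    (I : ℕ → State → Prop) (h0 : I 0 s)
    (step : ∀ i < n, ∀ s', I i s' → e.Ok E s' ∧ e.eval E s' ≠ 0 ∧ WP E c s'.tick (I (i + 1)))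
    (last : ∀ s', I n s' → e.Ok E s' ∧ e.eval E s' = 0 ∧ Q s'.tick) :
    WP E (.while e c) s Q := by
  have : ∀ k ≤ n, ∀ s, I (n - k) s → WP E (.while e c) s Q := by
    intro k
    induction k with
    | zero =>
      intro _ s hI
      obtain ⟨h1, h2, h3⟩ := last s hI
      exact ⟨_, .while_false h1 h2, h3⟩
    | succ k ih =>
      intro hk s hI
      obtain ⟨h1, h2, s', h3, h4⟩ := step _ (by omega) s hI
      obtain ⟨s'', h5, h6⟩ := ih (by omega) s' (by convert h4 using 1; omega)
      exact ⟨_, .while_true h1 h2 h3 h5, h6⟩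
  exact this n le_rfl s (by simpa using h0)

/-- The registers that a program may assign. -/
def Cmd.sets : Cmd → Reg → Bool
  | .skip, _ => false
  | .assign d _, r => decide (r = d)
  | .store _ _ _, _ => false
  | .seq c₁ c₂, r => c₁.sets r || c₂.sets r
  | .ite _ c₁ c₂, r => c₁.sets r || c₂.sets r
  | .while _ c, r => c.sets r

/-- The arrays that a program may write. -/
def Cmd.setsArr : Cmd → Arr → Bool
  | .skip, _ => false
  | .assign _ _, _ => false
  | .store d _ _, r => decide (r = d)
  | .seq c₁ c₂, r => c₁.setsArr r || c₂.setsArr r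
  | .ite _ c₁ c₂, r => c₁.setsArr r || c₂.setsArr r
  | .while _ c, r => c.setsArr r

/-- The registers and arrays that a program does not touch agree. -/
structure Cmd.Frame (c : Cmd) (s s' : State) : Prop where
  reg : ∀ r, c.sets r = false → s'.reg r = s.reg r
  arr : ∀ r, c.setsArr r = false → s'.arr r = s.arr r

theorem Exec.frame {E : Env} {c : Cmd} {s s' : State} (h : Exec E c s s') : c.Frame s s' := by
  induction h with
  | skip s => exact ⟨fun _ _ => rfl, fun _ _ => rfl⟩
  | assign h =>
    refine ⟨fun r hr => ?_, fun _ _ => rfl⟩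
    simp [Cmd.sets] at hr
    simp [hr]
  | store hi he ha =>
    refine ⟨fun _ _ => rfl, fun r hr => ?_⟩
    simp [Cmd.setsArr] at hr
    simp [hr]
  | seq h₁ h₂ ih₁ ih₂ =>
    refine ⟨fun r hr => ?_, fun r hr => ?_⟩
    · simp [Cmd.sets] at hr
      rw [ih₂.reg r hr.2, ih₁.reg r hr.1]
    · simp [Cmd.setsArr] at hr
      rw [ih₂.arr r hr.2, ih₁.arr r hr.1]
  | ite_true h he h₁ ih =>
    refine ⟨fun r hr => ?_, fun r hr => ?_⟩
    · simp [Cmd.sets] at hr; exact ih.reg r hr.1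
    · simp [Cmd.setsArr] at hr; exact ih.arr r hr.1
  | ite_false h he h₁ ih =>
    refine ⟨fun r hr => ?_, fun r hr => ?_⟩
    · simp [Cmd.sets] at hr; exact ih.reg r hr.2
    · simp [Cmd.setsArr] at hr; exact ih.arr r hr.2
  | while_true h he h₁ h₂ ih₁ ih₂ =>
    refine ⟨fun r hr => ?_, fun r hr => ?_⟩
    · rw [ih₂.reg r hr, ih₁.reg r hr]; rfl
    · rw [ih₂.arr r hr, ih₁.arr r hr]; rfl
  | while_false h he => exact ⟨fun _ _ => rfl, fun _ _ => rfl⟩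

/-- Adds to any postcondition that untouched registers and arrays keep their contents. Being
syntactic, this keeps invariants short. -/
theorem WP.frame {E : Env} {c : Cmd} {s : State} {Q : State → Prop} (h : WP E c s Q) :
    WP E c s (fun s' => c.Frame s s' ∧ Q s') := by
  obtain ⟨s', h, h'⟩ := h
  exact ⟨s', h, h.frame, h'⟩

/-- A counting loop: `v` runs through the numbers below the content of `b`. -/
def Cmd.for (v b : Reg) (c : Cmd) : Cmd :=
  .assign v 0 ;; .while (.lt v b) (c ;; .assign v (v + 1))

/-- The frame with respect to the state before the loop is available in every iteration, so an
invariant only has to mention what the body changes. -/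
theorem wp_for {E : Env} {s : State} {v b : Reg} {c : Cmd} {Q : State → Prop} {n : ℕ}
    (I : ℕ → State → Prop) (hv : c.sets v = false) (hb : c.sets b = false) (hvb : b ≠ v)
    (hn : s.reg b = n) (hnB : n < E.bound) (h0 : I 0 (s.set v 0))
    (step : ∀ i < n, ∀ s', (Cmd.for v b c).Frame s s' → s'.reg v = i → I i s' →
      WP E c s'.tick (fun s'' => I (i + 1) (s''.set v (i + 1))))
    (last : ∀ s', (Cmd.for v b c).Frame s s' → s'.reg v = n → I n s' → Q s'.tick) :
    WP E (Cmd.for v b c) s Q := by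
  rw [Cmd.for, wp_seq, wp_assign]
  refine ⟨show 0 < E.bound by omega, ?_⟩
  refine wp_while n (fun i s' => (Cmd.for v b c).Frame s s' ∧ s'.reg v = i ∧ I i s') ?_ ?_ ?_
  · refine ⟨⟨fun r hr => ?_, fun r hr => ?_⟩, by simp, h0⟩
    · simp [Cmd.for, Cmd.sets] at hr; simp [hr]
    · simp
  · rintro i hi s' ⟨hF, hi', hI⟩
    have hb' : s'.reg b = n := by
      rw [← hn]; exact hF.reg b (by simp [Cmd.for, Cmd.sets, hvb, hb])
    refine ⟨⟨trivial, trivial⟩, by simp [hi', hb', hi], ?_⟩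
    rw [wp_seq]
    refine (step i hi s' hF hi' hI).frame.mono ?_
    rintro s'' ⟨hF', hI'⟩
    have hv' : s''.reg v = i := by rw [hF'.reg v hv]; exact hi'
    rw [wp_assign]
    refine ⟨⟨trivial, show 1 < E.bound by omega,
      show s''.reg v + 1 < E.bound by omega⟩, ⟨fun r hr => ?_, fun r hr => ?_⟩, ?_, ?_⟩
    · have hr' := hr
      simp [Cmd.for, Cmd.sets] at hr
      simp only [State.set_reg, if_neg hr.1]
      rw [hF'.reg r hr.2.1, ← hF.reg r hr']; rfl
    · have hr' := hr
      simp [Cmd.for, Cmd.setsArr] at hr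
      simp only [State.set_arr]
      rw [hF'.arr r hr, ← hF.arr r hr']; rfl
    · simp [hv']
    · simpa [hv'] using hI'
  · rintro s' ⟨hF, hi', hI⟩
    have hb' : s'.reg b = n := by
      rw [← hn]; exact hF.reg b (by simp [Cmd.for, Cmd.sets, hvb, hb])
    exact ⟨⟨trivial, trivial⟩, by simp [hi', hb'], last s' hF hi' hI⟩

end DynSCC

namespace DynSCC

/-! ## Simulation of a machine, with a log of its writes -/

/-- Write the value of `e` to the simulated cell with address `a`, and log the write. -/
def logWrite (a e : Expr) : Cmd :=
  .assign .addr a ;; .assign .val e ;; .store .logAddr Reg.lp Reg.addr ;;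
  -- The log receives the old content of the cell, hence it must be written before the cell is
  -- overwritten.
  .store .logVal Reg.lp (.arr .mem Reg.addr) ;; .store .mem Reg.addr Reg.val ;;
  .assign .lp (Reg.lp + 1)

/-- The memory from which the logged writes `l - 1, …, 0` lead to `μ`. -/
def undo (la lv : ℕ → ℕ) : ℕ → Memory → Memory
  | 0, μ => μ
  | l + 1, μ => undo la lv l (Function.update μ (la l) (lv l))

/-- The simulated memory before the logged writes. -/
def State.orig (s : State) : Memory :=
  undo (s.arr .logAddr) (s.arr .logVal) (s.reg .lp) (s.arr .mem)

/-- The log leads back to `μ₀`, and its addresses are available. -/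
def State.Logged (E : Env) (μ₀ : Memory) (s : State) : Prop :=
  s.orig = μ₀ ∧ ∀ i < s.reg .lp, E.base + 4 * s.arr .logAddr i + 3 < E.bound

theorem State.Logged.congr {E : Env} {μ₀ : Memory} {s s' : State} (h : s.Logged E μ₀)
    (h1 : s'.arr = s.arr) (h2 : s'.reg .lp = s.reg .lp) : s'.Logged E μ₀ := by
  rw [State.Logged, State.orig, h1, h2]; exact h

theorem undo_congr {la lv la' lv' : ℕ → ℕ} : ∀ (l : ℕ) (μ : Memory),
    (∀ i < l, la i = la' i ∧ lv i = lv' i) → undo la lv l μ = undo la' lv' l μ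
  | 0, _, _ => rfl
  | l + 1, μ, h => by
    simp only [undo]
    rw [(h l (by omega)).1, (h l (by omega)).2]
    exact undo_congr l _ fun i hi => h i (by omega)

/-- The addresses and constants in an instruction are at most `k`. -/
def Instr.BoundedBy (k : ℕ) : Instr → Prop
  | .const d c => d ≤ k ∧ c ≤ k
  | .op _ d a b => d ≤ k ∧ a ≤ k ∧ b ≤ k
  | .load d a => d ≤ k ∧ a ≤ k
  | .store a b => a ≤ k ∧ b ≤ k
  | .jlt a b l => a ≤ k ∧ b ≤ k ∧ l ≤ k

theorem Instr.BoundedBy.mono {k k' : ℕ} (h : k ≤ k') {i : Instr} (hi : i.BoundedBy k) :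
    i.BoundedBy k' := by
  cases i <;> simp only [Instr.BoundedBy] at hi ⊢ <;> omega

theorem exists_boundedBy (P : Program) : ∃ k, P.length ≤ k ∧ ∀ i ∈ P, i.BoundedBy k := by
  induction P with
  | nil => exact ⟨0, by simp⟩
  | cons i P ih =>
    obtain ⟨k, h1, h2⟩ := ih
    obtain ⟨k', hk'⟩ : ∃ k', i.BoundedBy k' := by
      cases i with
      | const d c => exact ⟨d + c, by simp only [Instr.BoundedBy]; omega⟩
      | op o d a b => exact ⟨d + a + b, by simp only [Instr.BoundedBy]; omega⟩
      | load d a => exact ⟨d + a, by simp only [Instr.BoundedBy]; omega⟩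
      | store a b => exact ⟨a + b, by simp only [Instr.BoundedBy]; omega⟩
      | jlt a b l => exact ⟨a + b + l, by simp only [Instr.BoundedBy]; omega⟩
    refine ⟨k + k' + 1, by simp; omega, fun j hj => ?_⟩
    rcases List.mem_cons.1 hj with rfl | hj
    · exact hk'.mono (by omega)
    · exact (h2 j hj).mono (by omega)

/-- An expression for the content of the simulated cell with address `a`. -/
def cell (a : ℕ) : Expr := .arr .mem (.const a)

/-- Simulation of one instruction. -/
def simInstr : Instr → Cmd
  | .const d k => logWrite (.const d) (.const k) ;; .assign .pc (Reg.pc + 1)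
  | .op o d a b => logWrite (.const d) (.op o (cell a) (cell b)) ;; .assign .pc (Reg.pc + 1)
  | .load d a => logWrite (.const d) (.arr .mem (cell a)) ;; .assign .pc (Reg.pc + 1)
  | .store a b => logWrite (cell a) (cell b) ;; .assign .pc (Reg.pc + 1)
  | .jlt a b l => .ite (.lt (cell a) (cell b)) (.assign .pc (.const l))
      (.assign .pc (Reg.pc + 1))

/-- Simulation of the instruction at the line in register `pc`, where the listed instructions start
at line `k`. -/
def dispatch : Program → ℕ → Cmd
  | [], _ => .skip
  | i :: P, k => .ite (.lt Reg.pc (.const (k + 1))) (simInstr i) (dispatch P (k + 1))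

/-- Simulation of a program. -/
def call (P : Program) : Cmd :=
  .assign .pc 0 ;; .while (.lt Reg.pc (.const P.length)) (dispatch P 0)

theorem logWrite_shallow {a e : Expr} (ha : a.depth ≤ 28) (he : e.depth ≤ 28) :
    (logWrite a e).Shallow := by
  simp [logWrite, Cmd.Shallow, ha, he]

theorem simInstr_shallow (i : Instr) : (simInstr i).Shallow := by
  cases i with
  | const d k => exact ⟨logWrite_shallow (by simp) (by simp), by simp [Cmd.Shallow]⟩
  | op o d a b => exact ⟨logWrite_shallow (by simp) (by simp [cell, Expr.depth]),
      by simp [Cmd.Shallow]⟩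
  | load d a => exact ⟨logWrite_shallow (by simp) (by simp [cell]), by simp [Cmd.Shallow]⟩
  | store a b => exact ⟨logWrite_shallow (by simp [cell]) (by simp [cell]),
      by simp [Cmd.Shallow]⟩
  | jlt a b l => simp [simInstr, Cmd.Shallow, cell]

theorem dispatch_shallow (P : Program) : ∀ k, (dispatch P k).Shallow := by
  induction P with
  | nil => intro k; trivial
  | cons i P ih => exact fun k => ⟨by simp, simInstr_shallow i, ih _⟩

theorem call_shallow (P : Program) : (call P).Shallow :=
  ⟨by simp [Cmd.Shallow], ⟨by simp, dispatch_shallow P 0⟩⟩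

theorem dispatch_sets (P : Program) {r : Reg} (h1 : r ≠ .pc) (h2 : r ≠ .addr) (h3 : r ≠ .val)
    (h4 : r ≠ .lp) : ∀ k, (dispatch P k).sets r = false := by
  induction P with
  | nil => intro k; rfl
  | cons i P ih =>
    intro k
    have : (simInstr i).sets r = false := by
      cases i <;> simp [simInstr, Cmd.sets, logWrite, *]
    simp [dispatch, Cmd.sets, ih, this]

theorem call_sets (P : Program) {r : Reg} (h1 : r ≠ .pc) (h2 : r ≠ .addr) (h3 : r ≠ .val)
    (h4 : r ≠ .lp) : (call P).sets r = false := by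
  simp [call, Cmd.sets, dispatch_sets, *]

theorem call_setsArr (P : Program) : (call P).setsArr .clause = false := by
  have : ∀ k, (dispatch P k).setsArr .clause = false := by
    induction P with
    | nil => intro k; rfl
    | cons i P ih =>
      intro k
      have : (simInstr i).setsArr .clause = false := by
        cases i <;> simp [simInstr, Cmd.setsArr, logWrite]
      simp [dispatch, Cmd.setsArr, ih, this]
  simp [call, Cmd.setsArr, this]

/-- The value is computed after register `addr` has been set, which is why its hypotheses refer to
`s.set .addr i`. Undoing the new log entry first restores the old memory, so the log still leads
back to the same `μ₀`. -/
theorem wp_logWrite {E : Env} {s : State} {a e : Expr} {Q : State → Prop} {i v : ℕ}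
    (ha : a.Ok E s) (hi : a.eval E s = i) (he : e.Ok E (s.set .addr i))
    (hv : e.eval E (s.set .addr i) = v) (hib : E.base + 4 * i + 3 < E.bound)
    (hlp : E.base + 4 * s.reg .lp + 3 < E.bound) (h1 : 0 < E.base)
    (hQ : ∀ s', s'.arr .mem = Function.update (s.arr .mem) i v → (∀ μ₀, s.Logged E μ₀ → s'.Logged E μ₀) →
      s'.reg .lp = s.reg .lp + 1 → s'.reg .pc = s.reg .pc → s'.time = s.time + 6 → Q s') :
    WP E (logWrite a e) s Q := by
  simp only [logWrite, wp_seq, wp_assign, wp_store]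
  refine ⟨ha, ?_⟩
  rw [hi]
  refine ⟨he, ?_⟩
  rw [hv]
  simp only [Expr.ok_var, Expr.ok_arr, Expr.ok_add, Expr.ok_ofNat, Expr.eval_var,
    Expr.eval_arr, Expr.eval_add, Expr.eval_ofNat, State.set_reg, State.set_arr,
    State.setArr_reg, State.setArr_arr, reduceCtorEq, if_true, if_false, true_and]
  refine ⟨hlp, hib, hlp, hib, by omega, hQ _ (by simp) ?_ (by simp) (by simp) rfl⟩
  rintro μ₀ ⟨h2, h3⟩
  constructor
  · rw [← h2]
    simp [State.orig, undo]
    apply undo_congr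
    intro j hj
    simp [hj.ne]
  · intro j hj
    simp at hj ⊢
    rw [Function.update_apply]
    split_ifs with h4
    · exact hib
    · exact h3 j (by omega)

/-- The addresses that a machine with words below `b` and a log of length up to `l` need are
available, for programs with constants at most `k`. -/
structure Env.Room (E : Env) (k b l : ℕ) : Prop where
  base : 64 ≤ E.base
  const : E.base + 4 * k + 7 < E.bound
  word : E.base + 4 * b + 7 < E.bound
  log : E.base + 4 * l + 7 < E.bound

theorem wp_simInstr {E : Env} {s : State} {k b l : ℕ} {i : Instr} {Q : State → Prop}
    (hR : E.Room k b l) (hi : i.BoundedBy k) (hl : s.reg .lp ≤ l)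
    (hpc : s.reg .pc < k) (hb : ∀ x, s.arr .mem x < b)
    (hb' : ∀ x, i.nextMem (s.arr .mem) x < b)
    (hQ : ∀ s', s'.arr .mem = i.nextMem (s.arr .mem) → (∀ μ₀, s.Logged E μ₀ → s'.Logged E μ₀) →
      s'.reg .lp ≤ s.reg .lp + 1 → s'.reg .pc = i.nextPc (s.reg .pc) (s.arr .mem) →
      s'.time ≤ s.time + 7 → Q s') :
    WP E (simInstr i) s Q := by
  obtain ⟨r1, r2, r3, r4⟩ := hR
  have key : ∀ {d v : ℕ}, (∀ s', s'.arr .mem = Function.update (s.arr .mem) d v →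
      (∀ μ₀, s.Logged E μ₀ → s'.Logged E μ₀) →
      s'.reg .lp = s.reg .lp + 1 → s'.reg .pc = s.reg .pc → s'.time = s.time + 6 → 
      i.nextMem (s.arr .mem) = Function.update (s.arr .mem) d v →
      i.nextPc (s.reg .pc) (s.arr .mem) = s.reg .pc + 1 →
      WP E (.assign .pc (Reg.pc + 1)) s' Q) := by
    intro d v s' h1 h2 h3 h4 h5 h6 h7
    simp only [wp_assign]
    refine ⟨⟨trivial, show 1 < E.bound by omega, show s'.reg .pc + 1 < E.bound by omega⟩,
      hQ _ ?_ ?_ ?_ ?_ ?_⟩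
    · simp [h1, h6]
    · exact fun μ₀ h => (h2 μ₀ h).congr rfl (by simp)
    · simp [h3]
    · simp [h4, h7]
    · simp [h5]
  cases i with
  | const d c =>
    simp only [Instr.BoundedBy] at hi
    rw [simInstr, wp_seq]
    refine wp_logWrite (i := d) (show d < E.bound by omega) rfl (show c < E.bound by omega) rfl (by omega)
      (by omega) (by omega) fun s' h1 h2 h3 h4 h5 => key s' h1 h2 h3 h4 h5 rfl rfl
  | op o d x y =>
    simp only [Instr.BoundedBy] at hi
    rw [simInstr, wp_seq]
    have hv := hb' d
    simp only [Instr.nextMem, Function.update_self] at hv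
    refine wp_logWrite (i := d) (show d < E.bound by omega) rfl ⟨?_, ?_, ?_⟩ rfl (by omega)
      (by omega) (by omega) fun s' h1 h2 h3 h4 h5 => key s' h1 h2 h3 h4 h5 rfl rfl
    · simp [cell]; omega
    · simp [cell]; omega
    · simp [cell]; omega
  | load d x =>
    simp only [Instr.BoundedBy] at hi
    have := hb x
    rw [simInstr, wp_seq]
    refine wp_logWrite (i := d) (show d < E.bound by omega) rfl ?_ rfl (by omega)
      (by omega) (by omega) fun s' h1 h2 h3 h4 h5 => key s' h1 h2 h3 h4 h5 rfl rfl
    simp [cell]; omega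
  | store x y =>
    simp only [Instr.BoundedBy] at hi
    have := hb x
    rw [simInstr, wp_seq]
    refine wp_logWrite (by simp [cell]; omega) rfl (by simp [cell]; omega) rfl
      (by simp [cell]; omega)
      (by omega) (by omega) fun s' h1 h2 h3 h4 h5 => key s' h1 h2 h3 h4 h5 rfl rfl
  | jlt x y t =>
    simp only [Instr.BoundedBy] at hi
    simp only [simInstr, cell, wp_ite, wp_assign, Expr.ok_lt, Expr.ok_arr, Expr.ok_const,
      Expr.eval_const, Expr.eval_lt, Expr.eval_arr, Expr.ok_add, Expr.ok_var, Expr.ok_ofNat,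
      Expr.eval_add, Expr.eval_var, Expr.eval_ofNat, State.tick_reg]
    refine ⟨by omega, fun hlt => ⟨by omega, hQ _ rfl ?_ (by simp) ?_ ?_⟩,
      fun hlt => ⟨⟨trivial, by omega, by omega⟩, hQ _ rfl ?_ (by simp) ?_ ?_⟩⟩
    · exact fun μ₀ h => h.congr rfl (by simp)
    · have : s.arr .mem x < s.arr .mem y := by by_contra h0; simp [h0] at hlt
      simp [Instr.nextPc, this]
    · simp
    · exact fun μ₀ h => h.congr rfl (by simp)
    · have : ¬ s.arr .mem x < s.arr .mem y := by by_contra h0; simp [h0] at hlt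
      simp [Instr.nextPc, this]
    · simp

/-- The instruction is found by a chain of comparisons. Since `j ≤ pc`, the test `pc < j + 1` means
`pc = j`. The cost is linear in the length of the simulated program, hence constant for a fixed
algorithm. -/
theorem wp_dispatch {E : Env} {k b l : ℕ} {P : Program} {Q : State → Prop}
    (hR : E.Room k b l) : ∀ {j : ℕ} {i : Instr} {s : State}, (∀ i ∈ P, i.BoundedBy k) →
    j + P.length ≤ k → s.reg .lp ≤ l → j ≤ s.reg .pc → P[s.reg .pc - j]? = some i →
    (∀ x, s.arr .mem x < b) → (∀ x, i.nextMem (s.arr .mem) x < b) →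
    (∀ s', s'.arr .mem = i.nextMem (s.arr .mem) → (∀ μ₀, s.Logged E μ₀ → s'.Logged E μ₀) →
      s'.reg .lp ≤ s.reg .lp + 1 → s'.reg .pc = i.nextPc (s.reg .pc) (s.arr .mem) →
      s'.time ≤ s.time + P.length + 7 → Q s') → WP E (dispatch P j) s Q := by
  induction P with
  | nil => intro j i s _ _ _ _ h; simp at h
  | cons i₀ P ih =>
    intro j i s hi hk hl hj hP hb hb' hQ
    simp only [List.length_cons] at hk
    have := hR.const
    simp only [dispatch, wp_ite, Expr.eval_lt, Expr.eval_var, Expr.eval_const, Expr.ok_lt,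
      Expr.ok_var, Expr.ok_const]
    refine ⟨⟨trivial, by omega⟩, fun h => ?_, fun h => ?_⟩
    · have h' : s.reg .pc = j := by by_contra h0; exact h (if_neg (by simp; omega))
      have : i₀ = i := by simpa [h'] using hP
      subst this
      refine wp_simInstr (s := s.tick) hR (hi _ (by simp)) hl (by simp; omega) hb hb' ?_
      intro s' h1 h2 h3 h4 h5
      exact hQ s' h1 h2 h3 h4 (by simp at h5 ⊢; omega)
    · have h' : ¬ s.reg .pc < j + 1 := by by_contra h0; simp [h0] at h
      refine ih (i := i) (s := s.tick) (fun i hi' => hi i (by simp [hi'])) (by omega) hl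
        (by simp; omega) ?_ hb hb' ?_
      · rw [show s.reg .pc - j = (s.reg .pc - (j + 1)) + 1 by omega] at hP
        simpa using hP
      · intro s' h1 h2 h3 h4 h5
        exact hQ s' h1 h2 h3 h4 (by simp at h5 ⊢; omega)

/-- A simulated run. -/
theorem wp_call {E : Env} {k b l T : ℕ} {P : Program} {μ' : Memory} {s : State}
    {Q : State → Prop} (hR : E.Room k b l) (hi : ∀ i ∈ P, i.BoundedBy k) (hk : P.length ≤ k)
    (hl : s.reg .lp + T ≤ l) (h : RunsTo P b 0 (s.arr .mem) T μ')
    (hQ : ∀ s', (call P).Frame s s' → s'.arr .mem = μ' → (∀ μ₀, s.Logged E μ₀ → s'.Logged E μ₀) →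
      s'.reg .lp ≤ s.reg .lp + T → s'.time ≤ s.time + (P.length + 8) * T + 2 → Q s') :
    WP E (call P) s Q := by
  have r1 := hR.base
  have r2 := hR.const
  have main : ∀ {pc : ℕ} {μ : Memory} {T : ℕ} {μ' : Memory}, RunsTo P b pc μ T μ' →
      ∀ s : State, s.reg .lp + T ≤ l → s.arr .mem = μ → s.reg .pc = pc →
      WP E (.while (.lt Reg.pc (.const P.length)) (dispatch P 0)) s (fun s' =>
        s'.arr .mem = μ' ∧ (∀ μ₀, s.Logged E μ₀ → s'.Logged E μ₀) ∧ s'.reg .lp ≤ s.reg .lp + T ∧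
        s'.time ≤ s.time + (P.length + 8) * T + 1) := by
    intro pc μ T μ' h
    induction h with
    | @halt pc μ hpc hμ =>
      intro s hl hmem hs
      refine ⟨_, .while_false ⟨trivial, show P.length < E.bound by omega⟩ ?_, hmem,
        fun _ h => h, by simp, by simp⟩
      exact if_neg (by simp; omega)
    | @step pc μ T μ' i hP hμ h ih =>
      intro s hl hmem hs
      -- Both constructors of the remaining run record the bound on its first memory, which is the
      -- memory after this instruction.
      have hb' : ∀ x, i.nextMem μ x < b := by cases h <;> assumption
      have hlt : pc < P.length := by
        by_contra h0
        rw [List.getElem?_eq_none (by omega)] at hP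
        simp at hP
      have := wp_dispatch (s := s.tick) (j := 0) (Q := fun s' => ∃ s'',
        Exec E (.while (.lt Reg.pc (.const P.length)) (dispatch P 0)) s' s'' ∧
        s''.arr .mem = μ' ∧ (∀ μ₀, s.Logged E μ₀ → s''.Logged E μ₀) ∧ s''.reg .lp ≤ s.reg .lp + (T + 1) ∧
        s''.time ≤ s.time + (P.length + 8) * (T + 1) + 1) hR hi (by omega)
        (by simp; omega) (by omega) (i := i) (by simpa [hs] using hP)
        (by simpa [hmem] using hμ) (by simpa [hmem] using hb') ?_
      · obtain ⟨s', h1, s'', h2, h3⟩ := this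
        exact ⟨s'', .while_true ⟨trivial, show P.length < E.bound by omega⟩
          (by rw [Expr.eval_lt, if_pos (by simp; omega)]; simp) h1 h2, h3⟩
      · intro s' h1 h2 h3 h4 h5
        simp at h3 h5
        obtain ⟨s'', e1, e2, e3, e4, e5⟩ := ih s' (by omega) (by simp [h1, hmem])
          (by simp [h4, hmem, hs])
        refine ⟨s'', e1, e2, fun μ₀ h => e3 μ₀ (h2 μ₀ h), by omega, ?_⟩
        rw [Nat.mul_add]; omega
  have : WP E (call P) s (fun s' => s'.arr .mem = μ' ∧ (∀ μ₀, s.Logged E μ₀ → s'.Logged E μ₀) ∧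
      s'.reg .lp ≤ s.reg .lp + T ∧ s'.time ≤ s.time + (P.length + 8) * T + 2) := by
    rw [call, wp_seq, wp_assign]
    refine ⟨show 0 < E.bound by omega, (main h (s.set .pc 0) (by simpa using hl) rfl
      (by simp)).mono ?_⟩
    rintro s' ⟨h1, h2, h3, h4⟩
    refine ⟨h1, h2, by simpa using h3, ?_⟩
    simp at h4; omega
  exact this.frame.mono fun s' ⟨hF, h1, h2, h3, h4⟩ => hQ s' hF h1 h2 h3 h4

/-- Undo the logged writes. -/
def rollback : Cmd :=
  .while (.lt 0 Reg.lp) (.assign .lp (Reg.lp - 1) ;;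
    .store .mem (.arr .logAddr Reg.lp) (.arr .logVal Reg.lp))

/-- Each log entry costs three units: the test, the decrement and the restoring write. As a
simulated step logs at most one write, undoing a run costs no more than the order of its time. -/
theorem wp_rollback {E : Env} {b k l : ℕ} {s : State} {Q : State → Prop} (hR : E.Room k b l)
    {μ₀ : Memory} (hl : s.reg .lp ≤ l)
    (hlog : s.Logged E μ₀)
    (hQ : ∀ s', rollback.Frame s s' → s'.arr .mem = μ₀ → s'.reg .lp = 0 →
      s'.time ≤ s.time + 3 * s.reg .lp + 1 → Q s') :
    WP E rollback s Q := by
  have r1 := hR.base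
  have r2 := hR.log
  have : WP E rollback s (fun s' => s'.arr .mem = μ₀ ∧ s'.reg .lp = 0 ∧
      s'.time ≤ s.time + 3 * s.reg .lp + 1) := by
    refine wp_while (s.reg .lp) (fun i s' => s'.orig = μ₀ ∧ s'.reg .lp + i = s.reg .lp ∧
      s'.arr .logAddr = s.arr .logAddr ∧ s'.time = s.time + 3 * i) ⟨hlog.1, rfl, rfl, rfl⟩ ?_ ?_
    · rintro i hi s' ⟨h1, h2, h3, h4⟩
      obtain ⟨j, hj⟩ : ∃ j, s'.reg .lp = j + 1 := ⟨s'.reg .lp - 1, by omega⟩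
      have hlj := hlog.2 j (by omega)
      simp [h3, hj]
      refine ⟨by omega, by omega, by omega, by omega, ?_, by omega, by omega⟩
      rw [← h1]
      simp [State.orig, hj, undo, h3]
    · rintro s' ⟨h1, h2, h3, h4⟩
      have h0 : s'.reg .lp = 0 := by omega
      simp [h0]
      refine ⟨by omega, ?_, by omega⟩
      rw [← h1]; simp [State.orig, h0, undo]
  exact this.frame.mono fun s' ⟨hF, h1, h2, h3⟩ => hQ s' hF h1 h2 h3

end DynSCC

namespace DynSCC

/-! ## Strongly connected components of the graphs of the reduction -/

/-- Nothing leaves `R`, and a path that ends outside `R` stays outside and strictly lowers `rk`.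
Hence no cycle passes through a vertex outside `R`, while all of `R` is connected in both directions
through `s`. -/
theorem sccs_eq {V : Type*} {G : Digraph V} {R : Set V} {s : V} (rk : V → ℕ) (hs : s ∈ R)
    (hR : ∀ v ∈ R, Reaches G s v ∧ Reaches G v s) (hcl : ∀ u v, u ∈ R → G.Adj u v → v ∈ R)
    (hrk : ∀ u v, v ∉ R → G.Adj u v → rk v < rk u) :
    sccs G = insert R ((fun v => {v}) '' Rᶜ) := by
  classical
  have closed : ∀ {u v}, Reaches G u v → u ∈ R → v ∈ R := by
    intro u v h hu
    induction h with
    | refl => exact hu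
    | tail _ h ih => exact hcl _ _ ih h
  have rank : ∀ {u v}, Reaches G u v → v ∉ R → u = v ∨ rk v < rk u := by
    intro u v h
    induction h with
    | refl => intro _; exact Or.inl rfl
    | @tail x y h1 h2 ih =>
      intro hy
      have hx : x ∉ R := fun hx => hy (hcl _ _ hx h2)
      have := hrk _ _ hy h2
      rcases ih hx with rfl | h3
      · exact Or.inr this
      · exact Or.inr (this.trans h3)
  have comp : ∀ u, {v | Reaches G u v ∧ Reaches G v u} = if u ∈ R then R else {u} := by
    intro u
    ext v
    split_ifs with hu
    · refine ⟨fun h => closed h.1 hu, fun hv => ⟨(hR u hu).2.trans (hR v hv).1,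
        (hR v hv).2.trans (hR u hu).1⟩⟩
    · simp only [Set.mem_ofPred_eq, Set.mem_singleton_iff]
      constructor
      · rintro ⟨h1, h2⟩
        have hv : v ∉ R := fun hv => hu (closed h2 hv)
        rcases rank h1 hv with h | h
        · exact h.symm
        · rcases rank h2 hu with h' | h'
          · exact h'
          · omega
      · rintro rfl
        exact ⟨Relation.ReflTransGen.refl, Relation.ReflTransGen.refl⟩
  ext S
  simp only [sccs, Set.mem_ofPred_eq, comp, Set.mem_insert_iff, Set.mem_image, Set.mem_compl_iff]
  constructor
  · rintro ⟨u, rfl⟩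
    by_cases hu : u ∈ R
    · simp [hu]
    · exact Or.inr ⟨u, hu, by simp [hu]⟩
  · rintro (rfl | ⟨u, hu, rfl⟩)
    · exact ⟨s, by simp [hs]⟩
    · exact ⟨u, by simp [hu]⟩

/-- The parameters of the graphs of the reduction: the numbers of clauses and of partial
assignments, and whether an assignment leaves a clause open. -/
structure Layout where
  m : ℕ
  w : ℕ
  isOpen : ℕ → ℕ → Bool

/-- The number of vertices. -/
def Layout.nv (D : Layout) : ℕ := D.w + 6 * D.m + 8

/-- Adjacency when the clauses in `c` are linked to the source `0`.  Clause `j` is the vertex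
`j + 1`, and assignment `b` is the vertex `m + 1 + b`. -/
def Layout.Adj (D : Layout) (c : ℕ → Bool) (u v : ℕ) : Prop :=
  (v = 0 ∧ 0 < u) ∨
  (0 < u ∧ u < D.m + 1 ∧ D.m < v ∧ v < D.m + D.w + 1 ∧ D.isOpen (u - 1) (v - D.m - 1) = true) ∨
  (u = 0 ∧ 0 < v ∧ v < D.m + 1 ∧ c (v - 1) = true)

/-- The graph with this adjacency. -/
def Layout.graph (D : Layout) (c : ℕ → Bool) : Digraph (Fin D.nv) := ⟨fun u v => D.Adj c u v⟩

/-- The vertices reachable from the source. -/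
def Layout.Reached (D : Layout) (c : ℕ → Bool) (v : ℕ) : Prop :=
  v = 0 ∨ (0 < v ∧ v < D.m + 1 ∧ c (v - 1) = true) ∨
  (D.m < v ∧ v < D.m + D.w + 1 ∧ ∃ j < D.m, c j = true ∧ D.isOpen j (v - D.m - 1) = true)

/-- The vertex with a given number. -/
def Layout.vtx (D : Layout) (k : ℕ) : Fin D.nv :=
  ⟨k % D.nv, Nat.mod_lt _ (by simp [Layout.nv])⟩

theorem Layout.vtx_val (D : Layout) {k : ℕ} (h : k < D.nv) : (D.vtx k).val = k :=
  Nat.mod_eq_of_lt h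

/-- A vertex on no cycle. -/
def Layout.dummy (D : Layout) : ℕ := D.m + D.w + 1

/-- The deletion that all queries are about. -/
def Layout.deletion (D : Layout) : DeletionKind → Deletion D.nv
  | .edge => .edge (D.vtx D.dummy) (D.vtx 0)
  | .vertex => .vertex (D.vtx D.dummy)

/-- The number of deleted vertices. -/
def DeletionKind.count : DeletionKind → ℕ
  | .edge => 0
  | .vertex => 1

/-- Stated for a vertex type `V` with numbers `f` so as to cover both kinds of deletion. Only the
source, clauses and assignments, with their outgoing edges, have to survive. -/
theorem Layout.sccs_graph (D : Layout) (c : ℕ → Bool) {V : Type*} {G : Digraph V} (f : V → ℕ)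
    (hf : Function.Injective f) (hlt : ∀ k, k < D.m + D.w + 1 → ∃ v, f v = k)
    (hG : ∀ u v, f u < D.m + D.w + 1 → (G.Adj u v ↔ D.Adj c (f u) (f v)))
    (hG' : ∀ u v, G.Adj u v → D.Adj c (f u) (f v)) :
    sccs G = insert {v | D.Reached c (f v)} ((fun v => {v}) '' {v | D.Reached c (f v)}ᶜ) := by
  obtain ⟨s, hs⟩ := hlt 0 (by omega)
  -- Clauses have rank `1`, all others `0`: an edge into an unreached vertex cannot end in the
  -- source and cannot be a link, so it leads from a clause to an assignment.
  refine sccs_eq (s := s) (fun v => if 0 < f v ∧ f v < D.m + 1 then 1 else 0) (Or.inl hs) ?_ ?_ ?_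
  · intro v hv
    have step : ∀ {u v}, f u < D.m + D.w + 1 → D.Adj c (f u) (f v) → Reaches G u v :=
      fun h1 h2 => Relation.ReflTransGen.single ((hG _ _ h1).2 h2)
    have hlt' : f v < D.m + D.w + 1 := by
      rcases hv with h | h | h <;> omega
    constructor
    · rcases hv with h | h | ⟨h1, h2, j, hj, hc, hu⟩
      · rw [← hs] at h; rw [hf h]; exact Relation.ReflTransGen.refl
      · exact step (by omega) (Or.inr (Or.inr ⟨hs, h⟩))
      · obtain ⟨x, hx⟩ := hlt (j + 1) (by omega)
        refine Relation.ReflTransGen.trans (step (u := s) (v := x) (by omega) ?_)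
          (step (u := x) (by omega) ?_)
        · exact Or.inr (Or.inr ⟨hs, by omega, by omega, by simpa [hx] using hc⟩)
        · exact Or.inr (Or.inl ⟨by omega, by omega, h1, h2, by simpa [hx] using hu⟩)
    · by_cases h0 : f v = 0
      · rw [← hs] at h0; rw [hf h0]; exact Relation.ReflTransGen.refl
      · exact step hlt' (Or.inl ⟨hs, by omega⟩)
  · intro u v hu hadj
    rcases hG' u v hadj with h | h | h
    · exact Or.inl h.1
    · rcases hu with hu | hu | hu
      · omega
      · exact Or.inr (Or.inr ⟨h.2.2.1, h.2.2.2.1, f u - 1, by omega, hu.2.2, h.2.2.2.2⟩)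
      · omega
    · exact Or.inr (Or.inl h.2)
  · intro u v hv hadj
    rcases hG' u v hadj with h | h | h
    · exact absurd (Or.inl h.1) hv
    · have h1 : 0 < f u ∧ f u < D.m + 1 := by omega
      have h2 : ¬ (0 < f v ∧ f v < D.m + 1) := by omega
      simp only [h1, h2, if_true, if_false, and_self, zero_lt_one]
    · exact absurd (Or.inr (Or.inl h.2)) hv

/-- The components after the deletion are the set of vertices reached from the source, and
singletons. -/
theorem Layout.sccsAfter_eq (D : Layout) (c : ℕ → Bool) (κ : DeletionKind) :
    ∃ X : Set (Fin D.nv), (∀ x ∈ X, ¬ D.Reached c x) ∧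
      X.ncard + {v : Fin D.nv | D.Reached c v}.ncard + κ.count = D.nv ∧
      sccsAfter (D.graph c) (D.deletion κ) =
        insert {v : Fin D.nv | D.Reached c v} ((fun v => {v}) '' X) := by
  have hd : D.dummy < D.nv := by simp [Layout.dummy, Layout.nv]; omega
  have h0 : 0 < D.nv := by omega
  have hdv := D.vtx_val hd
  have h0v := D.vtx_val h0
  have hnr : ¬ D.Reached c D.dummy := by
    rintro (h | h | h) <;> simp only [Layout.dummy] at h <;> omega
  have hcard : {v : Fin D.nv | D.Reached c v}ᶜ.ncard + {v : Fin D.nv | D.Reached c v}.ncard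
      = D.nv := by
    rw [Nat.add_comm, Set.ncard_add_ncard_compl, Nat.card_fin]
  cases κ with
  | edge =>
    refine ⟨{v | D.Reached c v}ᶜ, fun x hx => hx, by simpa [DeletionKind.count] using hcard, ?_⟩
    refine D.sccs_graph c (G := deleteEdge (D.graph c) (D.vtx D.dummy) (D.vtx 0))
      (fun v => v.val) Fin.val_injective (fun k hk => ⟨⟨k, by simp [Layout.nv]; omega⟩, rfl⟩)
      ?_ (fun u v h => h.1)
    intro u v hu
    refine ⟨fun h => h.1, fun h => ⟨h, ?_⟩⟩
    rintro ⟨rfl, rfl⟩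
    rw [hdv] at hu
    simp [Layout.dummy] at hu
  | vertex =>
    refine ⟨{v | D.Reached c v}ᶜ \ {D.vtx D.dummy}, fun x hx => hx.1, ?_, ?_⟩
    · have := Set.ncard_sdiff_singleton_add_one (a := D.vtx D.dummy)
        (s := {v : Fin D.nv | D.Reached c v}ᶜ) (by simpa [hdv] using hnr) (Set.toFinite _)
      simp only [DeletionKind.count]; omega
    · have := D.sccs_graph c (G := deleteVertex (D.graph c) (D.vtx D.dummy))
        (fun v => v.1.val) (fun a b h => Subtype.ext (Fin.ext h))
        (fun k hk => ⟨⟨⟨k, by simp [Layout.nv]; omega⟩, fun h => by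
          have := congrArg Fin.val h
          rw [hdv] at this
          simp only [Layout.dummy] at this; omega⟩, rfl⟩)
        (fun u v _ => Iff.rfl) (fun u v h => h)
      simp only [Layout.deletion, sccsAfter]
      rw [this, Set.image_insert_eq, Set.image_image]
      congr 1
      · ext v
        simp only [Set.mem_image, Set.mem_ofPred_eq, Subtype.exists, exists_and_left,
          exists_prop, exists_eq_right_right]
        refine ⟨fun h => h.1, fun h => ⟨h, ?_⟩⟩
        rintro rfl
        exact hnr (hdv ▸ h)
      · ext S
        simp only [Set.image_singleton, Set.mem_image, Set.mem_compl_iff, Set.mem_ofPred_eq,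
          Subtype.exists, exists_and_left, exists_prop, Set.mem_sdiff, Set.mem_singleton_iff]
        constructor
        · rintro ⟨v, h1, h2, rfl⟩; exact ⟨v, ⟨h1, h2⟩, rfl⟩
        · rintro ⟨v, ⟨h1, h2⟩, rfl⟩; exact ⟨v, h1, h2, rfl⟩

/-- The number of clauses that are not linked to the source. -/
def unlinked (c : ℕ → Bool) (k : ℕ) : ℕ := ∑ j ∈ Finset.range k, if c j then 0 else 1

theorem unlinked_le (c : ℕ → Bool) (k : ℕ) : unlinked c k ≤ k := by
  calc unlinked c k ≤ ∑ j ∈ Finset.range k, 1 :=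
        Finset.sum_le_sum fun j _ => by split_ifs <;> omega
    _ = k := by simp

-- The numbers split into blocks: the source, `m` clauses, `w` assignments and `5 m + 7` spare
-- vertices. The source is always reached, spare vertices never, a clause if it is linked, and an
-- assignment if it leaves a linked clause open; the two sums count the failures in the middle
-- blocks.
open Classical in
theorem Layout.ncard_reached (D : Layout) (c : ℕ → Bool) :
    {v : Fin D.nv | D.Reached c v}.ncard + unlinked c D.m + (∑ b ∈ Finset.range D.w,
      if ∃ j < D.m, c j = true ∧ D.isOpen j b = true then 0 else 1) = 1 + D.m + D.w := by
  have h1 : {v : Fin D.nv | D.Reached c v}.ncard =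
      ∑ v ∈ Finset.range D.nv, if D.Reached c v then 1 else 0 := by
    rw [Set.ncard_eq_toFinset_card', ← Fin.sum_univ_eq_sum_range
      (fun v => if D.Reached c v then 1 else 0), Finset.card_eq_sum_ones,
      ← Finset.sum_filter]
    congr 1
    ext; simp
  have h2 : D.nv = 1 + D.m + D.w + (5 * D.m + 7) := by simp only [Layout.nv]; omega
  have e1 : ∑ v ∈ Finset.range 1, (if D.Reached c v then 1 else 0) = 1 := by
    rw [Finset.sum_range_one, if_pos (show D.Reached c 0 from Or.inl rfl)]
  have e2 : ∑ j ∈ Finset.range D.m, (if D.Reached c (1 + j) then 1 else 0) + unlinked c D.m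
      = D.m := by
    rw [unlinked, ← Finset.sum_add_distrib]
    calc _ = ∑ j ∈ Finset.range D.m, 1 := Finset.sum_congr rfl fun j hj => by
          have hj := Finset.mem_range.1 hj
          have : D.Reached c (1 + j) ↔ c j = true := by
            constructor
            · rintro (h | h | h)
              · omega
              · simpa using h.2.2
              · omega
            · intro h
              exact Or.inr (Or.inl ⟨by omega, by omega, by simpa using h⟩)
          simp only [this]
          split_ifs <;> rfl
      _ = D.m := by simp
  have e3 : ∑ b ∈ Finset.range D.w, (if D.Reached c (1 + D.m + b) then 1 else 0) +
      (∑ b ∈ Finset.range D.w, if ∃ j < D.m, c j = true ∧ D.isOpen j b = true then 0 else 1)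
      = D.w := by
    rw [← Finset.sum_add_distrib]
    calc _ = ∑ b ∈ Finset.range D.w, 1 := Finset.sum_congr rfl fun b hb => by
          have hb := Finset.mem_range.1 hb
          have hs : 1 + D.m + b - D.m - 1 = b := by omega
          have : D.Reached c (1 + D.m + b) ↔
              ∃ j < D.m, c j = true ∧ D.isOpen j b = true := by
            constructor
            · rintro (h | h | h)
              · omega
              · omega
              · simpa only [hs] using h.2.2
            · intro h
              exact Or.inr (Or.inr ⟨by omega, by omega, by simpa only [hs] using h⟩)
          simp only [this]
          split_ifs <;> rfl
      _ = D.w := by simp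
  have e4 : ∑ x ∈ Finset.range (5 * D.m + 7),
      (if D.Reached c (1 + D.m + D.w + x) then 1 else 0) = 0 := by
    refine Finset.sum_eq_zero fun x _ => if_neg ?_
    rintro (h | h | h) <;> omega
  rw [h1, h2, Finset.sum_range_add, Finset.sum_range_add, Finset.sum_range_add, e1, e4]
  omega

/-- Few vertices are reached from the source if and only if some assignment leaves none of the
linked clauses open. -/
theorem Layout.ncard_reached_lt_iff (D : Layout) (c : ℕ → Bool) :
    {v : Fin D.nv | D.Reached c v}.ncard + unlinked c D.m < 1 + D.m + D.w ↔
      ∃ b < D.w, ∀ j < D.m, c j = true → D.isOpen j b = false := by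
  classical
  have h := D.ncard_reached c
  constructor
  · intro h1
    by_contra h2
    have h2' : ∀ b < D.w, ∃ j < D.m, c j = true ∧ D.isOpen j b = true := by
      intro b hb
      by_contra h3
      exact h2 ⟨b, hb, fun j hj hc => by
        by_contra h4; exact h3 ⟨j, hj, hc, by simpa using h4⟩⟩
    have := Finset.sum_eq_zero (s := Finset.range D.w)
      (f := fun b => if ∃ j < D.m, c j = true ∧ D.isOpen j b = true then 0 else 1)
      fun b hb => if_pos (h2' b (Finset.mem_range.1 hb))
    omega
  · rintro ⟨b, hb, h1⟩
    have := Finset.single_le_sum (s := Finset.range D.w)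
      (f := fun b => if ∃ j < D.m, c j = true ∧ D.isOpen j b = true then 0 else 1)
      (fun _ _ => Nat.zero_le _) (Finset.mem_range.2 hb)
    rw [if_neg] at this
    · omega
    · rintro ⟨j, hj, hc, hu⟩
      simp [h1 j hj hc] at hu

/-- What a correct answer tells. -/
theorem Layout.answer (D : Layout) (c : ℕ → Bool) (κ : DeletionKind) :
    (sccsAfter (D.graph c) (D.deletion κ)).ncard + {v : Fin D.nv | D.Reached c v}.ncard + κ.count
      = D.nv + 1 ∧
    sSup ((fun S => S.ncard) '' sccsAfter (D.graph c) (D.deletion κ)) =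
      {v : Fin D.nv | D.Reached c v}.ncard := by
  obtain ⟨X, h1, h2, h3⟩ := D.sccsAfter_eq c κ
  have h0 : D.Reached c (D.vtx 0) := Or.inl (D.vtx_val (by simp [Layout.nv]))
  -- The component of the source is not empty, so no singleton is larger and it is a largest
  -- component.
  have hpos : 1 ≤ {v : Fin D.nv | D.Reached c v}.ncard := by
    rw [Nat.one_le_iff_ne_zero, ← Nat.pos_iff_ne_zero, Set.ncard_pos]
    exact ⟨_, h0⟩
  rw [h3]
  constructor
  · rw [Set.ncard_insert_of_notMem, Set.ncard_image_of_injective _ Set.singleton_injective]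
    · omega
    · rintro ⟨x, hx, hx'⟩
      have : D.vtx 0 ∈ ({x} : Set (Fin D.nv)) := by
        have h0' : D.vtx 0 ∈ {v : Fin D.nv | D.Reached c v} := h0
        rw [← hx'] at h0'; exact h0'
      rw [← Set.mem_singleton_iff.1 this] at hx
      exact h1 _ hx h0
  · refine IsGreatest.csSup_eq ⟨⟨_, Set.mem_insert _ _, rfl⟩, ?_⟩
    rintro _ ⟨S, rfl | ⟨x, -, rfl⟩, rfl⟩
    · exact le_rfl
    · simpa using hpos

/-- The outer list has one entry for each component, so a report of all components contains their
number as the length of that list; the inner lists need not be read. -/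
theorem reports_length {n : ℕ} {μ : Memory} {F : Set (Set (Fin n))} (h : Reports μ F) :
    ∃ heads : List ℕ, IsLinkedList μ (μ 0) heads ∧ heads.length = F.ncard := by
  classical
  obtain ⟨heads, L, h1, h2, -, h3, h4⟩ := h
  refine ⟨heads, h1, ?_⟩
  rw [h2.length_eq, ← h4, ← List.length_map (as := L) (fun l => {x | x ∈ l}),
    ← List.toFinset_card_of_nodup h3, ← Set.ncard_coe_finset]
  congr 1
  ext S
  simp [eq_comm]

end DynSCC

namespace DynSCC

/-! ## Sequences of operations -/

/-- Determinism of the machine. It identifies the states that an algorithm reaches on different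
sequences of operations with a common beginning. -/
theorem RunsTo.unique {P : Program} {B pc T T' : ℕ} {μ μ' μ'' : Memory}
    (h : RunsTo P B pc μ T μ') (h' : RunsTo P B pc μ T' μ'') : T = T' ∧ μ' = μ'' := by
  induction h generalizing T' with
  | halt hpc hμ =>
    cases h' with
    | halt => exact ⟨rfl, rfl⟩
    | step i hi => rw [List.getElem?_eq_none hpc] at hi; simp at hi
  | step i hi hμ h ih =>
    cases h' with
    | halt hpc => rw [List.getElem?_eq_none hpc] at hi; simp at hi
    | step i' hi' _ h2 =>
      rw [hi] at hi'
      cases hi'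
      obtain ⟨rfl, rfl⟩ := ih h2
      exact ⟨rfl, rfl⟩

/-- Serving the operations leads from memory `μ` to memory `μ'` in `t` steps. -/
def DynAlg.Steps (A : DynAlg) (B : ℕ) {n : ℕ} : Memory → List (Op n) → Memory → ℕ → Prop
  | μ, [], μ', t => μ' = μ ∧ t = 0
  | μ, o :: os, μ', t => ∃ T μ₁ t', RunsTo (A.prog o) B 0 (writeArgs o.args μ) T μ₁ ∧
      A.Steps B μ₁ os μ' t' ∧ t = T + t'

/-- The graph after a sequence of operations. -/
def applyAll {n : ℕ} (G : Digraph (Fin n)) (os : List (Op n)) : Digraph (Fin n) :=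
  os.foldl Op.apply G

theorem DynAlg.Steps.unique {A : DynAlg} {B n : ℕ} {os : List (Op n)} :
    ∀ {μ μ' μ'' : Memory} {t t' : ℕ}, A.Steps B μ os μ' t → A.Steps B μ os μ'' t' →
      μ' = μ'' ∧ t = t' := by
  induction os with
  | nil => rintro μ μ' μ'' t t' ⟨rfl, rfl⟩ ⟨rfl, rfl⟩; exact ⟨rfl, rfl⟩
  | cons o os ih =>
    rintro μ μ' μ'' t t' ⟨T, μ₁, t₁, h1, h2, rfl⟩ ⟨T', μ₁', t₁', h1', h2', rfl⟩
    obtain ⟨rfl, rfl⟩ := h1.unique h1'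
    obtain ⟨rfl, rfl⟩ := ih h2 h2'
    exact ⟨rfl, rfl⟩

theorem DynAlg.Steps.append {A : DynAlg} {B n : ℕ} {os os' : List (Op n)} :
    ∀ {μ μ' μ'' : Memory} {t t' : ℕ}, A.Steps B μ os μ' t → A.Steps B μ' os' μ'' t' →
      A.Steps B μ (os ++ os') μ'' (t + t') := by
  induction os with
  | nil => rintro μ μ' μ'' t t' ⟨rfl, rfl⟩ h; simpa using h
  | cons o os ih =>
    rintro μ μ' μ'' t t' ⟨T, μ₁, t₁, h1, h2, rfl⟩ h
    exact ⟨T, μ₁, _, h1, ih h2 h, by omega⟩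

theorem DynAlg.Serves.split {A : DynAlg} {B : ℕ} {τ : QueryType} {n : ℕ} {os os' : List (Op n)} :
    ∀ {G : Digraph (Fin n)} {μ : Memory} {Ts : List ℕ}, A.Serves B τ G μ (os ++ os') Ts →
    ∃ μ' Ts₁ Ts₂, A.Steps B μ os μ' Ts₁.sum ∧ A.Serves B τ G μ os Ts₁ ∧
      A.Serves B τ (applyAll G os) μ' os' Ts₂ ∧ Ts = Ts₁ ++ Ts₂ ∧ Ts₁.length = os.length := by
  induction os with
  | nil => intro G μ Ts h; exact ⟨μ, [], Ts, ⟨rfl, rfl⟩, .nil _ _, h, rfl, rfl⟩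
  | cons o os ih =>
    intro G μ Ts h
    cases h with
    | cons run correct rest =>
      obtain ⟨μ', Ts₁, Ts₂, h1, h2, h3, rfl, h5⟩ := ih rest
      exact ⟨μ', _, Ts₂, ⟨_, _, _, run, h1, by simp⟩, .cons run correct h2, h3, by simp,
        by simp [h5]⟩

/-- The next step of a service that has come as far as memory `μ'`. -/
theorem DynAlg.Serves.next {A : DynAlg} {B : ℕ} {τ : QueryType} {n : ℕ} {os os' : List (Op n)}
    {o : Op n} {G : Digraph (Fin n)} {μ μ' : Memory} {Ts : List ℕ} {t : ℕ}
    (h : A.Serves B τ G μ (os ++ o :: os') Ts) (ht : A.Steps B μ os μ' t) :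
    ∃ T μ'', RunsTo (A.prog o) B 0 (writeArgs o.args μ') T μ'' ∧
      (∀ x, o = Op.query x → IsAnswer μ'' (sccsAfter (applyAll G os) x) τ) ∧
      A.Steps B μ (os ++ [o]) μ'' (t + T) ∧ t + T ≤ Ts.sum := by
  obtain ⟨μ₁, Ts₁, Ts₂, h1, -, h2, rfl, -⟩ := h.split
  obtain ⟨rfl, rfl⟩ := h1.unique ht
  cases h2 with
  | cons run correct rest =>
    exact ⟨_, _, run, correct, h1.append ⟨_, _, 0, run, ⟨rfl, rfl⟩, rfl⟩, by simp⟩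

section Graphs

variable {n : ℕ}

theorem applyAll_append (G : Digraph (Fin n)) (os os' : List (Op n)) :
    applyAll G (os ++ os') = applyAll (applyAll G os) os' := by
  simp [applyAll]

theorem validSeq_append {os os' : List (Op n)} : ∀ {G : Digraph (Fin n)},
    ValidSeq G (os ++ os') ↔ ValidSeq G os ∧ ValidSeq (applyAll G os) os' := by
  induction os with
  | nil => intro G; simp [ValidSeq, applyAll]
  | cons o os ih => intro G; simp [ValidSeq, ih, applyAll, and_assoc]

theorem numUpdates_append (os os' : List (Op n)) :
    numUpdates (os ++ os') = numUpdates os + numUpdates os' := by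
  induction os with
  | nil => simp [numUpdates]
  | cons o os ih => cases o <;> simp [numUpdates, ih] <;> omega

/-- The insertions of the edges in a list. -/
def insertions (l : List (Fin n × Fin n)) : List (Op n) := l.map fun e => .insert e.1 e.2

/-- The deletions of the edges in a list. -/
def deletions (l : List (Fin n × Fin n)) : List (Op n) := l.map fun e => .delete e.1 e.2

theorem numUpdates_insertions (l : List (Fin n × Fin n)) :
    numUpdates (insertions l) = l.length := by
  induction l with
  | nil => rfl
  | cons e l ih => simpa [insertions, numUpdates] using ih

theorem numUpdates_deletions (l : List (Fin n × Fin n)) :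
    numUpdates (deletions l) = l.length := by
  induction l with
  | nil => rfl
  | cons e l ih => simpa [deletions, numUpdates] using ih

theorem adj_applyAll_insertions {l : List (Fin n × Fin n)} : ∀ {G : Digraph (Fin n)} {u v},
    (applyAll G (insertions l)).Adj u v ↔ G.Adj u v ∨ (u, v) ∈ l := by
  induction l with
  | nil => intro G u v; simp [applyAll, insertions]
  | cons e l ih =>
    intro G u v
    have := ih (G := insertEdge G e.1 e.2) (u := u) (v := v)
    simp only [applyAll, insertions, List.map_cons, List.foldl_cons, Op.apply] at this ⊢
    rw [this, List.mem_cons, Prod.ext_iff, ← or_assoc]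
    exact Iff.rfl

theorem adj_applyAll_deletions {l : List (Fin n × Fin n)} : ∀ {G : Digraph (Fin n)} {u v},
    (applyAll G (deletions l)).Adj u v ↔ G.Adj u v ∧ (u, v) ∉ l := by
  induction l with
  | nil => intro G u v; simp [applyAll, deletions]
  | cons e l ih =>
    intro G u v
    have := ih (G := deleteEdge G e.1 e.2) (u := u) (v := v)
    simp only [applyAll, deletions, List.map_cons, List.foldl_cons, Op.apply] at this ⊢
    rw [this, List.mem_cons, Prod.ext_iff, not_or, ← and_assoc]
    exact Iff.rfl

theorem validSeq_insertions {l : List (Fin n × Fin n)} : ∀ {G : Digraph (Fin n)}, l.Nodup →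
    (∀ e ∈ l, e.1 ≠ e.2 ∧ ¬ G.Adj e.1 e.2) → ValidSeq G (insertions l) := by
  induction l with
  | nil => intro G _ _; trivial
  | cons e l ih =>
    intro G h1 h2
    rw [List.nodup_cons] at h1
    refine ⟨h2 e (by simp), ih h1.2 fun e' he' => ⟨(h2 e' (by simp [he'])).1, ?_⟩⟩
    rintro (h | h)
    · exact (h2 e' (by simp [he'])).2 h
    · rw [← Prod.ext_iff] at h
      exact h1.1 (h ▸ he')

theorem validSeq_deletions {l : List (Fin n × Fin n)} : ∀ {G : Digraph (Fin n)}, l.Nodup →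
    (∀ e ∈ l, G.Adj e.1 e.2) → ValidSeq G (deletions l) := by
  induction l with
  | nil => intro G _ _; trivial
  | cons e l ih =>
    intro G h1 h2
    rw [List.nodup_cons] at h1
    refine ⟨h2 e (by simp), ih h1.2 fun e' he' => ⟨h2 e' (by simp [he']), ?_⟩⟩
    intro h
    rw [← Prod.ext_iff] at h
    exact h1.1 (h ▸ he')

/-- Enough edges are absent if all edges are confined to a small set. -/
theorem exists_absent {G : Digraph (Fin n)} {F : Finset (Fin n × Fin n)} {k : ℕ}
    (hF : ∀ u v, G.Adj u v ∨ u = v → (u, v) ∈ F) (hk : F.card + k ≤ n * n) :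
    ∃ l : List (Fin n × Fin n), l.length = k ∧ l.Nodup ∧
      ∀ e ∈ l, e.1 ≠ e.2 ∧ ¬ G.Adj e.1 e.2 := by
  classical
  have : k ≤ (Fᶜ).card := by
    rw [Finset.card_compl, Fintype.card_prod, Fintype.card_fin]; omega
  obtain ⟨S, hS, rfl⟩ := Finset.exists_subset_card_eq this
  refine ⟨S.toList, by simp, S.nodup_toList, fun e he => ?_⟩
  have he' := Finset.mem_compl.1 (hS (Finset.mem_toList.1 he))
  exact ⟨fun h => he' (hF _ _ (Or.inr h)), fun h => he' (hF _ _ (Or.inl h))⟩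

theorem list_sum_le {l : List ℕ} {b : ℝ} (h : ∀ x ∈ l, (x : ℝ) ≤ b) :
    ((l.sum : ℕ) : ℝ) ≤ l.length * b := by
  induction l with
  | nil => simp
  | cons x l ih =>
    have h1 := h x (by simp)
    have h2 := ih fun y hy => h y (by simp [hy])
    simp only [List.sum_cons, List.length_cons]
    rw [Nat.cast_add, Nat.cast_add, Nat.cast_one]
    linarith

end Graphs

/-! ## The sequences of the reduction -/

/-- The three kinds of dynamic algorithms. -/
inductive Mode
  | full | inc | dec

/-- The clauses that are linked to the source at the start. -/
def Mode.start : Mode → ℕ → Bool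
  | .dec, _ => true
  | _, _ => false

/-- The update that changes the link of a clause. -/
def Mode.op : Mode → ∀ {n : ℕ}, Fin n → Fin n → Op n
  | .dec => fun u v => .delete u v
  | _ => fun u v => .insert u v

/-- Whether the link of a clause has to be changed. -/
def Mode.sel : Mode → (ℕ → Bool) → ℕ → Bool
  | .dec, c, j => !c j
  | _, c, j => c j

instance (D : Layout) (c : ℕ → Bool) (u v : ℕ) : Decidable (D.Adj c u v) := by
  unfold Layout.Adj; infer_instance

/-- The pair of vertices number `x`. -/
def Layout.pair (D : Layout) (x : ℕ) : Fin D.nv × Fin D.nv :=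
  (D.vtx (x / D.nv), D.vtx (x % D.nv))

/-- Those of the first `k` pairs that are edges. -/
def Layout.edgesBelow (D : Layout) (c : ℕ → Bool) (k : ℕ) : List (Fin D.nv × Fin D.nv) :=
  ((List.range k).filter fun x => decide (D.Adj c (x / D.nv) (x % D.nv))).map D.pair

/-- The edges of the graph. -/
def Layout.edges (D : Layout) (c : ℕ → Bool) : List (Fin D.nv × Fin D.nv) :=
  D.edgesBelow c (D.nv * D.nv)

/-- The edges from the source to the clauses in `c` among the first `k`. -/
def Layout.links (D : Layout) (c : ℕ → Bool) (k : ℕ) : List (Fin D.nv × Fin D.nv) :=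
  ((List.range k).filter c).map fun j => (D.vtx 0, D.vtx (j + 1))

/-- The updates before the query of a trial, for the first `k` clauses. -/
def Layout.before (D : Layout) (M : Mode) (c : ℕ → Bool) (k : ℕ) : List (Op D.nv) :=
  (D.links (M.sel c) k).map fun e => M.op e.1 e.2

/-- The updates after the query of a trial, for the first `k` clauses. -/
def Layout.after (D : Layout) (M : Mode) (c : ℕ → Bool) (k : ℕ) : List (Op D.nv) :=
  match M with
  | .full => deletions (D.links c k)
  | _ => []

/-- The operations of a trial. -/
def Layout.trial (D : Layout) (M : Mode) (κ : DeletionKind) (c : ℕ → Bool) : List (Op D.nv) :=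
  D.before M c D.m ++ .query (D.deletion κ) :: D.after M c D.m

/-- The operations of the trials for a sequence of sets of clauses. -/
def Layout.trials (D : Layout) (M : Mode) (κ : DeletionKind) (c : ℕ → ℕ → Bool) (k : ℕ) :
    List (Op D.nv) :=
  (List.range k).flatMap fun a => D.trial M κ (c a)

/-- The edges given to the preprocessing. -/
def Layout.initial (D : Layout) : Mode → List (Fin D.nv × Fin D.nv)
  | .dec => D.edges Mode.dec.start
  | _ => []

/-- The operations that build the start graph, from the first `k` pairs. -/
def Layout.build (D : Layout) (M : Mode) (k : ℕ) : List (Op D.nv) :=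
  match M with
  | .dec => []
  | M => insertions (D.edgesBelow M.start k)

/-- The number of updates announced to the algorithm. -/
def Layout.updates (D : Layout) : Mode → ℕ
  | .dec => (D.edges Mode.dec.start).length
  -- Construction takes at most `(m + 2) * nv` updates and a session at most `2 * m * nv`. The
  -- number must be announced before the trials are known, so a fixed bound is used and the rest is
  -- padded.
  | _ => (3 * D.m + 3) * D.nv

section Reduction

variable (D : Layout)

theorem Layout.nv_pos : 0 < D.nv := by simp [Layout.nv]

theorem Layout.nodup_edges (c : ℕ → Bool) : (D.edges c).Nodup := by
  refine List.Nodup.map_on ?_ (List.nodup_range.filter _)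
  intro x hx y hy hxy
  simp only [List.mem_filter, List.mem_range] at hx hy
  have h1 := congrArg (fun e => e.1.val) hxy
  have h2 := congrArg (fun e => e.2.val) hxy
  simp only [Layout.pair] at h1 h2
  rw [D.vtx_val (Nat.div_lt_of_lt_mul hx.1), D.vtx_val (Nat.div_lt_of_lt_mul hy.1)] at h1
  rw [D.vtx_val (Nat.mod_lt _ D.nv_pos), D.vtx_val (Nat.mod_lt _ D.nv_pos)] at h2
  rw [← Nat.div_add_mod x D.nv, ← Nat.div_add_mod y D.nv, h1, h2]

theorem Layout.mem_edges {c : ℕ → Bool} {u v : Fin D.nv} :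
    (u, v) ∈ D.edges c ↔ (D.graph c).Adj u v := by
  simp only [Layout.edges, Layout.edgesBelow, List.mem_map, List.mem_filter, List.mem_range,
    decide_eq_true_eq, Layout.pair, Prod.mk.injEq, Layout.graph]
  constructor
  · rintro ⟨x, ⟨h1, h2⟩, rfl, rfl⟩
    rwa [D.vtx_val (Nat.div_lt_of_lt_mul h1), D.vtx_val (Nat.mod_lt _ D.nv_pos)]
  · intro h
    have e1 : (v.val + D.nv * u.val) / D.nv = u.val := by
      rw [Nat.add_mul_div_left _ _ D.nv_pos, Nat.div_eq_of_lt v.2, Nat.zero_add]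
    have e2 : (v.val + D.nv * u.val) % D.nv = v.val := by
      rw [Nat.add_mul_mod_self_left, Nat.mod_eq_of_lt v.2]
    refine ⟨v.val + D.nv * u.val, ⟨?_, by rwa [e1, e2]⟩, ?_, ?_⟩
    · calc v.val + D.nv * u.val < D.nv + D.nv * u.val := by have := v.2; omega
        _ = D.nv * (u.val + 1) := by ring
        _ ≤ D.nv * D.nv := Nat.mul_le_mul_left _ u.2
    · rw [e1]; exact Fin.ext (D.vtx_val u.2)
    · rw [e2]; exact Fin.ext (D.vtx_val v.2)

theorem Layout.adj_ne {c : ℕ → Bool} {u v : Fin D.nv} (h : (D.graph c).Adj u v) : u ≠ v := by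
  rintro rfl
  rcases h with h | h | h <;> omega

theorem Layout.ofEdges_edges (c : ℕ → Bool) : ofEdges (D.edges c) = D.graph c := by
  ext u v; exact D.mem_edges

theorem Layout.nodup_links (c : ℕ → Bool) : (D.links c D.m).Nodup := by
  refine List.Nodup.map_on ?_ (List.nodup_range.filter _)
  intro x hx y hy hxy
  simp only [List.mem_filter, List.mem_range] at hx hy
  have h2 := congrArg (fun e => e.2.val) hxy
  have : D.m + 1 < D.nv := by simp only [Layout.nv]; omega
  simp only at h2
  rw [D.vtx_val (by omega), D.vtx_val (by omega)] at h2
  omega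

theorem Layout.mem_links {c : ℕ → Bool} {u v : Fin D.nv} : (u, v) ∈ D.links c D.m ↔
    u.val = 0 ∧ 0 < v.val ∧ v.val < D.m + 1 ∧ c (v - 1) = true := by
  have hm : D.m + 1 < D.nv := by simp only [Layout.nv]; omega
  simp only [Layout.links, List.mem_map, List.mem_filter, List.mem_range, Prod.mk.injEq]
  constructor
  · rintro ⟨j, ⟨h1, h2⟩, rfl, rfl⟩
    rw [D.vtx_val (k := 0) D.nv_pos, D.vtx_val (by omega)]
    exact ⟨rfl, by omega, by omega, by simpa using h2⟩
  · rintro ⟨h1, h2, h3, h4⟩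
    refine ⟨v - 1, ⟨by omega, h4⟩, Fin.ext ?_, Fin.ext ?_⟩
    · rw [D.vtx_val D.nv_pos, h1]
    · rw [D.vtx_val (by omega)]; omega

theorem Layout.length_links_le (c : ℕ → Bool) (k : ℕ) : (D.links c k).length ≤ k := by
  rw [Layout.links, List.length_map]
  exact (List.length_filter_le _ _).trans (by simp)

/-- A set that contains all edges of the graphs. -/
def Layout.zone (D : Layout) : Finset (Fin D.nv × Fin D.nv) :=
  Finset.univ ×ˢ {D.vtx 0} ∪ (Finset.univ.filter fun u : Fin D.nv => u.val < D.m + 1) ×ˢ Finset.univ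

theorem Layout.mem_zone {c : ℕ → Bool} {u v : Fin D.nv} (h : (D.graph c).Adj u v) :
    (u, v) ∈ D.zone := by
  simp only [Layout.zone, Finset.mem_union, Finset.mem_product, Finset.mem_univ, true_and,
    Finset.mem_singleton, Finset.mem_filter, and_true]
  rcases h with h | h | h
  · left; exact Fin.ext (by rw [D.vtx_val D.nv_pos, h.1])
  · right; exact h.2.1
  · right; omega

theorem Layout.card_zone : D.zone.card ≤ (D.m + 2) * D.nv := by
  have h1 : (Finset.univ.filter fun u : Fin D.nv => u.val < D.m + 1).card ≤ D.m + 1 := by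
    calc _ ≤ (Finset.range (D.m + 1)).card :=
          Finset.card_le_card_of_injOn Fin.val (fun u hu => by simpa using hu)
            Fin.val_injective.injOn
      _ = D.m + 1 := by simp
  refine (Finset.card_union_le _ _).trans ?_
  rw [Finset.card_product, Finset.card_product, Finset.card_univ, Fintype.card_fin,
    Finset.card_singleton]
  calc _ ≤ D.nv * 1 + (D.m + 1) * D.nv := by gcongr
    _ = (D.m + 2) * D.nv := by ring

theorem Layout.length_edges_le (c : ℕ → Bool) : (D.edges c).length ≤ (D.m + 2) * D.nv := by
  rw [← List.toFinset_card_of_nodup (D.nodup_edges c)]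
  refine (Finset.card_le_card fun e he => ?_).trans D.card_zone
  exact D.mem_zone (D.mem_edges.1 (List.mem_toFinset.1 he))

theorem Layout.applyAll_build (M : Mode) :
    applyAll (ofEdges (D.initial M)) (D.build M (D.nv * D.nv)) = D.graph M.start := by
  have : ∀ c, applyAll (ofEdges []) (insertions (D.edges c)) = D.graph c := by
    intro c
    ext u v
    rw [adj_applyAll_insertions, D.mem_edges]
    simp [ofEdges]
  cases M with
  | dec => exact D.ofEdges_edges _
  | inc => exact this _
  | full => exact this _

theorem Layout.validSeq_build (M : Mode) :
    ValidSeq (ofEdges (D.initial M)) (D.build M (D.nv * D.nv)) := by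
  have : ∀ c, ValidSeq (ofEdges []) (insertions (D.edges c)) := by
    intro c
    refine validSeq_insertions (D.nodup_edges c) fun e he => ⟨D.adj_ne (D.mem_edges.1 he), ?_⟩
    simp [ofEdges]
  cases M with
  | dec => trivial
  | inc => exact this _
  | full => exact this _

/-- Without deletions the links of `c` are added to a graph with no links; without insertions all
links are present at first and those outside `c` are removed. Both ways lead to the same graph. -/
theorem Layout.before_valid (M : Mode) (c : ℕ → Bool) :
    ValidSeq (D.graph M.start) (D.before M c D.m) ∧
      applyAll (D.graph M.start) (D.before M c D.m) = D.graph c := by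
  have ins : ∀ c, ValidSeq (D.graph fun _ => false) (insertions (D.links c D.m)) ∧
      applyAll (D.graph fun _ => false) (insertions (D.links c D.m)) = D.graph c := by
    intro c
    constructor
    · refine validSeq_insertions (D.nodup_links c) fun e he => ?_
      have := D.mem_links.1 he
      refine ⟨fun h => by rw [h] at this; omega, ?_⟩
      rintro (h | h | h)
      · omega
      · omega
      · simp at h
    · ext u v
      rw [adj_applyAll_insertions, D.mem_links]
      simp [Layout.graph, Layout.Adj, or_assoc]
  have del : ValidSeq (D.graph fun _ => true) (deletions (D.links (fun j => !c j) D.m)) ∧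
      applyAll (D.graph fun _ => true) (deletions (D.links (fun j => !c j) D.m)) = D.graph c := by
    constructor
    · refine validSeq_deletions (D.nodup_links _) fun e he => ?_
      have := D.mem_links.1 he
      exact Or.inr (Or.inr ⟨this.1, this.2.1, this.2.2.1, rfl⟩)
    · ext u v
      rw [adj_applyAll_deletions, D.mem_links]
      simp only [Layout.graph, Layout.Adj]
      constructor
      · rintro ⟨h | h | h, h'⟩
        · exact Or.inl h
        · exact Or.inr (Or.inl h)
        · refine Or.inr (Or.inr ⟨h.1, h.2.1, h.2.2.1, ?_⟩)
          by_contra h0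
          exact h' ⟨h.1, h.2.1, h.2.2.1, by simpa using h0⟩
      · rintro (h | h | h)
        · exact ⟨Or.inl h, by omega⟩
        · exact ⟨Or.inr (Or.inl h), by omega⟩
        · exact ⟨Or.inr (Or.inr ⟨h.1, h.2.1, h.2.2.1, trivial⟩), by simp [h.2.2.2]⟩
  cases M with
  | dec => exact del
  | inc => exact ins c
  | full => exact ins c

theorem Layout.after_valid (c : ℕ → Bool) :
    ValidSeq (D.graph c) (D.after .full c D.m) ∧
      applyAll (D.graph c) (D.after .full c D.m) = D.graph Mode.full.start := by
  constructor
  · refine validSeq_deletions (D.nodup_links c) fun e he => Or.inr (Or.inr (D.mem_links.1 he))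
  · ext u v
    simp only [Layout.after]
    rw [adj_applyAll_deletions, D.mem_links]
    simp only [Layout.graph, Layout.Adj, Mode.start]
    constructor
    · rintro ⟨h | h | h, h'⟩
      · exact Or.inl h
      · exact Or.inr (Or.inl h)
      · exact absurd h h'
    · rintro (h | h | h)
      · exact ⟨Or.inl h, by omega⟩
      · exact ⟨Or.inr (Or.inl h), by omega⟩
      · simp at h

theorem Layout.query_valid (c : ℕ → Bool) (κ : DeletionKind) :
    (Op.query (D.deletion κ)).Valid (D.graph c) := by
  cases κ with
  | vertex => trivial
  | edge =>
    refine Or.inl ⟨D.vtx_val D.nv_pos, ?_⟩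
    rw [D.vtx_val (by simp [Layout.dummy, Layout.nv]; omega)]
    simp [Layout.dummy]

theorem Layout.trials_succ (M : Mode) (κ : DeletionKind) (c : ℕ → ℕ → Bool) (k : ℕ) :
    D.trials M κ c (k + 1) = D.trials M κ c k ++ D.trial M κ (c k) := by
  simp [Layout.trials, List.range_succ]

/-- Each trial removes the links that it has inserted, so any number of trials can follow each
other. In the partially dynamic modes the graph cannot be restored, and only one trial is served
before the memory is rolled back. -/
theorem Layout.trials_full (κ : DeletionKind) (c : ℕ → ℕ → Bool) (k : ℕ) :
    ValidSeq (D.graph Mode.full.start) (D.trials .full κ c k) ∧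
      applyAll (D.graph Mode.full.start) (D.trials .full κ c k) = D.graph Mode.full.start := by
  induction k with
  | zero => exact ⟨trivial, rfl⟩
  | succ k ih =>
    obtain ⟨h1, h2⟩ := D.before_valid .full (c k)
    obtain ⟨h3, h4⟩ := D.after_valid (c k)
    rw [D.trials_succ, validSeq_append, applyAll_append, ih.2, Layout.trial, validSeq_append,
      applyAll_append, h2]
    exact ⟨⟨ih.1, h1, D.query_valid _ κ, h3⟩, h4⟩

theorem Layout.trials_one {M : Mode} (hM : M ≠ .full) (κ : DeletionKind) (c : ℕ → ℕ → Bool) :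
    D.trials M κ c 1 = D.before M (c 0) D.m ++ [.query (D.deletion κ)] := by
  cases M with
  | full => exact absurd rfl hM
  | inc => simp [Layout.trials, Layout.trial, Layout.after, List.range_succ]
  | dec => simp [Layout.trials, Layout.trial, Layout.after, List.range_succ]

theorem Layout.trials_part {M : Mode} (hM : M ≠ .full) (κ : DeletionKind) (c : ℕ → ℕ → Bool) :
    ValidSeq (D.graph M.start) (D.trials M κ c 1) ∧
      applyAll (D.graph M.start) (D.trials M κ c 1) = D.graph (c 0) := by
  obtain ⟨h1, h2⟩ := D.before_valid M (c 0)
  rw [D.trials_one hM, validSeq_append, applyAll_append, h2]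
  exact ⟨⟨h1, D.query_valid _ κ, trivial⟩, rfl⟩

end Reduction

end DynSCC

/-! ### From dynamic algorithms to a common start state followed by cheap sessions. -/

namespace DynSCC

/-- The service that the reduction relies on: `base` is reached within the stated time, and from
there on each sequence of trials is served within the stated time. -/
structure DynAlg.Supports (A : DynAlg) (τ : QueryType) (κ : DeletionKind) (M : Mode) (D : Layout)
    (B s T₀ T₁ T₂ : ℕ) (c : ℕ → ℕ → ℕ → Bool) : Prop where
  exists_runs : ∃ (μ₀ μ₁ : Memory) (t₀ t₁ : ℕ) (Ts : List ℕ),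
    RunsTo A.init B 0 (writeArgs (D.nv :: D.updates M ::
      (D.initial M).flatMap (fun e => [e.1.val, e.2.val])) 0) t₀ μ₀ ∧ t₀ ≤ T₀ ∧
    A.Serves B τ (ofEdges (D.initial M)) μ₀ (D.build M (D.nv * D.nv)) Ts ∧ Ts.sum ≤ T₁ ∧
    A.Steps B μ₀ (D.build M (D.nv * D.nv)) μ₁ t₁ ∧
    ∀ g, ∃ Ts', A.Serves B τ (D.graph M.start) μ₁ (D.trials M κ (c g) s) Ts' ∧ Ts'.sum ≤ T₂

/-- For every session `g` there is a complete legal sequence `build ++ trials ++ os`. All these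
share the preprocessing and the construction, so by determinism they pass through one memory `μ₁`,
from which each session can be started. The completion `os` only makes the sequence legal and is cut
off. -/
theorem DynAlg.supports_of {A : DynAlg} {τ : QueryType} {κ : DeletionKind} {M : Mode} {D : Layout}
    {B s T₀ T₁ T₂ : ℕ} {c : ℕ → ℕ → ℕ → Bool}
    (h : ∀ g, ∃ (os : List (Op D.nv)) (t : ℕ) (Ts : List ℕ),
      A.Performs τ (D.updates M) B (D.initial M)
        (D.build M (D.nv * D.nv) ++ (D.trials M κ (c g) s ++ os)) t Ts ∧ t ≤ T₀ ∧
      ∀ Ts₁ Ts₂ Ts₃, Ts = Ts₁ ++ (Ts₂ ++ Ts₃) → Ts₁.length = (D.build M (D.nv * D.nv)).length →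
        Ts₂.length = (D.trials M κ (c g) s).length → Ts₁.sum ≤ T₁ ∧ Ts₂.sum ≤ T₂) :
    A.Supports τ κ M D B s T₀ T₁ T₂ c := by
  obtain ⟨os, t, Ts, ⟨μ₀, h1, h2⟩, h3, h4⟩ := h 0
  obtain ⟨μ₁, Ts₁, Ts', e1, e2, e3, rfl, e5⟩ := h2.split
  obtain ⟨μ₂, Ts₂, Ts₃, -, -, -, rfl, e6⟩ := e3.split
  refine ⟨μ₀, μ₁, t, _, Ts₁, h1, h3, e2, (h4 _ _ _ rfl e5 e6).1, e1, fun g => ?_⟩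
  obtain ⟨os', t', Ts', ⟨μ₀', h1', h2'⟩, h3', h4'⟩ := h g
  obtain ⟨rfl, rfl⟩ := h1.unique h1'
  obtain ⟨μ₁', Ts₁', Ts'', e1', e2', e3', rfl, e5'⟩ := h2'.split
  obtain ⟨rfl, -⟩ := e1.unique e1'
  obtain ⟨μ₂, Ts₂', Ts₃', -, e7, -, rfl, e6'⟩ := e3'.split
  rw [D.applyAll_build] at e7
  exact ⟨_, e7, (h4' _ _ _ rfl e5' e6').2⟩

section Reduction

variable (D : Layout)

/-- The spare vertices provide enough absent edges to bring a sequence to its announced number of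
updates. -/
theorem Layout.exists_padding (c : ℕ → Bool) {k : ℕ} (hk : k ≤ (3 * D.m + 3) * D.nv) :
    ∃ l : List (Fin D.nv × Fin D.nv), l.length = k ∧ ValidSeq (D.graph c) (insertions l) := by
  classical
  have hcard : (D.zone ∪ Finset.univ.image fun x : Fin D.nv => (x, x)).card + k
      ≤ D.nv * D.nv := by
    have h1 := Finset.card_union_le D.zone (Finset.univ.image fun x : Fin D.nv => (x, x))
    have h2 := D.card_zone
    have h3 : (Finset.univ.image fun x : Fin D.nv => (x, x)).card ≤ D.nv :=
      Finset.card_image_le.trans (by simp)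
    -- The possible edges of the graph, the loops and the padding must fit among all pairs; the
    -- summand `6 * m + 8` in `nv` ensures this.
    have h4 : (D.m + 2) * D.nv + D.nv + (3 * D.m + 3) * D.nv ≤ D.nv * D.nv := by
      calc _ = (4 * D.m + 6) * D.nv := by ring
        _ ≤ D.nv * D.nv := Nat.mul_le_mul_right _ (by simp only [Layout.nv]; omega)
    omega
  obtain ⟨l, h1, h2, h3⟩ := exists_absent (G := D.graph c) (F := D.zone ∪
    Finset.univ.image fun x : Fin D.nv => (x, x)) (k := k) (by
      rintro u v (h | rfl)
      · exact Finset.mem_union_left _ (D.mem_zone h)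
      · exact Finset.mem_union_right _ (by simp)) hcard
  exact ⟨l, h1, validSeq_insertions h2 h3⟩

theorem Layout.updates_pos (M : Mode) : 0 < D.updates M := by
  cases M with
  | dec =>
    refine List.length_pos_of_mem (a := (D.vtx 1, D.vtx 0)) (D.mem_edges.2 (Or.inl ⟨?_, ?_⟩))
    · exact D.vtx_val D.nv_pos
    · rw [D.vtx_val (by simp [Layout.nv])]; omega
  | inc => exact Nat.mul_pos (by omega) D.nv_pos
  | full => exact Nat.mul_pos (by omega) D.nv_pos

theorem Layout.updates_le (M : Mode) : D.updates M ≤ (3 * D.m + 3) * D.nv := by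
  cases M with
  | dec => exact (D.length_edges_le _).trans (Nat.mul_le_mul_right _ (by omega))
  | inc => exact le_rfl
  | full => exact le_rfl

theorem deletion_kind (κ : DeletionKind) : (D.deletion κ).kind = κ := by
  cases κ <;> rfl

theorem not_query_mem_map {n : ℕ} {l : List (Fin n × Fin n)} {x : Deletion n}
    {f : Fin n → Fin n → Op n} (hf : ∀ u v, f u v ≠ .query x) :
    Op.query x ∉ l.map fun e => f e.1 e.2 := by
  simp only [List.mem_map, not_exists, not_and]
  exact fun e _ => hf _ _

theorem Layout.query_mem_trials {M : Mode} {κ : DeletionKind} {c : ℕ → ℕ → Bool} {s : ℕ}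
    {x : Deletion D.nv} (h : Op.query x ∈ D.trials M κ c s) : x.kind = κ := by
  simp only [Layout.trials, List.mem_flatMap, Layout.trial, List.mem_append, List.mem_cons] at h
  obtain ⟨a, -, h | h | h⟩ := h
  · exact absurd h (not_query_mem_map (by cases M <;> simp [Mode.op]))
  · cases h; exact deletion_kind D κ
  · cases M with
    | full => exact absurd h (not_query_mem_map (f := .delete) (by simp))
    | inc => simp [Layout.after] at h
    | dec => simp [Layout.after] at h

theorem Layout.query_not_mem_build {M : Mode} {k : ℕ} {x : Deletion D.nv} :
    Op.query x ∉ D.build M k := by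
  cases M with
  | dec => simp [Layout.build]
  | inc => exact not_query_mem_map (f := .insert) (by simp)
  | full => exact not_query_mem_map (f := .insert) (by simp)

theorem Layout.numUpdates_before (M : Mode) (c : ℕ → Bool) :
    numUpdates (D.before M c D.m) = (D.links (M.sel c) D.m).length := by
  cases M with
  | dec => exact numUpdates_deletions _
  | inc => exact numUpdates_insertions _
  | full => exact numUpdates_insertions _

theorem Layout.numUpdates_trials_le (M : Mode) (κ : DeletionKind) (c : ℕ → ℕ → Bool) (s : ℕ) :
    numUpdates (D.trials M κ c s) ≤ 2 * D.m * s := by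
  induction s with
  | zero => simp [Layout.trials, numUpdates]
  | succ s ih =>
    have h1 : numUpdates (D.before M (c s) D.m) ≤ D.m := by
      rw [D.numUpdates_before]; exact D.length_links_le _ _
    have h2 : numUpdates (D.after M (c s) D.m) ≤ D.m := by
      cases M with
      | full =>
        rw [Layout.after, numUpdates_deletions]; exact D.length_links_le _ _
      | inc => simp [Layout.after, numUpdates]
      | dec => simp [Layout.after, numUpdates]
    rw [D.trials_succ, numUpdates_append, Layout.trial, numUpdates_append]
    simp only [numUpdates]
    rw [Nat.mul_succ]; omega

theorem Layout.length_trials (M : Mode) (κ : DeletionKind) (c : ℕ → ℕ → Bool) (s : ℕ) :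
    (D.trials M κ c s).length = numUpdates (D.trials M κ c s) + s := by
  induction s with
  | zero => simp [Layout.trials, numUpdates]
  | succ s ih =>
    have h1 : (D.before M (c s) D.m).length = numUpdates (D.before M (c s) D.m) := by
      rw [D.numUpdates_before, Layout.before, List.length_map]
    have h2 : (D.after M (c s) D.m).length = numUpdates (D.after M (c s) D.m) := by
      cases M with
      | full => rw [Layout.after, numUpdates_deletions, deletions, List.length_map]
      | inc => rfl
      | dec => rfl
    rw [D.trials_succ, numUpdates_append, Layout.trial, numUpdates_append, List.length_append, ih,
      List.length_append, h1, List.length_cons, h2]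
    simp only [numUpdates]
    omega

theorem Layout.numUpdates_build_le (M : Mode) :
    numUpdates (D.build M (D.nv * D.nv)) ≤ (D.m + 2) * D.nv := by
  cases M with
  | dec => simp [Layout.build, numUpdates]
  | inc => rw [Layout.build, numUpdates_insertions]; exact D.length_edges_le _; simp
  | full => rw [Layout.build, numUpdates_insertions]; exact D.length_edges_le _; simp

theorem Layout.length_build (M : Mode) (k : ℕ) :
    (D.build M k).length = numUpdates (D.build M k) := by
  cases M with
  | dec => rfl
  | inc => exact (List.length_map _).trans (numUpdates_insertions _).symm
  | full => exact (List.length_map _).trans (numUpdates_insertions _).symm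

end Reduction

theorem sum_append_le {Ts₁ Ts₂ Ts₃ : List ℕ} :
    Ts₁.sum ≤ (Ts₁ ++ (Ts₂ ++ Ts₃)).sum ∧ Ts₂.sum ≤ (Ts₁ ++ (Ts₂ ++ Ts₃)).sum := by
  simp only [List.sum_append]; omega

/-- An amortized bound controls only the total, so the same bound serves for the construction and
for a session. With `w` trials, one query each, there are `updates + w` operations, and the bound is
spread over `w` trials. -/
theorem DynAlg.IsFullyDynamic.supports {A : DynAlg} {τ : QueryType} {κ : DeletionKind} {ε : ℝ}
    (h : A.IsFullyDynamic τ κ ε) : ∃ (C : ℝ) (t b : ℕ), ∀ (D : Layout) (c : ℕ → ℕ → ℕ → Bool),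
    A.Supports τ κ .full D ((D.nv + D.updates .full + 2) ^ b) D.w
      ⌊C * ((D.nv : ℝ) + D.updates .full) ^ t⌋₊
      ⌊(D.updates .full + D.w : ℝ) * (C * (D.updates .full : ℝ) ^ (1 - ε))⌋₊
      ⌊(D.updates .full + D.w : ℝ) * (C * (D.updates .full : ℝ) ^ (1 - ε))⌋₊ c := by
  obtain ⟨C, t, b, h⟩ := h
  refine ⟨C, t, b, fun D c => DynAlg.supports_of fun g => ?_⟩
  obtain ⟨v1, v2⟩ := D.trials_full κ (c g) D.w
  have hu : numUpdates (D.build .full (D.nv * D.nv)) + numUpdates (D.trials .full κ (c g) D.w)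
      ≤ D.updates .full := by
    have h1 := D.numUpdates_build_le .full
    have h2 := D.numUpdates_trials_le .full κ (c g) D.w
    have h3 : 2 * D.m * D.w ≤ 2 * D.m * D.nv :=
      Nat.mul_le_mul_left _ (by simp only [Layout.nv]; omega)
    calc _ ≤ (D.m + 2) * D.nv + 2 * D.m * D.nv := by omega
      _ = (3 * D.m + 2) * D.nv := by ring
      _ ≤ _ := Nat.mul_le_mul_right _ (by omega)
  obtain ⟨l, l1, l2⟩ := D.exists_padding Mode.full.start (k := D.updates .full -
    (numUpdates (D.build .full (D.nv * D.nv)) + numUpdates (D.trials .full κ (c g) D.w)))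
    (by simp only [Layout.updates]; omega)
  have hn : numUpdates (D.build .full (D.nv * D.nv) ++ (D.trials .full κ (c g) D.w ++
      insertions l)) = D.updates .full := by
    rw [numUpdates_append, numUpdates_append, numUpdates_insertions, l1]; omega
  obtain ⟨T₀, Ts, h1, h2, h3⟩ := h D.nv (D.updates .full) (D.updates_pos _)
    (D.build .full (D.nv * D.nv) ++ (D.trials .full κ (c g) D.w ++ insertions l))
    (by
      rw [validSeq_append, validSeq_append]
      refine ⟨D.validSeq_build .full, ?_⟩
      have := D.applyAll_build .full
      rw [Layout.initial] at this
      rw [this, v2]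
      exact ⟨v1, l2⟩; simp)
    (by
      intro x hx
      rcases List.mem_append.1 hx with hx | hx
      · exact absurd hx D.query_not_mem_build
      · rcases List.mem_append.1 hx with hx | hx
        · exact D.query_mem_trials hx
        · exact absurd hx (not_query_mem_map (f := .insert) (by simp))) hn
  refine ⟨_, T₀, Ts, h1, Nat.le_floor h2, ?_⟩
  have hlen : (D.build .full (D.nv * D.nv) ++ (D.trials .full κ (c g) D.w ++
      insertions l)).length = D.updates .full + D.w := by
    rw [← hn, List.length_append, List.length_append, D.length_build, D.length_trials,
      numUpdates_append, numUpdates_append, numUpdates_insertions, insertions, List.length_map]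
    omega
  rintro Ts₁ Ts₂ Ts₃ rfl - -
  have h4 : (Ts₁ ++ (Ts₂ ++ Ts₃)).sum ≤
      ⌊(D.updates .full + D.w : ℝ) * (C * (D.updates .full : ℝ) ^ (1 - ε))⌋₊ := by
    refine Nat.le_floor ?_
    rw [hlen] at h3
    exact_mod_cast h3
  exact ⟨sum_append_le.1.trans h4, sum_append_le.2.trans h4⟩

/-- The maximum with `0` allows for a negative constant in a hypothesis on running times. -/
theorem floor_sum_le {l : List ℕ} {b : ℝ} {k : ℕ} (h : ∀ x ∈ l, (x : ℝ) ≤ b)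
    (hk : l.length ≤ k) : l.sum ≤ ⌊(k : ℝ) * max b 0⌋₊ := by
  refine Nat.le_floor ?_
  calc ((l.sum : ℕ) : ℝ) ≤ l.length * max b 0 :=
        list_sum_le fun x hx => (h x hx).trans (le_max_left _ _)
    _ ≤ k * max b 0 := by gcongr

/-- Worst-case bounds hold for every part of the sequence separately: a single trial costs at most
`2 * m + 1` operations, no matter how expensive the construction was. The padding starts from the
graph of the trial, since the links stay. -/
theorem DynAlg.IsIncremental.supports {A : DynAlg} {τ : QueryType} {κ : DeletionKind} {ε : ℝ}
    (h : A.IsIncremental τ κ ε) : ∃ (C : ℝ) (t b : ℕ), ∀ (D : Layout) (c : ℕ → ℕ → ℕ → Bool),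
    A.Supports τ κ .inc D ((D.nv + D.updates .inc + 2) ^ b) 1
      ⌊C * ((D.nv : ℝ) + D.updates .inc) ^ t⌋₊
      ⌊((((D.m + 2) * D.nv : ℕ)) : ℝ) * max (C * (D.updates .inc : ℝ) ^ (1 - ε)) 0⌋₊
      ⌊((2 * D.m * 1 + 1 : ℕ) : ℝ) * max (C * (D.updates .inc : ℝ) ^ (1 - ε)) 0⌋₊ c := by
  obtain ⟨C, t, b, h⟩ := h
  refine ⟨C, t, b, fun D c => DynAlg.supports_of fun g => ?_⟩
  obtain ⟨v1, v2⟩ := D.trials_part (M := .inc) (by simp) κ (c g)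
  have h1 := D.numUpdates_build_le .inc
  have h2 := D.numUpdates_trials_le .inc κ (c g) 1
  have hu : numUpdates (D.build .inc (D.nv * D.nv)) + numUpdates (D.trials .inc κ (c g) 1)
      ≤ D.updates .inc := by
    have h3 : 2 * D.m * 1 ≤ 2 * D.m * D.nv := Nat.mul_le_mul_left _ D.nv_pos
    calc _ ≤ (D.m + 2) * D.nv + 2 * D.m * D.nv := by omega
      _ = (3 * D.m + 2) * D.nv := by ring
      _ ≤ _ := Nat.mul_le_mul_right _ (by omega)
  obtain ⟨l, l1, l2⟩ := D.exists_padding (c g 0) (k := D.updates .inc -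
    (numUpdates (D.build .inc (D.nv * D.nv)) + numUpdates (D.trials .inc κ (c g) 1)))
    (by simp only [Layout.updates]; omega)
  obtain ⟨T₀, Ts, h3, h4, h5⟩ := h D.nv (D.updates .inc) (D.updates_pos _)
    (D.build .inc (D.nv * D.nv) ++ (D.trials .inc κ (c g) 1 ++ insertions l))
    (by
      rw [validSeq_append, validSeq_append]
      refine ⟨D.validSeq_build .inc, ?_⟩
      have := D.applyAll_build .inc
      rw [Layout.initial] at this
      rw [this, v2]
      exact ⟨v1, l2⟩; simp)
    (by
      intro x hx
      rcases List.mem_append.1 hx with hx | hx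
      · exact absurd hx D.query_not_mem_build
      · rcases List.mem_append.1 hx with hx | hx
        · exact D.query_mem_trials hx
        · exact absurd hx (not_query_mem_map (f := .insert) (by simp)))
    (by
      intro o ho
      have ins : ∀ l : List (Fin D.nv × Fin D.nv), o ∈ insertions l → ¬ o.IsDelete := by
        intro l ho
        obtain ⟨e, -, rfl⟩ := List.mem_map.1 ho
        simp [Op.IsDelete]
      rw [D.trials_one (by simp)] at ho
      simp only [List.mem_append, List.mem_singleton] at ho
      rcases ho with ho | (ho | ho) | ho
      · exact ins _ ho
      · exact ins _ ho
      · subst ho; simp [Op.IsDelete]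
      · exact ins _ ho)
    (by rw [numUpdates_append, numUpdates_append, numUpdates_insertions, l1]; omega)
  refine ⟨_, T₀, Ts, h3, Nat.le_floor h4, ?_⟩
  rintro Ts₁ Ts₂ Ts₃ rfl e1 e2
  refine ⟨floor_sum_le (fun x hx => h5 x (by simp [hx])) ?_,
    floor_sum_le (fun x hx => h5 x (by simp [hx])) ?_⟩
  · rw [e1, D.length_build]; exact h1
  · rw [e2, D.length_trials]; omega

/-- Here the start graph is the input and there is nothing to build. After the query all surviving
edges are deleted, so the sequence deletes every edge exactly once. -/
theorem DynAlg.IsDecremental.supports {A : DynAlg} {τ : QueryType} {κ : DeletionKind} {ε : ℝ}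
    (h : A.IsDecremental τ κ ε) : ∃ (C : ℝ) (t b : ℕ), ∀ (D : Layout) (c : ℕ → ℕ → ℕ → Bool),
    A.Supports τ κ .dec D ((D.nv + D.updates .dec + 2) ^ b) 1
      ⌊C * ((D.nv : ℝ) + D.updates .dec) ^ t⌋₊
      ⌊((((D.m + 2) * D.nv : ℕ)) : ℝ) * max (C * (D.updates .dec : ℝ) ^ (1 - ε)) 0⌋₊
      ⌊((2 * D.m * 1 + 1 : ℕ) : ℝ) * max (C * (D.updates .dec : ℝ) ^ (1 - ε)) 0⌋₊ c := by
  classical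
  obtain ⟨C, t, b, h⟩ := h
  refine ⟨C, t, b, fun D c => DynAlg.supports_of fun g => ?_⟩
  obtain ⟨v1, v2⟩ := D.trials_part (M := .dec) (by simp) κ (c g)
  have h1 := D.numUpdates_build_le .dec
  have h2 := D.numUpdates_trials_le .dec κ (c g) 1
  have hE := D.applyAll_build .dec
  have hl : ∀ e ∈ D.links (Mode.dec.sel (c g 0)) D.m, e ∈ D.edges Mode.dec.start := by
    intro e he
    have := D.mem_links.1 he
    exact D.mem_edges.2 (Or.inr (Or.inr ⟨this.1, this.2.1, this.2.2.1, rfl⟩))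
  have hgr : ∀ e : Fin D.nv × Fin D.nv, (D.graph (c g 0)).Adj e.1 e.2 ↔
      e ∈ D.edges Mode.dec.start ∧ e ∉ D.links (Mode.dec.sel (c g 0)) D.m := by
    intro e
    rw [← (D.before_valid .dec (c g 0)).2, ← Prod.mk.eta (p := e), D.mem_edges]
    exact adj_applyAll_deletions
  obtain ⟨T₀, Ts, h3, h4, h5⟩ := h D.nv (D.updates .dec) (D.updates_pos _)
    (D.edges Mode.dec.start)
    (D.build .dec (D.nv * D.nv) ++ (D.trials .dec κ (c g) 1 ++
      deletions ((D.edges Mode.dec.start).filter fun e =>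
        decide (e ∉ D.links (Mode.dec.sel (c g 0)) D.m))))
    (D.nodup_edges _) (fun e he => D.adj_ne (D.mem_edges.1 he)) rfl
    (by
      rw [validSeq_append, validSeq_append]
      refine ⟨D.validSeq_build .dec, ?_⟩
      rw [Layout.initial] at hE
      rw [hE, v2]
      refine ⟨v1, validSeq_deletions ((D.nodup_edges _).filter _) fun e he => ?_⟩
      rw [hgr]
      simpa using he)
    (by
      intro x hx
      rcases List.mem_append.1 hx with hx | hx
      · exact absurd hx D.query_not_mem_build
      · rcases List.mem_append.1 hx with hx | hx
        · exact D.query_mem_trials hx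
        · exact absurd hx (not_query_mem_map (f := .delete) (by simp)))
    (by
      intro o ho
      have del : ∀ l : List (Fin D.nv × Fin D.nv), o ∈ deletions l → ¬ o.IsInsert := by
        intro l ho
        obtain ⟨e, -, rfl⟩ := List.mem_map.1 ho
        simp [Op.IsInsert]
      rw [D.trials_one (by simp)] at ho
      simp only [List.mem_append, List.mem_singleton] at ho
      rcases ho with ho | (ho | ho) | ho
      · simp [Layout.build] at ho
      · exact del _ ho
      · subst ho; simp [Op.IsInsert]
      · exact del _ ho)
    (by
      rw [numUpdates_append, numUpdates_append, numUpdates_deletions, D.trials_one (by simp),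
        numUpdates_append, D.numUpdates_before]
      simp only [Layout.build, numUpdates, Layout.updates]
      rw [← List.toFinset_card_of_nodup (D.nodup_edges _),
        ← List.toFinset_card_of_nodup (D.nodup_links _),
        ← List.toFinset_card_of_nodup ((D.nodup_edges _).filter _), List.toFinset_filter]
      have hs : (D.links (Mode.dec.sel (c g 0)) D.m).toFinset ⊆
          (D.edges Mode.dec.start).toFinset := fun e he => by
        rw [List.mem_toFinset] at he ⊢; exact hl e he
      -- The links deleted by the trial and the edges deleted afterwards partition the initial
      -- edges, so the number of updates is the number of edges.
      have := Finset.card_sdiff_add_card_eq_card hs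
      have h' : (D.edges Mode.dec.start).toFinset.filter (fun e =>
          decide (e ∉ D.links (Mode.dec.sel (c g 0)) D.m) = true) =
          (D.edges Mode.dec.start).toFinset \ (D.links (Mode.dec.sel (c g 0)) D.m).toFinset := by
        ext e; simp
      rw [h']
      omega)
  refine ⟨_, T₀, Ts, h3, Nat.le_floor h4, ?_⟩
  rintro Ts₁ Ts₂ Ts₃ rfl e1 e2
  refine ⟨floor_sum_le (fun x hx => h5 x (by simp [hx])) ?_,
    floor_sum_le (fun x hx => h5 x (by simp [hx])) ?_⟩
  · rw [e1, D.length_build]; exact h1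
  · rw [e2, D.length_trials]; omega

end DynSCC

namespace DynSCC

/-! ## The program of the reduction: serving operations -/

/-- An instance of the reduction: the numbers of variables, of variables of the partial assignments
in the graph, and of clauses, and the clauses as words. -/
structure Inst where
  n : ℕ
  p : ℕ
  m : ℕ
  cl : ℕ → ℕ

/-- The literals that an assignment of the first `p` variables makes true, as a word. -/
def Inst.openMask (I : Inst) (b : ℕ) : ℕ := b + (2 ^ I.p - 1 - b) * 2 ^ I.n

/-- The literals that an assignment of the other variables makes true, as a word. -/
def Inst.linkMask (I : Inst) (x : ℕ) : ℕ :=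
  x * 2 ^ I.p + (2 ^ (I.n - I.p) - 1 - x) * 2 ^ (I.n + I.p)

/-- The layout of the graphs. -/
def Inst.layout (I : Inst) : Layout :=
  ⟨I.m, 2 ^ I.p, fun j b => decide (I.cl j &&& I.openMask b = 0)⟩

/-- The clauses that an assignment of the other variables leaves open. -/
def Inst.link (I : Inst) (x j : ℕ) : Bool := decide (I.cl j &&& I.linkMask x = 0)

/-- The registers that stay fixed after the setup. -/
def constRegs : List Reg := [.n, .p, .m, .w, .nv, .ne, .s, .grp]

/-- The program leaves the fixed registers and the table of clauses alone. -/
def Cmd.Keeps (c : Cmd) : Prop :=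
  (∀ r ∈ constRegs, c.sets r = false) ∧ c.setsArr .clause = false

/-- The contents of the fixed registers and of the table of clauses. -/
structure Inst.Const (I : Inst) (sz gr : ℕ) (st : State) : Prop where
  n : st.reg .n = I.n
  p : st.reg .p = I.p
  m : st.reg .m = I.m
  w : st.reg .w = 2 ^ I.p
  nv : st.reg .nv = I.layout.nv
  ne : st.reg .ne = I.layout.nv * I.layout.nv
  s : st.reg .s = sz
  grp : st.reg .grp = gr
  cl : ∀ j < I.m, st.arr .clause j = I.cl j

theorem Inst.Const.frame {I : Inst} {sz grp : ℕ} {s s' : State} {c : Cmd}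
    (h : I.Const sz grp s) (hc : c.Keeps) (hF : c.Frame s s') : I.Const sz grp s' where
  n := by rw [hF.reg .n (hc.1 _ (by simp [constRegs])), h.n]
  p := by rw [hF.reg .p (hc.1 _ (by simp [constRegs])), h.p]
  m := by rw [hF.reg .m (hc.1 _ (by simp [constRegs])), h.m]
  w := by rw [hF.reg .w (hc.1 _ (by simp [constRegs])), h.w]
  nv := by rw [hF.reg .nv (hc.1 _ (by simp [constRegs])), h.nv]
  ne := by rw [hF.reg .ne (hc.1 _ (by simp [constRegs])), h.ne]
  s := by rw [hF.reg .s (hc.1 _ (by simp [constRegs])), h.s]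
  grp := by rw [hF.reg .grp (hc.1 _ (by simp [constRegs])), h.grp]
  cl j hj := by rw [hF.arr .clause hc.2, h.cl j hj]

/-- Words and addresses are large enough for the instance. -/
structure Env.Fits (E : Env) (I : Inst) (k b l Z : ℕ) : Prop where
  room : E.Room k b l
  bound : 64 * Z < E.bound
  base : E.base ≤ Z
  nv : I.layout.nv * I.layout.nv ≤ Z
  pow : 2 ^ (2 * I.n) ≤ Z
  le : I.p ≤ I.n

theorem Env.Fits.nv_le {E : Env} {I : Inst} {k b l Z : ℕ} (h : E.Fits I k b l Z) :
    I.layout.nv ≤ Z := (Nat.le_mul_self _).trans h.nv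

/-- Serve an operation with two arguments. -/
def call₂ (P : Program) (e₁ e₂ : Expr) : Cmd := logWrite 0 e₁ ;; logWrite 1 e₂ ;; call P

/-- Serve an operation with one argument. -/
def call₁ (P : Program) (e₁ : Expr) : Cmd := logWrite 0 e₁ ;; call P

theorem call₂_sets (P : Program) (e₁ e₂ : Expr) {r : Reg} (h1 : r ≠ .pc) (h2 : r ≠ .addr)
    (h3 : r ≠ .val) (h4 : r ≠ .lp) : (call₂ P e₁ e₂).sets r = false := by
  simp [call₂, Cmd.sets, logWrite, call_sets, *]

theorem call₁_sets (P : Program) (e₁ : Expr) {r : Reg} (h1 : r ≠ .pc) (h2 : r ≠ .addr)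
    (h3 : r ≠ .val) (h4 : r ≠ .lp) : (call₁ P e₁).sets r = false := by
  simp [call₁, Cmd.sets, logWrite, call_sets, *]

theorem call₂_setsArr (P : Program) (e₁ e₂ : Expr) :
    (call₂ P e₁ e₂).setsArr .clause = false := by
  simp [call₂, Cmd.setsArr, logWrite, call_setsArr]

theorem call₁_setsArr (P : Program) (e₁ : Expr) : (call₁ P e₁).setsArr .clause = false := by
  simp [call₁, Cmd.setsArr, logWrite, call_setsArr]

theorem call₂_shallow {P : Program} {e₁ e₂ : Expr} (h₁ : e₁.depth ≤ 28) (h₂ : e₂.depth ≤ 28) :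
    (call₂ P e₁ e₂).Shallow :=
  ⟨logWrite_shallow (by simp) h₁, logWrite_shallow (by simp) h₂, call_shallow P⟩

theorem call₁_shallow {P : Program} {e₁ : Expr} (h₁ : e₁.depth ≤ 28) :
    (call₁ P e₁).Shallow := ⟨logWrite_shallow (by simp) h₁, call_shallow P⟩

/-- The operations `os` have been served, starting with memory `μ`.  Apart from a time `T`, each
step took at most time `a`. -/
def State.At (E : Env) (A : DynAlg) (B a : ℕ) (μ : Memory) {n : ℕ} (os : List (Op n)) (T : ℕ)
    (s : State) : Prop :=
  s.Logged E μ ∧ ∃ t, A.Steps B μ os (s.arr .mem) t ∧ s.reg .lp ≤ t + 2 * os.length ∧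
    s.time ≤ T + a * (t + os.length)

theorem State.At.congr {E : Env} {A : DynAlg} {B a : ℕ} {μ : Memory} {n : ℕ} {os : List (Op n)}
    {T T' : ℕ} {s s' : State} (h : s.At E A B a μ os T) (h1 : s'.arr = s.arr)
    (h2 : s'.reg .lp = s.reg .lp) (h3 : s'.time + T ≤ s.time + T') : s'.At E A B a μ os T' := by
  obtain ⟨h4, t, h5, h6, h7⟩ := h
  exact ⟨h4.congr h1 h2, t, by rwa [h1], by rwa [h2], by omega⟩

/-- Constants that bound the programs of a dynamic algorithm. -/
structure DynAlg.BoundedBy (A : DynAlg) (k a : ℕ) : Prop where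
  const : ∀ P, P = A.init ∨ P = A.insert ∨ P = A.delete ∨ P = A.query → ∀ i ∈ P, i.BoundedBy k
  length : ∀ P, P = A.init ∨ P = A.insert ∨ P = A.delete ∨ P = A.query →
    P.length ≤ k ∧ P.length + 20 ≤ a

theorem DynAlg.exists_boundedBy (A : DynAlg) : ∃ k a, A.BoundedBy k a := by
  obtain ⟨k₁, h1, h1'⟩ := DynSCC.exists_boundedBy A.init
  obtain ⟨k₂, h2, h2'⟩ := DynSCC.exists_boundedBy A.insert
  obtain ⟨k₃, h3, h3'⟩ := DynSCC.exists_boundedBy A.delete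
  obtain ⟨k₄, h4, h4'⟩ := DynSCC.exists_boundedBy A.query
  refine ⟨k₁ + k₂ + k₃ + k₄, k₁ + k₂ + k₃ + k₄ + 20, ?_, ?_⟩
  · rintro P (rfl | rfl | rfl | rfl) i hi
    · exact (h1' i hi).mono (by omega)
    · exact (h2' i hi).mono (by omega)
    · exact (h3' i hi).mono (by omega)
    · exact (h4' i hi).mono (by omega)
  · rintro P (rfl | rfl | rfl | rfl) <;> omega

theorem DynAlg.prog_mem (A : DynAlg) {n : ℕ} (o : Op n) :
    A.prog o = A.init ∨ A.prog o = A.insert ∨ A.prog o = A.delete ∨ A.prog o = A.query := by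
  cases o <;> simp [DynAlg.prog]

theorem RunsTo.lt {P : Program} {B pc T : ℕ} {μ μ' : Memory} (h : RunsTo P B pc μ T μ') :
    ∀ z, μ' z < B := by
  induction h with
  | halt _ hμ => exact hμ
  | step _ _ _ _ ih => exact ih

section Serve

variable {E : Env} {A : DynAlg} {k b l a T n : ℕ} {τ : QueryType} {μ : Memory}
  {os os' : List (Op n)} {o : Op n} {G : Digraph (Fin n)} {Ts : List ℕ} {s : State}
  {Q : State → Prop}

/-- The arguments are written through the log, so that a rollback removes them as well. The second
expression is evaluated after the first argument has been written, hence `h1` quantifies over all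
states that agree with `s` apart from the registers used for logging. -/
theorem wp_call₂ {e₁ e₂ : Expr} {x y : ℕ} (hR : E.Room k b l) (hA : A.BoundedBy k a)
    (hS : A.Serves b τ G μ (os ++ o :: os') Ts) (hl : Ts.sum + 2 * (os.length + 1) ≤ l)
    (hs : s.At E A b a μ os T) (hx : o.args = [x, y])
    (h1 : ∀ s', (∀ r, r ≠ .addr → r ≠ .val → r ≠ .lp → s'.reg r = s.reg r) →
      (e₁.Ok E s' ∧ e₁.eval E s' = x) ∧ (e₂.Ok E s' ∧ e₂.eval E s' = y))
    (hQ : ∀ s', (call₂ (A.prog o) e₁ e₂).Frame s s' → s'.At E A b a μ (os ++ [o]) T →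
      (∀ x, o = Op.query x → IsAnswer (s'.arr .mem) (sccsAfter (applyAll G os) x) τ ∧
        ∀ z, s'.arr .mem z < b) → Q s') :
    WP E (call₂ (A.prog o) e₁ e₂) s Q := by
  obtain ⟨r1, r2, r3, r4⟩ := hR
  obtain ⟨hL, t, hst, hlp, ht⟩ := hs
  obtain ⟨T', μ'', hrun, hcor, hst', hsum⟩ := hS.next hst
  have hlen := (hA.length _ (A.prog_mem o)).2
  have : WP E (call₂ (A.prog o) e₁ e₂) s (fun s' => s'.At E A b a μ (os ++ [o]) T ∧
      (∀ x, o = Op.query x → IsAnswer (s'.arr .mem) (sccsAfter (applyAll G os) x) τ ∧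
        ∀ z, s'.arr .mem z < b)) := by
    rw [call₂, wp_seq]
    obtain ⟨h3, h3'⟩ := (h1 (s.set .addr 0) (fun r hr _ _ => by simp [hr])).1
    refine WP.mono (WP.frame (Q := fun s' => s'.arr .mem = Function.update (s.arr .mem) 0 x ∧
      s'.Logged E μ ∧ s'.reg .lp = s.reg .lp + 1 ∧ s'.time = s.time + 6) ?_) ?_
    · refine wp_logWrite (i := 0) (v := x) (by simp; omega) rfl h3 h3' (by omega) (by omega)
        (by omega) ?_
      intro s' e1 e2 e3 _ e5
      exact ⟨e1, e2 μ hL, e3, e5⟩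
    rintro s₁ ⟨hF₁, e1, e2, e3, e4⟩
    rw [wp_seq]
    obtain ⟨h4, h4'⟩ := (h1 (s₁.set .addr 1) (fun r hr hr' hr'' => by
      simp [hr]; exact hF₁.reg r (by simp [logWrite, Cmd.sets, hr, hr', hr'']))).2
    refine wp_logWrite (i := 1) (v := y) (by simp; omega) rfl h4 h4' (by omega) (by omega)
        (by omega) ?_
    intro s₂ e1' e2' e3' _ e5'
    -- The two logged writes to cells `0` and `1` are exactly the handing over of the arguments.
    have hmem : writeArgs o.args (s.arr .mem) = s₂.arr .mem := by
      rw [e1', e1, hx]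
      funext z
      rcases z with _ | _ | z <;> simp [writeArgs]
    rw [hmem] at hrun
    refine wp_call ⟨r1, r2, r3, r4⟩ (hA.const _ (A.prog_mem o)) (hA.length _ (A.prog_mem o)).1
      (by omega) hrun ?_
    intro s₃ _ e6 e7 e8 e9
    refine ⟨⟨e7 _ (e2' _ e2), t + T', by rw [e6]; exact hst', ?_, ?_⟩, fun x hx => e6 ▸ ⟨hcor x hx, hrun.lt⟩⟩
    · simp only [List.length_append, List.length_cons, List.length_nil]; omega
    · simp only [List.length_append, List.length_cons, List.length_nil]
      have h5 : ((A.prog o).length + 8) * T' ≤ a * T' := Nat.mul_le_mul_right _ (by omega)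
      have h6 : a * (t + T' + (os.length + (0 + 1))) = a * (t + os.length) + a * T' + a := by ring
      omega
  exact this.frame.mono fun s' ⟨hF, h3, h4⟩ => hQ s' hF h3 h4

theorem wp_call₁ {e₁ : Expr} {x : ℕ} (hR : E.Room k b l) (hA : A.BoundedBy k a)
    (hS : A.Serves b τ G μ (os ++ o :: os') Ts) (hl : Ts.sum + 2 * (os.length + 1) ≤ l)
    (hs : s.At E A b a μ os T) (hx : o.args = [x])
    (h1 : ∀ s', (∀ r, r ≠ .addr → r ≠ .val → r ≠ .lp → s'.reg r = s.reg r) →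
      e₁.Ok E s' ∧ e₁.eval E s' = x)
    (hQ : ∀ s', (call₁ (A.prog o) e₁).Frame s s' → s'.At E A b a μ (os ++ [o]) T →
      (∀ x, o = Op.query x → IsAnswer (s'.arr .mem) (sccsAfter (applyAll G os) x) τ ∧
        ∀ z, s'.arr .mem z < b) → Q s') :
    WP E (call₁ (A.prog o) e₁) s Q := by
  obtain ⟨r1, r2, r3, r4⟩ := hR
  obtain ⟨hL, t, hst, hlp, ht⟩ := hs
  obtain ⟨T', μ'', hrun, hcor, hst', hsum⟩ := hS.next hst
  have hlen := (hA.length _ (A.prog_mem o)).2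
  have : WP E (call₁ (A.prog o) e₁) s (fun s' => s'.At E A b a μ (os ++ [o]) T ∧
      (∀ x, o = Op.query x → IsAnswer (s'.arr .mem) (sccsAfter (applyAll G os) x) τ ∧
        ∀ z, s'.arr .mem z < b)) := by
    rw [call₁, wp_seq]
    obtain ⟨h3, h3'⟩ := h1 (s.set .addr 0) (fun r hr _ _ => by simp [hr])
    refine wp_logWrite (i := 0) (v := x) (by simp; omega) rfl h3 h3' (by omega) (by omega)
        (by omega) ?_
    intro s₂ e1' e2' e3' _ e5'
    have hmem : writeArgs o.args (s.arr .mem) = s₂.arr .mem := by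
      rw [e1', hx]
      funext z
      rcases z with _ | z <;> simp [writeArgs]
    rw [hmem] at hrun
    refine wp_call ⟨r1, r2, r3, r4⟩ (hA.const _ (A.prog_mem o)) (hA.length _ (A.prog_mem o)).1
      (by omega) hrun ?_
    intro s₃ _ e6 e7 e8 e9
    refine ⟨⟨e7 _ (e2' _ hL), t + T', by rw [e6]; exact hst', ?_, ?_⟩, fun x hx => e6 ▸ ⟨hcor x hx, hrun.lt⟩⟩
    · simp only [List.length_append, List.length_cons, List.length_nil]; omega
    · simp only [List.length_append, List.length_cons, List.length_nil]
      have h5 : ((A.prog o).length + 8) * T' ≤ a * T' := Nat.mul_le_mul_right _ (by omega)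
      have h6 : a * (t + T' + (os.length + (0 + 1))) = a * (t + os.length) + a * T' + a := by ring
      omega
  exact this.frame.mono fun s' ⟨hF, h3, h4⟩ => hQ s' hF h3 h4

end Serve

/-! ### Updates of a trial -/

/-- For each clause, count it if it is satisfied, and serve an update if it is satisfied (`pos`) or
if it is not (`¬ pos`). -/
def updateLoop (P : Program) (pos : Bool) : Cmd :=
  .for .j .m (.assign .flag (.lt 0 (.arr .clause Reg.j &&& Reg.mask)) ;;
    .assign .cnt (Reg.cnt + Reg.flag) ;;
    .ite (if pos then Reg.flag else 1 - Reg.flag) (call₂ P 0 (Reg.j + 1)) .skip)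

theorem updateLoop_sets (P : Program) (pos : Bool) {r : Reg} (h1 : r ≠ .pc) (h2 : r ≠ .addr)
    (h3 : r ≠ .val) (h4 : r ≠ .lp) (h5 : r ≠ .j) (h6 : r ≠ .flag) (h7 : r ≠ .cnt) :
    (updateLoop P pos).sets r = false := by
  simp [updateLoop, Cmd.for, Cmd.sets, call₂_sets, *]

theorem updateLoop_setsArr (P : Program) (pos : Bool) :
    (updateLoop P pos).setsArr .clause = false := by
  simp [updateLoop, Cmd.for, Cmd.setsArr, call₂_setsArr]

theorem updateLoop_keeps (P : Program) (pos : Bool) : (updateLoop P pos).Keeps :=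
  ⟨by simp [constRegs, updateLoop_sets], updateLoop_setsArr P pos⟩

theorem updateLoop_shallow (P : Program) (pos : Bool) : (updateLoop P pos).Shallow := by
  have : (call₂ P 0 (Reg.j + 1)).Shallow := call₂_shallow (by simp) (by simp)
  cases pos <;> simp [updateLoop, Cmd.for, Cmd.Shallow, this]

theorem Layout.links_succ (D : Layout) (c : ℕ → Bool) (k : ℕ) : D.links c (k + 1) =
    D.links c k ++ if c k then [(D.vtx 0, D.vtx (k + 1))] else [] := by
  rw [Layout.links, List.range_succ, List.filter_append, List.map_append]
  by_cases h : c k <;> simp [h, Layout.links]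

theorem Layout.links_prefix (D : Layout) (c : ℕ → Bool) {k k' : ℕ} (h : k ≤ k') :
    D.links c k <+: D.links c k' := by
  obtain ⟨r, rfl⟩ := Nat.exists_eq_add_of_le h
  rw [Layout.links, Layout.links, List.range_add, List.filter_append, List.map_append]
  exact List.prefix_append _ _

theorem unlinked_succ (c : ℕ → Bool) (k : ℕ) :
    unlinked c (k + 1) = unlinked c k + if c k then 0 else 1 := by
  rw [unlinked, Finset.sum_range_succ]; rfl

/-- The clause is met by the mask exactly if `x` satisfies it, so `cnt` grows by the number of
unlinked clauses. The exclusive or with `pos` turns the open clauses (insertions, or their undoing)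
into the satisfied ones (deletions in the decremental mode). The initial count `c₀` is arbitrary up
to `m` because the loop runs again after the query, when the count no longer matters and only must
not overflow. -/
theorem wp_updateLoop {E : Env} {I : Inst} {A : DynAlg} {k b l Z a T sz grp x c₀ : ℕ}
    {τ : QueryType} {μ : Memory} {os os' : List (Op I.layout.nv)} {pos : Bool}
    {f : Fin I.layout.nv → Fin I.layout.nv → Op I.layout.nv} {P : Program}
    {G : Digraph (Fin I.layout.nv)} {Ts : List ℕ} {s : State} {Q : State → Prop}
    (hE : E.Fits I k b l Z) (hA : A.BoundedBy k a) (hI : I.Const sz grp s)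
    (hx : I.linkMask x < 2 ^ (2 * I.n))
    (hf : ∀ u v, A.prog (f u v) = P ∧ (f u v).args = [u.val, v.val])
    (hS : A.Serves b τ G μ (os ++ ((I.layout.links (fun j => I.link x j ^^ pos) I.m).map
      (fun e => f e.1 e.2) ++ os')) Ts)
    (hl : Ts.sum + 2 * (os.length + I.m) ≤ l) (hc : s.reg .cnt = c₀) (hc' : c₀ ≤ I.m)
    (hmask : s.reg .mask = I.linkMask x)
    (hs : s.At E A b a μ os T)
    (hQ : ∀ s', (updateLoop P pos).Frame s s' → s'.At E A b a μ
      (os ++ (I.layout.links (fun j => I.link x j ^^ pos) I.m).map (fun e => f e.1 e.2))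
      (T + 5 * I.m + 2) → s'.reg .cnt = c₀ + unlinked (I.link x) I.m → Q s') :
    WP E (updateLoop P pos) s Q := by
  have hb := hE.bound
  have hbase := hE.base
  have hnv := hE.nv_le
  have hv : I.layout.nv = 2 ^ I.p + 6 * I.m + 8 := rfl
  have hpow := hE.pow
  have hp : 0 < 2 ^ I.p := Nat.two_pow_pos _
  have key : WP E (updateLoop P pos) s (fun s' => s'.At E A b a μ
      (os ++ (I.layout.links (fun j => I.link x j ^^ pos) I.m).map (fun e => f e.1 e.2))
      (T + 5 * I.m + 2) ∧ s'.reg .cnt = c₀ + unlinked (I.link x) I.m) := by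
    refine wp_for (n := I.m) (fun i s' => s'.At E A b a μ
      (os ++ (I.layout.links (fun j => I.link x j ^^ pos) i).map (fun e => f e.1 e.2))
      (T + 5 * i + 1) ∧ s'.reg .cnt = c₀ + unlinked (I.link x) i) ?_ ?_ (by simp) hI.m (by omega)
      ?_ ?_ ?_
    · simp [Cmd.sets, call₂_sets]
    · simp [Cmd.sets, call₂_sets]
    · refine ⟨?_, by simp [hc, unlinked]⟩
      have h0 : (I.layout.links (fun j => I.link x j ^^ pos) 0) = [] := rfl
      rw [h0, List.map_nil, List.append_nil]
      exact hs.congr rfl (by simp) (by simp; omega)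
    · rintro i hi s' hF hi' ⟨hat, hcnt⟩
      have hI' := hI.frame (updateLoop_keeps P pos) hF
      have hmask' : s'.reg .mask = I.linkMask x := by
        rw [← hmask]; exact hF.reg _ (updateLoop_sets P pos (by simp) (by simp) (by simp)
          (by simp) (by simp) (by simp) (by simp))
      have hun := unlinked_le (I.link x) i
      have hlk := I.layout.links_succ (fun j => I.link x j ^^ pos) i
      have hfl : (if 0 < I.cl i &&& I.linkMask x then 1 else 0) = (if I.link x i then 0 else 1) := by
        by_cases h : I.cl i &&& I.linkMask x = 0 <;> simp [Inst.link, h]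
      have hcnt' : c₀ + unlinked (I.link x) i + (if I.link x i then 0 else 1) =
          c₀ + unlinked (I.link x) (i + 1) := by rw [unlinked_succ, add_assoc]
      have hand : I.cl i &&& I.linkMask x < E.bound := by
        have := Nat.and_le_right (n := I.cl i) (m := I.linkMask x)
        omega
      simp only [wp_seq, wp_assign, wp_ite, wp_skip]
      refine ⟨?_, ?_, ?_, ?_, ?_⟩
      · simp [hi', hmask', hI'.cl i hi]
        exact ⟨by omega, by omega, hand⟩
      · simp [hi', hmask', hI'.cl i hi, hcnt]
        split_ifs <;> omega
      · cases pos <;> simp <;> omega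
      · intro hne
        have hsel : (I.link x i ^^ pos) = true := by
          revert hne
          cases hlx : I.link x i <;> cases pos <;> simp [hi', hmask', hI'.cl i hi, hfl, hlx]
        simp only [hsel, if_true] at hlk
        obtain ⟨rest, hrest⟩ := I.layout.links_prefix (fun j => I.link x j ^^ pos)
          (show i + 1 ≤ I.m from hi)
        obtain ⟨hP, hargs⟩ := hf (I.layout.vtx 0) (I.layout.vtx (i + 1))
        have hlen : (I.layout.links (fun j => I.link x j ^^ pos) i).length ≤ i := by
          rw [Layout.links, List.length_map]
          exact (List.length_filter_le _ _).trans (by simp)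
        rw [Layout.vtx_val _ (by show 0 < I.layout.nv; omega),
          Layout.vtx_val _ (by show i + 1 < I.layout.nv; omega)] at hargs
        rw [← hrest, hlk, List.map_append, List.map_append] at hS
        rw [← hP]
        refine wp_call₂ (os := os ++ (I.layout.links (fun j => I.link x j ^^ pos) i).map
          (fun e => f e.1 e.2)) (os' := rest.map (fun e => f e.1 e.2) ++ os') (T := T + 5 * i + 5)
          hE.room hA (by simpa [List.append_assoc] using hS)
          ?_ (hat.congr rfl (by simp) (by simp; omega)) hargs ?_ ?_
        · simp only [List.length_append, List.length_map]; omega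
        · intro s'' hs''
          have := hs'' .j (by simp) (by simp) (by simp)
          simp [hi'] at this
          simp [this]; omega
        · intro s'' hF' hat' _
          rw [hlk, List.map_append, ← List.append_assoc]
          refine ⟨hat'.congr rfl (by simp) (by simp; omega), ?_⟩
          have := hF'.reg .cnt (call₂_sets _ _ _ (by simp) (by simp) (by simp) (by simp))
          simp [hi', hmask', hI'.cl i hi, hcnt, hfl] at this
          simp [this, hcnt']
      · intro heq
        have hsel : (I.link x i ^^ pos) = false := by
          revert heq
          cases hlx : I.link x i <;> cases pos <;> simp [hi', hmask', hI'.cl i hi, hfl, hlx]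
        simp only [hsel, Bool.false_eq_true, if_false, List.append_nil] at hlk
        rw [hlk]
        refine ⟨hat.congr rfl (by simp) (by simp; omega), ?_⟩
        simp [hi', hmask', hI'.cl i hi, hcnt, hfl, hcnt']
    · rintro s' hF hi' ⟨hat, hcnt⟩
      exact ⟨hat.congr rfl (by simp) (by simp; omega), by simpa using hcnt⟩
  exact key.frame.mono fun s' ⟨hF, h1, h2⟩ => hQ s' hF h1 h2

end DynSCC

namespace DynSCC

/-! ## The program of the reduction: trials -/

/-- Serve the query of a trial. -/
def queryCmd (P : Program) : DeletionKind → Cmd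
  | .edge => call₂ P (Reg.m + Reg.w + 1) 0
  | .vertex => call₁ P (Reg.m + Reg.w + 1)

/-- The comparison that decides a trial, from the number of components. -/
def countTest (κ : DeletionKind) : Expr :=
  .lt (Reg.nv - .const κ.count + Reg.cnt) (Reg.h + Reg.m + Reg.w)

/-- Evaluate the answer to the query of a trial. -/
def check (κ : DeletionKind) : QueryType → Cmd
  | .number => .assign .h (cell 0) ;; .assign .flag (countTest κ)
  | .largest => .assign .flag (.lt (cell 0 + Reg.cnt) (1 + Reg.m + Reg.w))
  | .all => .assign .q (cell 0) ;; .assign .h 0 ;;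
      -- The limit is of the order of the number of clauses, since `w` cancels against `nv`. A list
      -- of at least this many components already makes the test succeed, so reading stops there
      -- instead of scanning up to `w` singletons.
      .assign .lim (Reg.nv + Reg.cnt + 1 - Reg.m - Reg.w) ;;
      .for .i .lim (.ite Reg.q (.assign .h (Reg.h + 1) ;; .assign .q (.arr .mem (Reg.q + 1))) .skip) ;;
      .assign .flag (countTest κ)

/-- Some extension of an assignment `x` of the other variables satisfies all clauses. -/
def Inst.Sat (I : Inst) (x : ℕ) : Prop :=
  ∃ b < 2 ^ I.p, ∀ j < I.m, I.link x j = true → I.layout.isOpen j b = false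

/-- The number of components and of deleted vertices determine the size of the component of the
source. Some assignment is missed by the source exactly if this size plus the number of unlinked
clauses is below `1 + m + w`. -/
theorem wp_check {E : Env} {I : Inst} {k b l Z sz gr x : ℕ} {τ : QueryType} {κ : DeletionKind}
    {s : State} {Q : State → Prop} (hE : E.Fits I k b l Z) (hI : I.Const sz gr s)
    (hc : s.reg .cnt = unlinked (I.link x) I.m) (hb : ∀ z, s.arr .mem z < b)
    (ha : IsAnswer (s.arr .mem) (sccsAfter (I.layout.graph (I.link x)) (I.layout.deletion κ)) τ)
    (hQ : ∀ s', (check κ τ).Frame s s' → (s'.reg .flag ≠ 0 ↔ I.Sat x) →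
      s'.time ≤ s.time + 30 * I.m + 60 → Q s') : WP E (check κ τ) s Q := by
  have h1 := hE.bound
  have h2 := hE.base
  have h3 := hE.nv_le
  have h4 : I.layout.nv = 2 ^ I.p + 6 * I.m + 8 := rfl
  have h5 : 0 < 2 ^ I.p := Nat.two_pow_pos _
  have h6 := unlinked_le (I.link x) I.m
  have h7 := I.layout.ncard_reached_lt_iff (I.link x)
  obtain ⟨h8, h9⟩ := I.layout.answer (I.link x) κ
  have e1 : I.layout.m = I.m := rfl
  have e2 : I.layout.w = 2 ^ I.p := rfl
  rw [e1, e2] at h7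
  have h10 : κ.count ≤ 1 := by cases κ <;> simp [DeletionKind.count]
  set F := sccsAfter (I.layout.graph (I.link x)) (I.layout.deletion κ)
  -- The test is correct for the exact number of components, and also for a count stopped at the
  -- limit: then it succeeds, and so many components force an unreached assignment.
  have htest : ∀ h, (h = F.ncard ∨ (h ≤ F.ncard ∧
      h = I.layout.nv + unlinked (I.link x) I.m + 1 - I.m - 2 ^ I.p)) →
      ((I.layout.nv - κ.count + unlinked (I.link x) I.m < h + I.m + 2 ^ I.p) ↔ I.Sat x) := by
    intro h hh
    rw [Inst.Sat, ← h7]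
    omega
  have hM := hI.m
  have hW := hI.w
  have hN := hI.nv
  have key : WP E (check κ τ) s (fun s' => (s'.reg .flag ≠ 0 ↔ I.Sat x) ∧
      s'.time ≤ s.time + 30 * I.m + 60) := by
    cases τ with
    | number =>
      have ha' : s.arr .mem 0 = F.ncard := ha
      simp [check, cell, countTest, hM, hW, hN, hc, ha']
      refine ⟨by omega, by omega, ?_, by omega⟩
      exact htest _ (Or.inl rfl)
    | largest =>
      have ha' : s.arr .mem 0 = {v : Fin I.layout.nv | I.layout.Reached (I.link x) v}.ncard :=
        Eq.trans ha h9
      simp [check, cell, hM, hW, hc, ha']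
      refine ⟨by omega, ?_, by omega⟩
      exact h7
    | all =>
      obtain ⟨heads, hl, hlen⟩ := reports_length ha
      simp only [check, wp_seq, wp_assign]
      refine ⟨by simp [cell]; omega, by simp; omega, by simp [hM, hW, hN, hc]; omega, ?_⟩
      -- Past the end of the list `q` is the null pointer and `h` stops growing, so the loop has a
      -- fixed length and ends with the minimum of the limit and the number of components.
      refine wp_for (n := I.layout.nv + unlinked (I.link x) I.m + 1 - I.m - 2 ^ I.p)
        (fun i s' => s'.arr = s.arr ∧ s'.reg .q < b ∧
          IsLinkedList (s.arr .mem) (s'.reg .q) (heads.drop i) ∧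
          s'.reg .h = min i F.ncard ∧ s'.time ≤ s.time + 4 + 5 * i) (by simp [Cmd.sets])
        (by simp [Cmd.sets]) (by simp) (by simp [hM, hW, hN, hc]) (by omega) ?_ ?_ ?_
      · simp [cell]; exact ⟨hb _, hl⟩
      · rintro i hi s' hF - ⟨i1, i2, i3, i4, i5⟩
        rw [wp_ite]
        refine ⟨trivial, ?_, ?_⟩
        · intro hq
          have hq' : s'.reg .q ≠ 0 := hq
          rcases hd : heads.drop i with _ | ⟨y, ys⟩
          · rw [hd] at i3; exact absurd i3 hq'
          · rw [hd] at i3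
            have hys : heads.drop (i + 1) = ys := by
              rw [← List.drop_drop, hd]; rfl
            have hi' : i < heads.length := by
              by_contra h
              rw [List.drop_eq_nil_of_le (by omega)] at hd
              simp at hd
            have hroom := hE.room.word
            simp [i1, i4]
            refine ⟨by omega, ⟨⟨by omega, by omega⟩, by omega⟩, hb _, ?_, by omega, by omega⟩
            rw [hys]; exact i3.2.2
        · intro hq
          have hq' : s'.reg .q = 0 := hq
          rcases hd : heads.drop i with _ | ⟨y, ys⟩
          · have hi' : heads.length ≤ i := by simpa using hd
            rw [wp_skip]
            refine ⟨i1, by simpa using i2, ?_, ?_, ?_⟩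
            · rw [List.drop_eq_nil_of_le (by omega)]; simpa [IsLinkedList] using hq'
            · simp [i4]; omega
            · simp; omega
          · rw [hd] at i3; exact absurd hq' i3.1
      · rintro s' hF - ⟨i1, i2, i3, i4, i5⟩
        have hM' : s'.reg .m = I.m := by
          rw [hF.reg .m (by simp [Cmd.for, Cmd.sets])]; simp [hM]
        have hW' : s'.reg .w = 2 ^ I.p := by
          rw [hF.reg .w (by simp [Cmd.for, Cmd.sets])]; simp [hW]
        have hN' : s'.reg .nv = I.layout.nv := by
          rw [hF.reg .nv (by simp [Cmd.for, Cmd.sets])]; simp [hN]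
        have hC' : s'.reg .cnt = unlinked (I.link x) I.m := by
          rw [hF.reg .cnt (by simp [Cmd.for, Cmd.sets])]; simp [hc]
        simp [countTest, hM', hW', hN', hC', i4]
        refine ⟨by omega, ?_, by omega⟩
        exact htest _ (by omega)
  exact key.frame.mono fun s' ⟨hF, h1, h2⟩ => hQ s' hF h1 h2

theorem check_sets (κ : DeletionKind) (τ : QueryType) {r : Reg} (h1 : r ≠ .h) (h2 : r ≠ .flag)
    (h3 : r ≠ .q) (h4 : r ≠ .lim) (h5 : r ≠ .i) : (check κ τ).sets r = false := by
  cases τ <;> simp [check, Cmd.sets, Cmd.for, *]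

theorem check_setsArr (κ : DeletionKind) (τ : QueryType) (r : Arr) :
    (check κ τ).setsArr r = false := by
  cases τ <;> simp [check, Cmd.setsArr, Cmd.for]

theorem check_shallow (κ : DeletionKind) (τ : QueryType) : (check κ τ).Shallow := by
  cases τ <;> simp [check, Cmd.Shallow, Cmd.for, countTest, cell]

theorem queryCmd_sets (P : Program) (κ : DeletionKind) {r : Reg} (h1 : r ≠ .pc) (h2 : r ≠ .addr)
    (h3 : r ≠ .val) (h4 : r ≠ .lp) : (queryCmd P κ).sets r = false := by
  cases κ <;> simp [queryCmd, call₁_sets, call₂_sets, *]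

theorem queryCmd_setsArr (P : Program) (κ : DeletionKind) :
    (queryCmd P κ).setsArr .clause = false := by
  cases κ <;> simp [queryCmd, call₁_setsArr, call₂_setsArr]

theorem queryCmd_shallow (P : Program) (κ : DeletionKind) : (queryCmd P κ).Shallow := by
  cases κ
  · exact call₂_shallow (by simp) (by simp)
  · exact call₁_shallow (by simp)

theorem wp_queryCmd {E : Env} {I : Inst} {A : DynAlg} {k b l Z a T sz gr : ℕ}
    {τ : QueryType} {κ : DeletionKind} {μ : Memory} {os os' : List (Op I.layout.nv)}
    {G : Digraph (Fin I.layout.nv)} {Ts : List ℕ} {s : State} {Q : State → Prop}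
    (hE : E.Fits I k b l Z) (hA : A.BoundedBy k a) (hI : I.Const sz gr s)
    (hS : A.Serves b τ G μ (os ++ .query (I.layout.deletion κ) :: os') Ts)
    (hl : Ts.sum + 2 * (os.length + 1) ≤ l) (hs : s.At E A b a μ os T)
    (hQ : ∀ s', (queryCmd A.query κ).Frame s s' →
      s'.At E A b a μ (os ++ [.query (I.layout.deletion κ)]) T →
      IsAnswer (s'.arr .mem) (sccsAfter (applyAll G os) (I.layout.deletion κ)) τ →
      (∀ z, s'.arr .mem z < b) → Q s') :
    WP E (queryCmd A.query κ) s Q := by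
  have h1 := hE.bound
  have h3 := hE.nv_le
  have h4 : I.layout.nv = 2 ^ I.p + 6 * I.m + 8 := rfl
  have h5 : 0 < 2 ^ I.p := Nat.two_pow_pos _
  have hd : I.layout.dummy = I.m + 2 ^ I.p + 1 := rfl
  have hdv : (I.layout.vtx I.layout.dummy).val = I.m + 2 ^ I.p + 1 := I.layout.vtx_val (by omega)
  have h0v : (I.layout.vtx 0).val = 0 := I.layout.vtx_val (by omega)
  have harg : ∀ s' : State, (∀ r, r ≠ .addr → r ≠ .val → r ≠ .lp → s'.reg r = s.reg r) →
      (Reg.m + Reg.w + 1 : Expr).Ok E s' ∧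
      (Reg.m + Reg.w + 1 : Expr).eval E s' = I.m + 2 ^ I.p + 1 := by
    intro s' hs'
    have e1 := hs' .m (by simp) (by simp) (by simp)
    have e2 := hs' .w (by simp) (by simp) (by simp)
    rw [hI.m] at e1
    rw [hI.w] at e2
    simp [e1, e2]; omega
  cases κ with
  | edge =>
    exact wp_call₂ (o := .query (I.layout.deletion .edge)) hE.room hA hS hl hs
      (show [_, _] = [_, _] by rw [hdv, h0v]) (fun s' hs' => ⟨harg s' hs', by simp; omega⟩)
      fun s' hF hat h => hQ s' hF hat (h _ rfl).1 (h _ rfl).2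
  | vertex =>
    exact wp_call₁ (o := .query (I.layout.deletion .vertex)) hE.room hA hS hl hs
      (show [_] = [_] by rw [hdv]) harg
      fun s' hF hat h => hQ s' hF hat (h _ rfl).1 (h _ rfl).2

end DynSCC

namespace DynSCC

/-! ## The program of the reduction: the search -/

/-- The program for the updates before the query of a trial. -/
def Mode.prog (A : DynAlg) : Mode → Program
  | .dec => A.delete
  | _ => A.insert

/-- Whether satisfied clauses are updated. -/
def Mode.pos : Mode → Bool
  | .dec => true
  | _ => false

/-- Undo the updates of a trial. -/
def afterCmd (A : DynAlg) : Mode → Cmd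
  | .full => updateLoop A.delete false
  | _ => .skip

/-- The word for an assignment `x` of the other variables. -/
def maskExpr : Expr :=
  Reg.x * Reg.w +
    ((1 : Expr) <<< (Reg.n - Reg.p : Expr) - 1 - Reg.x) * (1 : Expr) <<< (Reg.n + Reg.p : Expr)

/-- Try the assignment `x` of the other variables. -/
def trial (A : DynAlg) (τ : QueryType) (κ : DeletionKind) (M : Mode) : Cmd :=
  .assign .x (Reg.g * Reg.s + Reg.a) ;; .assign .mask maskExpr ;; .assign .cnt 0 ;;
    updateLoop (M.prog A) M.pos ;; queryCmd A.query κ ;; check κ τ ;;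
    .ite Reg.flag (.assign .out 1) .skip ;; afterCmd A M

/-- A series of trials that the algorithm serves in one run. -/
def session (A : DynAlg) (τ : QueryType) (κ : DeletionKind) (M : Mode) : Cmd :=
  .for .a .s (trial A τ κ M) ;; rollback

/-- All trials. -/
def search (A : DynAlg) (τ : QueryType) (κ : DeletionKind) (M : Mode) : Cmd :=
  .for .g .grp (session A τ κ M)

/-- The register `out` tells whether `P` holds. -/
def State.Outcome (P : Prop) (s : State) : Prop :=
  (s.reg .out = 1 ∧ P) ∨ (s.reg .out = 0 ∧ ¬ P)

theorem State.Outcome.congr {P P' : Prop} {s s' : State} (h : s.Outcome P)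
    (h1 : s'.reg .out = s.reg .out) (h2 : P ↔ P') : s'.Outcome P' := by
  rw [State.Outcome, h1, ← h2]; exact h

theorem Mode.op_spec (A : DynAlg) (M : Mode) {n : ℕ} (u v : Fin n) :
    A.prog (M.op u v) = M.prog A ∧ (M.op u v).args = [u.val, v.val] := by
  cases M <;> exact ⟨rfl, rfl⟩

theorem Layout.before_eq (D : Layout) (M : Mode) (c : ℕ → Bool) (k : ℕ) : D.before M c k =
    (D.links (fun j => c j ^^ M.pos) k).map fun e => M.op e.1 e.2 := by
  cases M <;> simp [Layout.before, Mode.pos] <;> rfl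

theorem Layout.trials_prefix (D : Layout) (M : Mode) (κ : DeletionKind) (c : ℕ → ℕ → Bool)
    {k k' : ℕ} (h : k ≤ k') : D.trials M κ c k <+: D.trials M κ c k' := by
  obtain ⟨r, rfl⟩ := Nat.exists_eq_add_of_le h
  rw [Layout.trials, Layout.trials, List.range_add, List.flatMap_append]
  exact List.prefix_append _ _

theorem Layout.length_trial_le (D : Layout) (M : Mode) (κ : DeletionKind) (c : ℕ → Bool) :
    (D.trial M κ c).length ≤ 2 * D.m + 1 := by
  have h1 := D.length_links_le (M.sel c) D.m
  have h2 := D.length_links_le c D.m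
  cases M <;> simp [Layout.trial, Layout.before, Layout.after, deletions] <;> omega

theorem Layout.length_trials_le (D : Layout) (M : Mode) (κ : DeletionKind) (c : ℕ → ℕ → Bool)
    (k : ℕ) : (D.trials M κ c k).length ≤ k * (2 * D.m + 1) := by
  induction k with
  | zero => simp [Layout.trials]
  | succ k ih =>
    have := D.length_trial_le M κ (c k)
    rw [D.trials_succ, List.length_append, add_mul]; omega

theorem DynAlg.Serves.steps_le {A : DynAlg} {B : ℕ} {τ : QueryType} {n : ℕ} {os os' : List (Op n)}
    {G : Digraph (Fin n)} {μ μ' : Memory} {Ts : List ℕ} {t : ℕ}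
    (h : A.Serves B τ G μ (os ++ os') Ts) (ht : A.Steps B μ os μ' t) : t ≤ Ts.sum := by
  obtain ⟨μ₁, Ts₁, Ts₂, h1, -, -, rfl, -⟩ := h.split
  obtain ⟨-, rfl⟩ := h1.unique ht
  simp

theorem queryCmd_keeps (P : Program) (κ : DeletionKind) : (queryCmd P κ).Keeps :=
  ⟨by simp [constRegs, queryCmd_sets], queryCmd_setsArr P κ⟩

theorem check_keeps (κ : DeletionKind) (τ : QueryType) : (check κ τ).Keeps :=
  ⟨by simp [constRegs, check_sets], check_setsArr κ τ _⟩

theorem afterCmd_sets (A : DynAlg) (M : Mode) {r : Reg} (h1 : r ≠ .pc) (h2 : r ≠ .addr)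
    (h3 : r ≠ .val) (h4 : r ≠ .lp) (h5 : r ≠ .j) (h6 : r ≠ .flag) (h7 : r ≠ .cnt) :
    (afterCmd A M).sets r = false := by
  cases M <;> simp [afterCmd, updateLoop_sets, Cmd.sets, *]

theorem trial_sets (A : DynAlg) (τ : QueryType) (κ : DeletionKind) (M : Mode) {r : Reg}
    (hr : r ∈ constRegs ∨ r = .a ∨ r = .g) : (trial A τ κ M).sets r = false := by
  have : r ≠ .pc ∧ r ≠ .addr ∧ r ≠ .val ∧ r ≠ .lp ∧ r ≠ .j ∧ r ≠ .flag ∧ r ≠ .cnt ∧ r ≠ .x ∧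
      r ≠ .mask ∧ r ≠ .h ∧ r ≠ .q ∧ r ≠ .lim ∧ r ≠ .i ∧ r ≠ .out := by
    rcases hr with hr | rfl | rfl
    · simp [constRegs] at hr
      rcases hr with rfl | rfl | rfl | rfl | rfl | rfl | rfl | rfl <;> simp
    · simp
    · simp
  simp [trial, Cmd.sets, updateLoop_sets, queryCmd_sets, check_sets, afterCmd_sets, this]

theorem trial_keeps (A : DynAlg) (τ : QueryType) (κ : DeletionKind) (M : Mode) :
    (trial A τ κ M).Keeps := by
  refine ⟨fun r hr => trial_sets A τ κ M (Or.inl hr), ?_⟩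
  have : (afterCmd A M).setsArr .clause = false := by
    cases M <;> simp [afterCmd, updateLoop_setsArr, Cmd.setsArr]
  simp [trial, Cmd.setsArr, updateLoop_setsArr, queryCmd_setsArr, check_setsArr, this]

theorem trial_shallow (A : DynAlg) (τ : QueryType) (κ : DeletionKind) (M : Mode) :
    (trial A τ κ M).Shallow := by
  have : (afterCmd A M).Shallow := by
    cases M
    · exact updateLoop_shallow _ _
    · trivial
    · trivial
  simp [trial, Cmd.Shallow, updateLoop_shallow, queryCmd_shallow, check_shallow, this, maskExpr]

theorem search_shallow (A : DynAlg) (τ : QueryType) (κ : DeletionKind) (M : Mode) :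
    (search A τ κ M).Shallow := by
  simp [search, session, Cmd.for, Cmd.Shallow, trial_shallow, rollback]

theorem Inst.linkMask_lt {I : Inst} (h : I.p ≤ I.n) {x : ℕ} (hx : x < 2 ^ (I.n - I.p)) :
    I.linkMask x < 2 ^ (2 * I.n) := by
  have e1 : 2 ^ (2 * I.n) = 2 ^ (I.n - I.p) * 2 ^ (I.n + I.p) := by
    rw [← pow_add]; congr 1; omega
  have e2 : 2 ^ I.p ≤ 2 ^ (I.n + I.p) := Nat.pow_le_pow_right (by omega) (by omega)
  obtain ⟨r, hr⟩ := Nat.exists_eq_add_of_lt hx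
  have e3 : 2 ^ (I.n - I.p) - 1 - x = r := by omega
  rw [Inst.linkMask, e1, e3, hr, add_mul, add_mul, one_mul]
  have := Nat.mul_le_mul_left x e2
  have := Nat.two_pow_pos (I.n + I.p)
  omega

theorem maskExpr_spec {E : Env} {I : Inst} {k b l Z sz gr x : ℕ} {s : State}
    (hE : E.Fits I k b l Z) (hI : I.Const sz gr s) (hx : x < 2 ^ (I.n - I.p))
    (h : s.reg .x = x) : maskExpr.Ok E s ∧ maskExpr.eval E s = I.linkMask x := by
  have h1 := hE.bound
  have h2 := hE.pow
  have h3 := hE.le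
  have h4 := I.linkMask_lt h3 hx
  have h5 : 2 ^ (I.n - I.p) ≤ 2 ^ (2 * I.n) := Nat.pow_le_pow_right (by omega) (by omega)
  have h6 : 2 ^ (I.n + I.p) ≤ 2 ^ (2 * I.n) := Nat.pow_le_pow_right (by omega) (by omega)
  have h7 : I.n < 2 ^ (I.n - I.p) * 2 ^ I.p := by
    rw [← pow_add, Nat.sub_add_cancel h3]; exact Nat.lt_two_pow_self
  have h8 : 2 ^ I.n ≤ 2 ^ (2 * I.n) := Nat.pow_le_pow_right (by omega) (by omega)
  have h9 : I.n < 2 ^ I.n := Nat.lt_two_pow_self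
  have h10 : I.linkMask x =
    x * 2 ^ I.p + (2 ^ (I.n - I.p) - 1 - x) * 2 ^ (I.n + I.p) := rfl
  simp [maskExpr, hI.w, hI.n, hI.p, h, Inst.linkMask]
  omega

/-- The operations `os` served so far are kept in general form with the requirement that they lead
to the start graph; this lets trials follow each other within a session. The outcome accumulates the
disjunction of all answers. -/
theorem wp_trial {E : Env} {I : Inst} {A : DynAlg} {k b l Z a T sz gr x : ℕ}
    {τ : QueryType} {κ : DeletionKind} {M : Mode} {μ : Memory} {os os' : List (Op I.layout.nv)}
    {G : Digraph (Fin I.layout.nv)} {Ts : List ℕ} {s : State} {P : Prop} {Q : State → Prop}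
    (hE : E.Fits I k b l Z) (hA : A.BoundedBy k a) (hI : I.Const sz gr s)
    (hx : s.reg .g * sz + s.reg .a = x) (hx' : x < 2 ^ (I.n - I.p))
    (hS : A.Serves b τ G μ (os ++ (I.layout.trial M κ (I.link x) ++ os')) Ts)
    (hG : applyAll G os = I.layout.graph M.start)
    (hl : Ts.sum + 2 * (os.length + (2 * I.m + 1)) ≤ l) (hs : s.At E A b a μ os T)
    (hP : s.Outcome P)
    (hQ : ∀ s', (trial A τ κ M).Frame s s' →
      s'.At E A b a μ (os ++ I.layout.trial M κ (I.link x)) (T + 40 * I.m + 80) →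
      s'.Outcome (P ∨ I.Sat x) → Q s') :
    WP E (trial A τ κ M) s Q := by
  have h1 := hE.bound
  have h2 := hE.pow
  have hxm := I.linkMask_lt hE.le hx'
  have hx2 : 2 ^ (I.n - I.p) ≤ 2 ^ (2 * I.n) := Nat.pow_le_pow_right (by omega) (by omega)
  have key : WP E (trial A τ κ M) s (fun s' =>
      s'.At E A b a μ (os ++ I.layout.trial M κ (I.link x)) (T + 40 * I.m + 80) ∧
      s'.Outcome (P ∨ I.Sat x)) := by
    rw [trial]
    simp only [wp_seq (c₁ := .assign _ _), wp_assign]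
    have hI₁ : I.Const sz gr (s.set .x x) :=
      ⟨by simpa using hI.n, by simpa using hI.p, by simpa using hI.m, by simpa using hI.w,
        by simpa using hI.nv, by simpa using hI.ne, by simpa using hI.s, by simpa using hI.grp,
        by simpa using hI.cl⟩
    have hxe : (Reg.g * Reg.s + Reg.a : Expr).eval E s = x := by simpa [hI.s] using hx
    refine ⟨by simp [hI.s]; rw [hx]; constructor <;> omega, ?_⟩
    rw [hxe]
    obtain ⟨m1, m2⟩ := maskExpr_spec hE hI₁ hx' (by simp)
    refine ⟨m1, ?_⟩
    rw [m2]
    refine ⟨by simp; omega, ?_⟩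
    set s₁ := ((s.set .x x).set .mask (I.linkMask x)).set .cnt
      (Expr.eval E ((s.set .x x).set .mask (I.linkMask x)) 0)
    have hI₂ : I.Const sz gr s₁ := ⟨by simpa [s₁] using hI.n, by simpa [s₁] using hI.p,
      by simpa [s₁] using hI.m, by simpa [s₁] using hI.w, by simpa [s₁] using hI.nv,
      by simpa [s₁] using hI.ne, by simpa [s₁] using hI.s, by simpa [s₁] using hI.grp,
      by simpa [s₁] using hI.cl⟩
    have hat₁ : s₁.At E A b a μ os (T + 3) :=
      hs.congr rfl (by simp [s₁]) (by simp [s₁]; omega)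
    have hout₁ : s₁.reg .out = s.reg .out := by simp [s₁]
    have hmask₁ : s₁.reg .mask = I.linkMask x := by simp [s₁]
    have hcnt₁ : s₁.reg .cnt = 0 := by simp [s₁]
    clear_value s₁
    have hm0 : I.layout.m = I.m := rfl
    rw [Layout.trial, Layout.before_eq, hm0] at hS ⊢
    have hlen := I.layout.length_links_le (fun j => I.link x j ^^ M.pos) I.m
    have hS' := hS
    rw [List.append_assoc] at hS
    rw [wp_seq]
    refine wp_updateLoop hE hA hI₂ hxm (M.op_spec A) hS (by omega) hcnt₁ (by omega) hmask₁ hat₁ ?_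
    intro s₂ hF₂ hat₂ hcnt₂
    have hI₃ := hI₂.frame (updateLoop_keeps _ _) hF₂
    have hout₂ : s₂.reg .out = s₁.reg .out := hF₂.reg _ (updateLoop_sets _ _ (by simp) (by simp)
      (by simp) (by simp) (by simp) (by simp) (by simp))
    have hmask₂ : s₂.reg .mask = s₁.reg .mask := hF₂.reg _ (updateLoop_sets _ _ (by simp)
      (by simp) (by simp) (by simp) (by simp) (by simp) (by simp))
    rw [← List.append_assoc, List.cons_append] at hS
    rw [wp_seq]
    -- At the moment of the query the links are exactly those for `x`, so the guaranteed answer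
    -- concerns the intended graph.
    have hGx : applyAll G (os ++ (I.layout.links (fun j => I.link x j ^^ M.pos) I.m).map
        fun e => M.op e.1 e.2) = I.layout.graph (I.link x) := by
      rw [applyAll_append, hG, ← Layout.before_eq]
      exact (I.layout.before_valid M (I.link x)).2
    refine wp_queryCmd hE hA hI₃ hS (by simp; omega) hat₂ ?_
    intro s₃ hF₃ hat₃ hans hmem
    rw [hGx] at hans
    have hI₄ := hI₃.frame (queryCmd_keeps _ _) hF₃
    have hreg₃ : ∀ r, r ≠ .pc → r ≠ .addr → r ≠ .val → r ≠ .lp → s₃.reg r = s₂.reg r :=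
      fun r h1 h2 h3 h4 => hF₃.reg r (queryCmd_sets _ _ h1 h2 h3 h4)
    rw [wp_seq]
    refine wp_check hE hI₄ (by
      rw [hreg₃ _ (by simp) (by simp) (by simp) (by simp), hcnt₂, zero_add]) hmem hans ?_
    intro s₄ hF₄ hflag htime
    have hI₅ := hI₄.frame (check_keeps _ _) hF₄
    have hreg₄ : ∀ r, r ≠ .h → r ≠ .flag → r ≠ .q → r ≠ .lim → r ≠ .i → s₄.reg r = s₃.reg r :=
      fun r h1 h2 h3 h4 h5 => hF₄.reg r (check_sets _ _ h1 h2 h3 h4 h5)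
    have harr₄ : s₄.arr = s₃.arr := funext fun r => hF₄.arr r (check_setsArr _ _ _)
    have hat₄ := hat₃.congr (T' := T + 35 * I.m + 70) harr₄
      (hreg₄ _ (by simp) (by simp) (by simp) (by simp) (by simp)) (by omega)
    have hmask₄ : s₄.reg .mask = I.linkMask x := by
      rw [hreg₄ _ (by simp) (by simp) (by simp) (by simp) (by simp),
        hreg₃ _ (by simp) (by simp) (by simp) (by simp), hmask₂, hmask₁]
    have hcnt₄ : s₄.reg .cnt = unlinked (I.link x) I.m := by
      rw [hreg₄ _ (by simp) (by simp) (by simp) (by simp) (by simp),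
        hreg₃ _ (by simp) (by simp) (by simp) (by simp), hcnt₂, zero_add]
    have hout₄ : s₄.reg .out = s.reg .out := by
      rw [hreg₄ _ (by simp) (by simp) (by simp) (by simp) (by simp),
        hreg₃ _ (by simp) (by simp) (by simp) (by simp), hout₂, hout₁]
    have fin : ∀ s₅ : State, (∀ r, r ≠ .out → s₅.reg r = s₄.reg r) → s₅.arr = s₄.arr →
        s₅.time ≤ s₄.time + 2 → s₅.Outcome (P ∨ I.Sat x) →
        WP E (afterCmd A M) s₅ (fun s' => s'.At E A b a μ
          (os ++ ((I.layout.links (fun j => I.link x j ^^ M.pos) I.m).map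
            (fun e => M.op e.1 e.2) ++ .query (I.layout.deletion κ) ::
              I.layout.after M (I.link x) I.m)) (T + 40 * I.m + 80) ∧
          s'.Outcome (P ∨ I.Sat x)) := by
      intro s₅ h5 h5' h5'' h5o
      have hat₅ := hat₄.congr (T' := T + 35 * I.m + 72) h5' (h5 _ (by simp)) (by omega)
      have hI₆ : I.Const sz gr s₅ := ⟨by rw [h5 _ (by simp), hI₅.n],
        by rw [h5 _ (by simp), hI₅.p], by rw [h5 _ (by simp), hI₅.m],
        by rw [h5 _ (by simp), hI₅.w], by rw [h5 _ (by simp), hI₅.nv],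
        by rw [h5 _ (by simp), hI₅.ne], by rw [h5 _ (by simp), hI₅.s],
        by rw [h5 _ (by simp), hI₅.grp], by rw [h5']; exact hI₅.cl⟩
      have done : M ≠ .full → WP E .skip s₅ (fun s' => s'.At E A b a μ
          (os ++ ((I.layout.links (fun j => I.link x j ^^ M.pos) I.m).map
            (fun e => M.op e.1 e.2) ++ .query (I.layout.deletion κ) ::
              I.layout.after M (I.link x) I.m)) (T + 40 * I.m + 80) ∧
          s'.Outcome (P ∨ I.Sat x)) := by
        intro hM
        have : I.layout.after M (I.link x) I.m = [] := by
          cases M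
          · exact absurd rfl hM
          · rfl
          · rfl
        rw [wp_skip, this, ← List.append_assoc]
        exact ⟨hat₅.congr rfl rfl (by omega), h5o⟩
      cases M with
      | inc => exact done (by simp)
      | dec => exact done (by simp)
      | full =>
        have hx0 : I.layout.after .full (I.link x) I.m =
            (I.layout.links (fun j => I.link x j ^^ false) I.m).map fun e => Op.delete e.1 e.2 := by
          simp [Layout.after, deletions]
        rw [hx0] at hS' ⊢
        refine wp_updateLoop (os := os ++ (I.layout.links (fun j => I.link x j ^^ Mode.full.pos)
          I.m).map (fun e => Mode.full.op e.1 e.2) ++ [.query (I.layout.deletion κ)]) (os' := os')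
          (f := fun u v => .delete u v) hE hA hI₆ hxm (fun u v => ⟨rfl, rfl⟩)
          (by simpa [List.append_assoc] using hS') (by simp; omega)
          (by rw [h5 _ (by simp), hcnt₄]) (unlinked_le _ _) (by rw [h5 _ (by simp), hmask₄]) hat₅ ?_
        intro s₆ hF₆ hat₆ _
        refine ⟨?_, h5o.congr (hF₆.reg _ (updateLoop_sets _ _ (by simp) (by simp) (by simp)
          (by simp) (by simp) (by simp) (by simp))) Iff.rfl⟩
        have := hat₆.congr (T' := T + 40 * I.m + 80) rfl rfl (by omega)
        simpa [List.append_assoc] using this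
    rw [wp_seq, wp_ite]
    refine ⟨trivial, fun hne => ?_, fun heq => ?_⟩
    · rw [wp_assign]
      refine ⟨by simp; omega, fin _ (fun r hr => by simp [hr]) rfl (by simp) ?_⟩
      exact Or.inl ⟨by simp, Or.inr (hflag.1 hne)⟩
    · rw [wp_skip]
      have hns : ¬ I.Sat x := fun h => hflag.2 h heq
      refine fin _ (fun r hr => by simp) rfl (by simp) (hP.congr (by simp [hout₄]) (by simp [hns]))
  exact key.frame.mono fun s' ⟨hF, h1, h2⟩ => hQ s' hF h1 h2

end DynSCC

/-! ### Sessions of trials with rollback, and the search over all assignments. -/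

namespace DynSCC

theorem Inst.Const.tick {I : Inst} {sz gr : ℕ} {s : State} (h : I.Const sz gr s) :
    I.Const sz gr s.tick := ⟨h.n, h.p, h.m, h.w, h.nv, h.ne, h.s, h.grp, h.cl⟩

theorem rollback_sets {r : Reg} (h : r ≠ .lp) : rollback.sets r = false := by
  simp [rollback, Cmd.sets, h]

theorem rollback_setsArr : rollback.setsArr .clause = false := by
  simp [rollback, Cmd.setsArr]

theorem session_sets (A : DynAlg) (τ : QueryType) (κ : DeletionKind) (M : Mode) {r : Reg}
    (hr : r ∈ constRegs ∨ r = .g) : (session A τ κ M).sets r = false := by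
  have : r ≠ .a ∧ r ≠ .lp := by
    rcases hr with hr | rfl
    · simp [constRegs] at hr
      rcases hr with rfl | rfl | rfl | rfl | rfl | rfl | rfl | rfl <;> simp
    · simp
  simp [session, Cmd.for, Cmd.sets, trial_sets A τ κ M (hr.imp_right Or.inr), rollback_sets, this]

theorem session_keeps (A : DynAlg) (τ : QueryType) (κ : DeletionKind) (M : Mode) :
    (session A τ κ M).Keeps :=
  ⟨fun r hr => session_sets A τ κ M (Or.inl hr), by
    simp [session, Cmd.for, Cmd.setsArr, (trial_keeps A τ κ M).2, rollback_setsArr]⟩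

theorem for_keeps {r b : Reg} {c : Cmd} (hv : r ∉ constRegs) (hc : c.Keeps) :
    (Cmd.for r b c).Keeps := by
  refine ⟨fun r' hr => ?_, by simp [Cmd.for, Cmd.setsArr, hc.2]⟩
  have : r' ≠ r := fun h => hv (h ▸ hr)
  simp [Cmd.for, Cmd.sets, hc.1 r' hr, this]

section Search

variable {E : Env} {I : Inst} {A : DynAlg} {k b l Z a T T₂ sz gr : ℕ} {τ : QueryType}
  {κ : DeletionKind} {M : Mode} {μ : Memory} {s : State} {P : Prop} {Q : State → Prop}

/-- Both the log and the simulated time of a session are bounded through `T₂` and its number of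
operations, so the rollback is absorbed in the factor `a + 60`. Afterwards the memory is `μ` with an
empty log, ready for the next session. -/
theorem wp_session {g : ℕ} {Ts : List ℕ} (hE : E.Fits I k b l Z) (hA : A.BoundedBy k a)
    (hI : I.Const sz gr s) (hg : s.reg .g = g) (hgr : g < gr) (hsz : gr * sz = 2 ^ (I.n - I.p))
    (hM : M = .full ∨ sz = 1)
    (hS : A.Serves b τ (I.layout.graph M.start) μ
      (I.layout.trials M κ (fun i => I.link (g * sz + i)) sz) Ts) (hT : Ts.sum ≤ T₂)
    (hl : T₂ + 2 * (sz * (2 * I.m + 2)) ≤ l)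
    (hs : s.At E A b a μ ([] : List (Op I.layout.nv)) T) (hP : s.Outcome P)
    (hQ : ∀ s', (session A τ κ M).Frame s s' →
      s'.At E A b a μ ([] : List (Op I.layout.nv))
        (T + (a + 60) * (T₂ + sz * (2 * I.m + 2)) + 10) →
      s'.Outcome (P ∨ ∃ i < sz, I.Sat (g * sz + i)) → Q s') :
    WP E (session A τ κ M) s Q := by
  have h1 := hE.bound
  have h2 := hE.pow
  have h3 : 2 ^ (I.n - I.p) ≤ 2 ^ (2 * I.n) := Nat.pow_le_pow_right (by omega) (by omega)
  have h4 : (g + 1) * sz ≤ 2 ^ (I.n - I.p) := hsz ▸ Nat.mul_le_mul_right _ hgr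
  rw [add_mul, one_mul] at h4
  have key : WP E (session A τ κ M) s (fun s' => s'.At E A b a μ ([] : List (Op I.layout.nv))
        (T + (a + 60) * (T₂ + sz * (2 * I.m + 2)) + 10) ∧
      s'.Outcome (P ∨ ∃ i < sz, I.Sat (g * sz + i))) := by
    rw [session, wp_seq]
    refine wp_for (n := sz) (fun i s' => s'.At E A b a μ
      (I.layout.trials M κ (fun i => I.link (g * sz + i)) i) (T + 1 + (40 * I.m + 82) * i) ∧
      s'.Outcome (P ∨ ∃ j < i, I.Sat (g * sz + j))) (trial_sets A τ κ M (by simp))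
      (trial_sets A τ κ M (by simp [constRegs])) (by simp) hI.s (by omega) ?_ ?_ ?_
    · exact ⟨hs.congr rfl (by simp) (by simp; omega), hP.congr (by simp) (by simp)⟩
    · rintro i hi s' hF hi' ⟨hat, hout⟩
      obtain ⟨rest, hrest⟩ := I.layout.trials_prefix M κ (fun i => I.link (g * sz + i))
        (show i + 1 ≤ sz from hi)
      rw [I.layout.trials_succ, List.append_assoc] at hrest
      rw [← hrest] at hS
      have hlen := I.layout.length_trials_le M κ (fun i => I.link (g * sz + i)) i
      have hlen' : (i + 1) * (2 * I.m + 1) ≤ sz * (2 * I.m + 2) := Nat.mul_le_mul hi (by omega)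
      rw [add_mul, one_mul] at hlen'
      have hm0 : I.layout.m = I.m := rfl
      rw [hm0] at hlen
      have hgr' : s'.reg .g = g := by
        rw [← hg]
        exact hF.reg _ (by simp [Cmd.for, Cmd.sets, trial_sets])
      refine wp_trial hE hA (hI.frame (for_keeps (by simp [constRegs]) (trial_keeps A τ κ M)) hF).tick (x := g * sz + i)
        (by simp [hgr', hi']) (by omega) hS ?_ (by omega) (hat.congr (s' := s'.tick) (T' := T +
          1 + (40 * I.m + 82) * i + 1) rfl rfl (by simp; omega)) (hout.congr rfl Iff.rfl) ?_
      -- Fully dynamic trials return to the start graph. Otherwise a session has a single trial and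
      -- nothing precedes it.
      · rcases hM with rfl | rfl
        · exact (I.layout.trials_full κ _ i).2
        · obtain rfl : i = 0 := by omega
          rfl
      · intro s'' _ hat' hout'
        rw [I.layout.trials_succ]
        refine ⟨hat'.congr rfl (by simp) (by simp; rw [mul_add]; omega),
          hout'.congr (by simp) ?_⟩
        rw [or_assoc]
        refine or_congr Iff.rfl ⟨?_, ?_⟩
        · rintro (⟨j, hj, h⟩ | h)
          · exact ⟨j, by omega, h⟩
          · exact ⟨i, by omega, h⟩
        · rintro ⟨j, hj, h⟩
          rcases Nat.lt_succ_iff_lt_or_eq.1 hj with hj | rfl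
          · exact Or.inl ⟨j, hj, h⟩
          · exact Or.inr h
    · rintro s' hF hi' ⟨⟨hlog, t, hst, hlp, htime⟩, hout⟩
      have ht := (show A.Serves b τ _ μ (_ ++ []) Ts by rwa [List.append_nil]).steps_le hst
      have hlen := I.layout.length_trials_le M κ (fun i => I.link (g * sz + i)) sz
      have hm0 : I.layout.m = I.m := rfl
      rw [hm0] at hlen
      have e1 : sz * (2 * I.m + 1) ≤ sz * (2 * I.m + 2) := Nat.mul_le_mul_left _ (by omega)
      refine wp_rollback hE.room (μ₀ := μ) (s := s'.tick) (by simp; omega) (hlog.congr rfl rfl) ?_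
      intro s'' hF' hmem hlp' htime'
      refine ⟨⟨⟨?_, by simp [hlp']⟩, 0, ⟨hmem, rfl⟩, by simp [hlp'], ?_⟩,
        hout.congr (hF'.reg _ (rollback_sets (by simp))) Iff.rfl⟩
      · rw [State.orig, hlp', hmem]; rfl
      · have e2 : a * (t + (I.layout.trials M κ (fun i => I.link (g * sz + i)) sz).length) ≤
            a * (T₂ + sz * (2 * I.m + 2)) := Nat.mul_le_mul_left _ (by omega)
        have e3 : (40 * I.m + 82) * sz ≤ 41 * (sz * (2 * I.m + 2)) := by
          rw [mul_comm sz, ← mul_assoc]; exact Nat.mul_le_mul_right _ (by omega)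
        simp at htime'
        rw [add_mul]
        simp only [List.length_nil, add_zero, mul_zero]
        omega
  exact key.frame.mono fun s' ⟨hF, h1, h2⟩ => hQ s' hF h1 h2

/-- Since `gr * sz` is the number of assignments of the second group, `g * sz + j` enumerates all of
them. Every session starts from the same memory `μ`, so its guarantee does not depend on earlier
sessions. -/
theorem wp_search (hE : E.Fits I k b l Z) (hA : A.BoundedBy k a)
    (hI : I.Const sz gr s) (hsz : gr * sz = 2 ^ (I.n - I.p)) (hM : M = .full ∨ sz = 1)
    (hS : ∀ g, ∃ Ts, A.Serves b τ (I.layout.graph M.start) μ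
      (I.layout.trials M κ (fun i => I.link (g * sz + i)) sz) Ts ∧ Ts.sum ≤ T₂)
    (hl : T₂ + 2 * (sz * (2 * I.m + 2)) ≤ l)
    (hs : s.At E A b a μ ([] : List (Op I.layout.nv)) T) (hout : s.reg .out = 0)
    (hQ : ∀ s', s'.time ≤ T + gr * ((a + 60) * (T₂ + sz * (2 * I.m + 2)) + 12) + 2 →
      s'.Outcome (∃ x < 2 ^ (I.n - I.p), I.Sat x) → Q s') :
    WP E (search A τ κ M) s Q := by
  have h1 := hE.bound
  have h2 := hE.pow
  have h3 : 2 ^ (I.n - I.p) ≤ 2 ^ (2 * I.n) := Nat.pow_le_pow_right (by omega) (by omega)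
  have hsz0 : 0 < sz := Nat.pos_of_ne_zero fun h => by
    rw [h, mul_zero] at hsz
    exact absurd hsz.symm (Nat.two_pow_pos _).ne'
  have hgr : gr ≤ gr * sz := Nat.le_mul_of_pos_right _ hsz0
  refine wp_for (n := gr) (fun i s' => s'.At E A b a μ ([] : List (Op I.layout.nv))
      (T + 1 + ((a + 60) * (T₂ + sz * (2 * I.m + 2)) + 12) * i) ∧
      s'.Outcome (∃ g < i, ∃ j < sz, I.Sat (g * sz + j)))
      (session_sets A τ κ M (by simp)) (session_sets A τ κ M (by simp [constRegs])) (by simp)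
      hI.grp (by omega) ?_ ?_ ?_
  · exact ⟨hs.congr rfl (by simp) (by simp; omega), Or.inr ⟨by simp [hout], by simp⟩⟩
  · rintro i hi s' hF hi' ⟨hat, hout⟩
    obtain ⟨Ts, hS, hT⟩ := hS i
    refine wp_session hE hA (hI.frame (for_keeps (by simp [constRegs])
      (session_keeps A τ κ M)) hF).tick hi' hi hsz hM hS hT hl
      (hat.congr (s' := s'.tick) (T' := T +
          1 + ((a + 60) * (T₂ + sz * (2 * I.m + 2)) + 12) * i + 1) rfl rfl (by simp; omega))
      (hout.congr rfl Iff.rfl) ?_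
    intro s'' _ hat' hout'
    refine ⟨hat'.congr rfl (by simp) (by simp only [State.set_time]; rw [mul_add _ i 1]; omega), hout'.congr (by simp) ?_⟩
    constructor
    · rintro (⟨g, hg, h⟩ | h)
      · exact ⟨g, by omega, h⟩
      · exact ⟨i, by omega, h⟩
    · rintro ⟨g, hg, h⟩
      rcases Nat.lt_succ_iff_lt_or_eq.1 hg with hg | rfl
      · exact Or.inl ⟨g, hg, h⟩
      · exact Or.inr h
  · rintro s' hF hi' ⟨⟨-, t, hst, -, htime⟩, hout⟩
    obtain ⟨-, rfl⟩ := hst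
    refine hQ _ ?_ (hout.congr rfl ⟨?_, ?_⟩)
    · simp at htime ⊢
      rw [mul_comm] at htime
      omega
    · rintro ⟨g, hg, j, hj, h⟩
      refine ⟨g * sz + j, ?_, h⟩
      calc g * sz + j < g * sz + sz := by omega
        _ = (g + 1) * sz := by ring
        _ ≤ gr * sz := Nat.mul_le_mul_right _ hg
        _ = _ := hsz
    · rintro ⟨x, hx, h⟩
      rw [← hsz] at hx
      refine ⟨x / sz, Nat.div_lt_of_lt_mul (by rwa [mul_comm]), x % sz, Nat.mod_lt _ hsz0, ?_⟩
      rwa [Nat.div_add_mod']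

end Search

end DynSCC

namespace DynSCC

/-! ## The program of the reduction: the start graph -/

/-- The word for a partial assignment `b` of the graph. -/
def openExpr (b : Expr) : Expr := b + (Reg.w - 1 - b) * (1 : Expr) <<< (Reg.n : Expr)

/-- Tell whether `u` and `v` are the source and a clause linked to it at the start. -/
def linkTest : Mode → Expr
  | .dec => .lt Reg.u 1 * .lt 0 Reg.v * .lt Reg.v (Reg.m + 1)
  | _ => 0

/-- Tell whether `u` and `v` are adjacent in the start graph. -/
def edgeTest (M : Mode) : Expr :=
  .lt Reg.v 1 * .lt 0 Reg.u +
    .lt 0 Reg.u * .lt Reg.u (Reg.m + 1) * .lt Reg.m Reg.v * .lt Reg.v (Reg.m + Reg.w + 1) *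
      .lt (.arr .clause (Reg.u - 1) &&& openExpr (Reg.v - Reg.m - 1)) 1 +
    linkTest M

/-- Run `c` for all edges of the start graph. -/
def edgeLoop (M : Mode) (c : Cmd) : Cmd :=
  .for .x .ne (.assign .u (Reg.x / Reg.nv) ;; .assign .v (Reg.x % Reg.nv) ;;
    .assign .flag (edgeTest M) ;; .ite Reg.flag c .skip)

/-- Append an edge to the input of the preprocessing. -/
def listEdge : Cmd :=
  .store .mem (2 * Reg.cnt + 2) Reg.u ;; .store .mem (2 * Reg.cnt + 3) Reg.v ;;
    .assign .cnt (Reg.cnt + 1)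

/-- Bring the algorithm to the start graph. -/
def startCmd (A : DynAlg) : Mode → Cmd
  | .dec => .assign .cnt 0 ;; edgeLoop .dec listEdge ;; .store .mem 0 Reg.nv ;;
      .store .mem 1 Reg.cnt ;; .assign .lp 0 ;; call A.init ;; .assign .lp 0
  | M => .store .mem 0 Reg.nv ;; .store .mem 1 ((3 * Reg.m + 3 : Expr) * Reg.nv) ;; .assign .lp 0 ;;
      call A.init ;; .assign .lp 0 ;; edgeLoop M (call₂ A.insert Reg.u Reg.v) ;; .assign .lp 0

/-- The expression has value `0` or `1`. -/
def Expr.Bit (E : Env) (s : State) (e : Expr) : Prop := e.Ok E s ∧ e.eval E s ≤ 1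

theorem ite_mul_ite (p q : Prop) [Decidable p] [Decidable q] :
    (if p then 1 else 0) * (if q then 1 else 0) = if p ∧ q then 1 else 0 := by
  by_cases p <;> by_cases q <;> simp [*]

/-- Each alternative of adjacency is a product of bits and the test is their sum, so it is nonzero
if and only if some alternative holds. All factors are evaluated for every pair; truncated
subtraction keeps masks and addresses in range even where `u` is no clause or `v` no assignment. -/
theorem edgeTest_spec {E : Env} {I : Inst} {M : Mode} {k b l Z sz gr u v : ℕ} {s : State}
    (hE : E.Fits I k b l Z) (hI : I.Const sz gr s) (hu : s.reg .u = u) (hv : s.reg .v = v)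
    (hu' : u < I.layout.nv) (hv' : v < I.layout.nv) : (edgeTest M).Ok E s ∧
      ((edgeTest M).eval E s ≠ 0 ↔ I.layout.Adj M.start u v) ∧ (edgeTest M).eval E s ≤ 3 := by
  have h1 := hE.bound
  have h2 := hE.pow
  have h3 := hE.le
  have h4 := hE.nv_le
  have h5 := hE.base
  have h6 : I.layout.nv = 2 ^ I.p + 6 * I.m + 8 := rfl
  have h7 : 0 < 2 ^ I.p := Nat.two_pow_pos _
  have h8 : 2 ^ I.p * 2 ^ I.n ≤ 2 ^ (2 * I.n) := by
    rw [← pow_add]; exact Nat.pow_le_pow_right (by omega) (by omega)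
  have h9 : (2 ^ I.p - 1 - (v - I.m - 1)) * 2 ^ I.n ≤ 2 ^ I.p * 2 ^ I.n :=
    Nat.mul_le_mul_right _ (by omega)
  have h10 : 2 ^ I.n ≤ 2 ^ (2 * I.n) := Nat.pow_le_pow_right (by omega) (by omega)
  have hop : (openExpr (Reg.v - Reg.m - 1)).eval E s = I.openMask (v - I.m - 1) := by
    simp [openExpr, hI.n, hI.m, hI.w, hv, Inst.openMask]
  have hopok : (openExpr (Reg.v - Reg.m - 1)).Ok E s := by
    simp [openExpr, hI.n, hI.m, hI.w, hv]
    omega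
  have hand := Nat.and_le_right (n := s.arr .clause (u - 1)) (m := I.openMask (v - I.m - 1))
  have hom : I.openMask (v - I.m - 1) = v - I.m - 1 + (2 ^ I.p - 1 - (v - I.m - 1)) * 2 ^ I.n := rfl
  have hadj : I.layout.Adj M.start u v ↔ (v = 0 ∧ 0 < u) ∨ (0 < u ∧ u < I.m + 1 ∧ I.m < v ∧
      v < I.m + 2 ^ I.p + 1 ∧ s.arr .clause (u - 1) &&& I.openMask (v - I.m - 1) = 0) ∨
      (u = 0 ∧ 0 < v ∧ v < I.m + 1 ∧ M.start (v - 1) = true) := by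
    refine or_congr Iff.rfl (or_congr ?_ Iff.rfl)
    refine and_congr_right fun e1 => and_congr_right fun e2 => ?_
    have : u - 1 < I.m := by
      have : I.layout.m = I.m := rfl
      omega
    simp only [hI.cl _ this]
    simp [Inst.layout]
  have hle : ∀ p : Prop, ∀ [Decidable p], (if p then 1 else 0) ≤ 1 := by
    intro p _; split_ifs <;> omega
  rw [hadj]
  clear hadj
  generalize hX : s.arr .clause (u - 1) &&& I.openMask (v - I.m - 1) = X at *
  have hev : (edgeTest M).eval E s = (if v < 1 ∧ 0 < u then 1 else 0) +
      (if (((0 < u ∧ u < I.m + 1) ∧ I.m < v) ∧ v < I.m + 2 ^ I.p + 1) ∧ X < 1 then 1 else 0) +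
      (if M.start 0 = true ∧ (u < 1 ∧ 0 < v) ∧ v < I.m + 1 then 1 else 0) := by
    cases M <;> simp only [edgeTest, linkTest, Expr.eval_add, Expr.eval_mul, Expr.eval_lt, Expr.eval_var,
      Expr.eval_and, Expr.eval_arr, Expr.eval_sub, Expr.eval_ofNat, hu, hv, hI.m, hI.w, hop, hX,
      ite_mul_ite, Mode.start, Bool.false_eq_true, false_and, if_false, true_and]
  have hlt : ∀ {e₁ e₂ : Expr}, e₁.Ok E s → e₂.Ok E s → Expr.Bit E s (.lt e₁ e₂) :=
    fun h1 h2 => ⟨⟨h1, h2⟩, by simp only [Expr.eval_lt]; split_ifs <;> omega⟩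
  have hmul : ∀ {e₁ e₂ : Expr}, e₁.Bit E s → e₂.Bit E s → (e₁ * e₂).Bit E s := by
    rintro e₁ e₂ ⟨h1, h2⟩ ⟨h3, h4⟩
    have : e₁.eval E s * e₂.eval E s ≤ 1 := Nat.mul_le_mul h2 h4
    exact ⟨(Expr.ok_mul ..).2 ⟨h1, h3, by omega⟩, this⟩
  have o0 : ∀ r : Reg, (r : Expr).Ok E s := fun r => trivial
  have o1 : (1 : Expr).Ok E s := by simp; omega
  have o2 : (0 : Expr).Ok E s := by simp; omega
  have o3 : (Reg.m + 1 : Expr).Ok E s := by simp [hI.m]; omega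
  have o4 : (Reg.m + Reg.w + 1 : Expr).Ok E s := by simp [hI.m, hI.w]; omega
  have o5 : (Expr.arr .clause (Reg.u - 1) &&& openExpr (Reg.v - Reg.m - 1)).Ok E s := by
    simp only [Expr.ok_and, Expr.ok_arr, Expr.ok_sub, Expr.ok_var, Expr.ok_ofNat, hopok,
      Expr.eval_arr, Expr.eval_sub, Expr.eval_var, Expr.eval_ofNat, hu, hop, hX]
    simp only [true_and]; omega
  have b1 := hmul (hlt (o0 .v) o1) (hlt o2 (o0 .u))
  have b2 := hmul (hmul (hmul (hmul (hlt o2 (o0 .u)) (hlt (o0 .u) o3)) (hlt (o0 .m) (o0 .v)))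
    (hlt (o0 .v) o4)) (hlt o5 o1)
  have b3 : (linkTest M).Bit E s := by
    cases M
    · exact ⟨o2, Nat.zero_le _⟩
    · exact ⟨o2, Nat.zero_le _⟩
    · exact hmul (hmul (hlt (o0 .u) o1) (hlt o2 (o0 .v))) (hlt (o0 .v) o3)
  have hok : (edgeTest M).Ok E s := by
    have e1 := b1.2
    have e2 := b2.2
    have e3 := b3.2
    have e4 : _ + _ < E.bound := show _ + _ < E.bound from
      lt_of_le_of_lt (Nat.add_le_add e1 e2) (by omega)
    exact (Expr.ok_add ..).2 ⟨(Expr.ok_add ..).2 ⟨b1.1, b2.1, e4⟩, b3.1,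
      lt_of_le_of_lt (Nat.add_le_add (Nat.add_le_add e1 e2) e3) (by omega)⟩
  refine ⟨hok, ?_, ?_⟩
  · rw [hev]
    have : M.start (v - 1) = M.start 0 := by cases M <;> rfl
    rw [this]
    cases hm : M.start 0 <;>
      simp only [Bool.false_eq_true, true_and, false_and, if_false, and_true, and_false, or_false] <;>
      split_ifs <;> omega
  · rw [hev]; split_ifs <;> omega

/-- The loop visits all `nv * nv` pairs. The invariant may depend only on the arrays, the length of
the log, the counter and the time, so it is insensitive to the registers used to decode a pair. -/
theorem wp_edgeLoop {E : Env} {I : Inst} {M : Mode} {k b l Z sz gr : ℕ} {c : Cmd} {s : State}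
    {Q : State → Prop} (J : ℕ → State → Prop) (hE : E.Fits I k b l Z) (hI : I.Const sz gr s)
    (hc : c.Keeps) (hcx : c.sets .x = false) (h0 : J 0 (s.set .x 0))
    (hadj : ∀ i < I.layout.nv * I.layout.nv,
      I.layout.Adj M.start (i / I.layout.nv) (i % I.layout.nv) → ∀ s₀ s', J i s₀ →
      s'.arr = s₀.arr → s'.reg .lp = s₀.reg .lp → s'.reg .cnt = s₀.reg .cnt →
      s'.time ≤ s₀.time + 5 → s'.reg .u = i / I.layout.nv → s'.reg .v = i % I.layout.nv →
      WP E c s' fun s'' => J (i + 1) (s''.set .x (i + 1)))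
    (hnot : ∀ i < I.layout.nv * I.layout.nv,
      ¬ I.layout.Adj M.start (i / I.layout.nv) (i % I.layout.nv) → ∀ s₀ s', J i s₀ →
      s'.arr = s₀.arr → s'.reg .lp = s₀.reg .lp → s'.reg .cnt = s₀.reg .cnt →
      s'.time ≤ s₀.time + 6 → J (i + 1) s')
    (hQ : ∀ s', (edgeLoop M c).Frame s s' → J (I.layout.nv * I.layout.nv) s' → Q s'.tick) :
    WP E (edgeLoop M c) s Q := by
  have h1 := hE.bound
  have h2 := hE.nv
  have h3 := hE.nv_le
  refine wp_for (n := I.layout.nv * I.layout.nv) J (by simp [Cmd.sets, hcx])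
    (by simp [Cmd.sets, hc.1 .ne (by simp [constRegs])]) (by simp) hI.ne (by omega) h0 ?_
    (fun s' hF _ h => hQ s' hF h)
  intro i hi s' hF hi' hJ
  have hk : (edgeLoop M c).Keeps := by
    refine for_keeps (by simp [constRegs]) ⟨fun r hr => ?_, by simp [Cmd.setsArr, hc.2]⟩
    have : r ≠ .u ∧ r ≠ .v ∧ r ≠ .flag := by
      simp [constRegs] at hr
      rcases hr with rfl | rfl | rfl | rfl | rfl | rfl | rfl | rfl <;> simp
    simp [Cmd.sets, hc.1 r hr, this]
  have hI' := hI.frame hk hF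
  have hd : i / I.layout.nv < I.layout.nv := Nat.div_lt_of_lt_mul hi
  have hm : i % I.layout.nv < I.layout.nv := Nat.mod_lt _ I.layout.nv_pos
  simp only [wp_seq, wp_assign, wp_ite]
  have e1 : (Reg.x / Reg.nv : Expr).eval E s'.tick = i / I.layout.nv := by simp [hi', hI'.nv]
  rw [e1]
  have e2 : (Reg.x % Reg.nv : Expr).eval E (s'.tick.set .u (i / I.layout.nv)) =
      i % I.layout.nv := by simp [hi', hI'.nv]
  rw [e2]
  obtain ⟨e3, e4, e5⟩ := edgeTest_spec (M := M) (u := i / I.layout.nv) (v := i % I.layout.nv)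
    (s := (s'.tick.set .u (i / I.layout.nv)).set .v (i % I.layout.nv)) hE
    (⟨by simpa using hI'.n, by simpa using hI'.p, by simpa using hI'.m, by simpa using hI'.w,
      by simpa using hI'.nv, by simpa using hI'.ne, by simpa using hI'.s, by simpa using hI'.grp,
      by simpa using hI'.cl⟩ : I.Const sz gr _) (by simp) (by simp) hd hm
  refine ⟨by simp [hi', hI'.nv]; omega, by simp [hi', hI'.nv]; omega, e3, trivial,
    fun hne => ?_, fun heq => ?_⟩
  · exact hadj i hi (e4.1 (by simpa using hne)) s' _ hJ rfl (by simp) (by simp) (by simp) (by simp)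
      (by simp)
  · rw [wp_skip]
    exact hnot i hi (fun h => e4.2 h (by simpa using heq)) s' _ hJ rfl (by simp) (by simp) (by simp)

theorem Layout.edgesBelow_succ (D : Layout) (c : ℕ → Bool) (k : ℕ) : D.edgesBelow c (k + 1) =
    D.edgesBelow c k ++ if D.Adj c (k / D.nv) (k % D.nv) then [D.pair k] else [] := by
  rw [Layout.edgesBelow, List.range_succ, List.filter_append, List.map_append]
  by_cases h : D.Adj c (k / D.nv) (k % D.nv) <;> simp [h, Layout.edgesBelow]

theorem Layout.edgesBelow_prefix (D : Layout) (c : ℕ → Bool) {k k' : ℕ} (h : k ≤ k') :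
    D.edgesBelow c k <+: D.edgesBelow c k' := by
  obtain ⟨r, rfl⟩ := Nat.exists_eq_add_of_le h
  rw [Layout.edgesBelow, Layout.edgesBelow, List.range_add, List.filter_append, List.map_append]
  exact List.prefix_append _ _

theorem writeArgs_append (xs : List ℕ) (x : ℕ) :
    Function.update (writeArgs xs 0) xs.length x = writeArgs (xs ++ [x]) 0 := by
  funext z
  rw [Function.update_apply]
  split_ifs with h
  · simp [writeArgs, h]
  · rcases lt_or_gt_of_ne h with h | h
    · simp [writeArgs, List.getD_eq_getElem?_getD, List.getElem?_append_left h]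
    · simp only [writeArgs, List.getD_eq_getElem?_getD]
      rw [List.getElem?_eq_none (l := xs) (by omega),
        List.getElem?_eq_none (l := xs ++ [x]) (by rw [List.length_append]; simp; omega)]

end DynSCC

/-! ### Preprocessing and insertion of the edges of the start graph. -/

namespace DynSCC

theorem listEdge_keeps : listEdge.Keeps := by
  refine ⟨by simp [constRegs, listEdge, Cmd.sets], by simp [listEdge, Cmd.setsArr]⟩

theorem call₂_keeps (P : Program) (e₁ e₂ : Expr) : (call₂ P e₁ e₂).Keeps :=
  ⟨by simp [constRegs, call₂_sets], call₂_setsArr P e₁ e₂⟩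

theorem edgeLoop_shallow {M : Mode} {c : Cmd} (hc : c.Shallow) : (edgeLoop M c).Shallow := by
  cases M <;> simp [edgeLoop, Cmd.for, Cmd.Shallow, hc, edgeTest, linkTest, openExpr]

theorem startCmd_shallow (A : DynAlg) (M : Mode) : (startCmd A M).Shallow := by
  have h1 : (edgeLoop M (call₂ A.insert Reg.u Reg.v)).Shallow :=
    edgeLoop_shallow (call₂_shallow (by simp) (by simp))
  have h2 : (edgeLoop .dec listEdge).Shallow :=
    edgeLoop_shallow (by simp [listEdge, Cmd.Shallow])
  cases M <;> simp [startCmd, Cmd.Shallow, call_shallow, h1, h2]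

theorem startCmd_sets (A : DynAlg) (M : Mode) {r : Reg} (hr : r ∈ constRegs ∨ r = .out) :
    (startCmd A M).sets r = false := by
  have : r ≠ .pc ∧ r ≠ .addr ∧ r ≠ .val ∧ r ≠ .lp ∧ r ≠ .x ∧ r ≠ .u ∧ r ≠ .v ∧ r ≠ .flag ∧
      r ≠ .cnt := by
    rcases hr with hr | rfl
    · simp [constRegs] at hr
      rcases hr with rfl | rfl | rfl | rfl | rfl | rfl | rfl | rfl <;> simp
    · simp
  cases M <;> simp [startCmd, Cmd.sets, edgeLoop, Cmd.for, call₂_sets, call_sets, listEdge, this]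

theorem startCmd_keeps (A : DynAlg) (M : Mode) : (startCmd A M).Keeps := by
  refine ⟨fun r hr => startCmd_sets A M (Or.inl hr), ?_⟩
  cases M <;> simp [startCmd, Cmd.setsArr, edgeLoop, Cmd.for, call₂_setsArr, call_setsArr, listEdge]

/-- Setting the length of the log to `0` declares the current memory to be the point to which later
rollbacks return. -/
theorem State.logged_of_lp {E : Env} {s : State} (h : s.reg .lp = 0) :
    s.Logged E (s.arr .mem) := by
  refine ⟨?_, by simp [h]⟩
  rw [State.orig, h]; rfl

section Start

variable {E : Env} {I : Inst} {A : DynAlg} {k b l Z a sz gr : ℕ} {τ : QueryType}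
  {M : Mode} {s : State} {Q : State → Prop}

theorem wp_callInit {μ₀ : Memory} {t₀ : ℕ} (hE : E.Fits I k b l Z) (hA : A.BoundedBy k a)
    (h : RunsTo A.init b 0 (s.arr .mem) t₀ μ₀) (hl : t₀ ≤ l)
    (hQ : ∀ s', (Cmd.assign .lp 0 ;; call A.init ;; .assign .lp 0).Frame s s' →
      s'.At E A b a μ₀ ([] : List (Op I.layout.nv)) (s.time + a * t₀ + 4) → Q s') :
    WP E (.assign .lp 0 ;; call A.init ;; .assign .lp 0) s Q := by
  have h1 := hE.bound
  have h2 := hE.nv_le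
  have hlen := (hA.length A.init (by simp)).2
  have : WP E (.assign .lp 0 ;; call A.init ;; .assign .lp 0) s (fun s' =>
      s'.At E A b a μ₀ ([] : List (Op I.layout.nv)) (s.time + a * t₀ + 4)) := by
    rw [wp_seq, wp_assign]
    refine ⟨by simp; omega, ?_⟩
    rw [wp_seq]
    refine wp_call hE.room (hA.const _ (by simp)) (hA.length _ (by simp)).1 (by simpa using hl)
      h ?_
    intro s' _ hmem _ _ htime
    rw [wp_assign]
    refine ⟨by simp; omega, ?_, 0, ⟨by simpa using hmem, rfl⟩, by simp, ?_⟩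
    · rw [← hmem]; exact State.logged_of_lp (s := s'.set .lp _) (by simp)
    · have : (A.init.length + 8) * t₀ ≤ a * t₀ := Nat.mul_le_mul_right _ (by omega)
      simp at htime ⊢
      omega
  exact this.frame.mono fun s' ⟨h1, h2⟩ => hQ s' h1 h2

/-- The log of the construction is dropped at the end, so that sessions are rolled back to `μ₁` and
not to the state `μ₀` before the edges. -/
theorem wp_insertEdges {μ₀ μ₁ : Memory} {t₁ T : ℕ} {Ts : List ℕ} (hM : M ≠ .dec)
    (hE : E.Fits I k b l Z) (hA : A.BoundedBy k a) (hI : I.Const sz gr s)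
    (hS : A.Serves b τ (ofEdges (I.layout.initial M)) μ₀
      (I.layout.build M (I.layout.nv * I.layout.nv)) Ts)
    (hst : A.Steps b μ₀ (I.layout.build M (I.layout.nv * I.layout.nv)) μ₁ t₁)
    (hl : Ts.sum + 2 * (I.layout.nv * I.layout.nv) ≤ l)
    (hs : s.At E A b a μ₀ ([] : List (Op I.layout.nv)) T)
    (hQ : ∀ s', s'.At E A b a μ₁ ([] : List (Op I.layout.nv))
        (T + a * (Ts.sum + I.layout.nv * I.layout.nv) + 8 * (I.layout.nv * I.layout.nv) + 3) →
      Q s') :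
    WP E (edgeLoop M (call₂ A.insert Reg.u Reg.v) ;; .assign .lp 0) s Q := by
  have hb : ∀ i, I.layout.build M i = insertions (I.layout.edgesBelow M.start i) := by
    intro i; cases M <;> first | rfl | exact absurd rfl hM
  have hlen : ∀ i, (I.layout.build M i).length ≤ i := by
    intro i
    rw [hb, insertions, List.length_map, Layout.edgesBelow, List.length_map]
    exact (List.length_filter_le _ _).trans (by simp)
  have h1 := hE.bound
  have h2 := hE.nv_le
  rw [wp_seq]
  refine wp_edgeLoop (fun i s' => s'.At E A b a μ₀ (I.layout.build M i) (T + 8 * i + 1)) hE hI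
    (call₂_keeps _ _ _) (call₂_sets _ _ _ (by simp) (by simp) (by simp) (by simp)) ?_ ?_ ?_ ?_
  · have : I.layout.build M 0 = [] := by rw [hb]; rfl
    rw [this]
    exact hs.congr rfl (by simp) (by simp; omega)
  · intro i hi hadj s₀ s' hat e1 e2 e3 e4 e5 e6
    have hsucc : I.layout.build M (i + 1) = I.layout.build M i ++
        [.insert (I.layout.pair i).1 (I.layout.pair i).2] := by
      rw [hb, hb, Layout.edgesBelow_succ, if_pos hadj]; simp [insertions]
    obtain ⟨rest, hrest⟩ := I.layout.edgesBelow_prefix M.start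
      (show i + 1 ≤ I.layout.nv * I.layout.nv from hi)
    have hS' := hS
    rw [hb, ← hrest, insertions, List.map_append] at hS'
    change A.Serves b τ _ μ₀ (insertions (I.layout.edgesBelow M.start (i + 1)) ++ _) Ts at hS'
    rw [← hb, hsucc, List.append_assoc, List.singleton_append] at hS'
    have hd : i / I.layout.nv < I.layout.nv := Nat.div_lt_of_lt_mul hi
    have hm : i % I.layout.nv < I.layout.nv := Nat.mod_lt _ I.layout.nv_pos
    have := hlen i
    refine wp_call₂ (T := T + 8 * i + 6) (o := .insert (I.layout.pair i).1 (I.layout.pair i).2)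
      hE.room hA hS' (by omega)
      (hat.congr e1 e2 (by omega)) (show [_, _] = [i / I.layout.nv, i % I.layout.nv] by
        simp only [Layout.pair]; rw [I.layout.vtx_val hd, I.layout.vtx_val hm]) ?_ ?_
    · intro s'' hs''
      exact ⟨⟨trivial, (hs'' .u (by simp) (by simp) (by simp)).trans e5⟩,
        trivial, (hs'' .v (by simp) (by simp) (by simp)).trans e6⟩
    · intro s'' hF hat' _
      rw [hsucc]
      exact hat'.congr rfl (by simp) (by simp; omega)
  · intro i hi hadj s₀ s' hat e1 e2 e3 e4
    have hsucc : I.layout.build M (i + 1) = I.layout.build M i := by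
      rw [hb, hb, Layout.edgesBelow_succ, if_neg hadj, List.append_nil]
    rw [hsucc]
    exact hat.congr e1 e2 (by omega)
  · rintro s' - ⟨-, t, hst', -, htime⟩
    obtain ⟨hmem, rfl⟩ := hst.unique hst'
    have ht := (show A.Serves b τ _ μ₀ (_ ++ []) Ts by rwa [List.append_nil]).steps_le hst
    rw [wp_assign]
    refine ⟨by simp; omega, hQ _ ⟨?_, 0, ⟨by simp [hmem], rfl⟩, by simp, ?_⟩⟩
    · rw [hmem]; exact State.logged_of_lp (s := s'.tick.set .lp _) (by simp)
    · have := hlen (I.layout.nv * I.layout.nv)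
      have : a * (t₁ + (I.layout.build M (I.layout.nv * I.layout.nv)).length) ≤
        a * (Ts.sum + I.layout.nv * I.layout.nv) := Nat.mul_le_mul_left _ (by omega)
      simp
      omega

end Start

end DynSCC

/-! ### The edge list for the decremental mode, and the start in all three modes. -/

namespace DynSCC

section Start

variable {E : Env} {I : Inst} {A : DynAlg} {k b l Z a sz gr : ℕ} {τ : QueryType}
  {M : Mode} {s : State} {Q : State → Prop}

/-- The numbers that encode a list of edges. -/
def encodeEdges {n : ℕ} (es : List (Fin n × Fin n)) : List ℕ :=
  es.flatMap fun e => [e.1.val, e.2.val]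

theorem length_encodeEdges {n : ℕ} (es : List (Fin n × Fin n)) :
    (encodeEdges es).length = 2 * es.length := by
  induction es with
  | nil => rfl
  | cons e es ih => simp [encodeEdges] at ih ⊢; omega

theorem update_writeArgs_zero (x y : ℕ) (xs : List ℕ) :
    Function.update (writeArgs (y :: xs) 0) 0 x = writeArgs (x :: xs) 0 := by
  funext z
  cases z <;> simp [writeArgs]

theorem update_writeArgs_one (w x y : ℕ) (xs : List ℕ) :
    Function.update (writeArgs (w :: y :: xs) 0) 1 x = writeArgs (w :: x :: xs) 0 := by
  funext z
  rcases z with _ | _ | z <;> simp [writeArgs]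

/-- The edges are written from cell `2` on while they are counted; cells `0` and `1`, for the
numbers of vertices and edges, are filled in once the count is known. No log is needed before the
preprocessing. -/
theorem wp_listEdges (hE : E.Fits I k b l Z) (hI : I.Const sz gr s) (hc : s.reg .cnt = 0)
    (hmem : s.arr .mem = 0)
    (hQ : ∀ s', (edgeLoop .dec listEdge).Frame s s' → s'.reg .cnt = I.layout.updates .dec →
      s'.arr .mem = writeArgs (0 :: 0 :: encodeEdges (I.layout.initial .dec)) 0 →
      s'.time ≤ s.time + 9 * (I.layout.nv * I.layout.nv) + 2 → Q s') :
    WP E (edgeLoop .dec listEdge) s Q := by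
  have h1 := hE.bound
  have h2 := hE.nv
  have h3 := hE.base
  have h4 := hE.nv_le
  have h5 : I.layout.nv = 2 ^ I.p + 6 * I.m + 8 := rfl
  have h6 : 0 < 2 ^ I.p := Nat.two_pow_pos _
  have hlen : ∀ i, (I.layout.edgesBelow Mode.dec.start i).length ≤ i := by
    intro i
    rw [Layout.edgesBelow, List.length_map]
    exact (List.length_filter_le _ _).trans (by simp)
  refine wp_edgeLoop (fun i s' =>
    s'.reg .cnt = (I.layout.edgesBelow Mode.dec.start i).length ∧
    s'.arr .mem = writeArgs (0 :: 0 :: encodeEdges (I.layout.edgesBelow Mode.dec.start i)) 0 ∧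
    s'.time ≤ s.time + 1 + 9 * i) hE hI listEdge_keeps (by simp [listEdge, Cmd.sets]) ?_ ?_ ?_ ?_
  · refine ⟨by simpa [Layout.edgesBelow] using hc, ?_, by simp⟩
    simp only [State.set_arr, hmem, Layout.edgesBelow, List.range_zero, List.filter_nil,
      List.map_nil, encodeEdges, List.flatMap_nil]
    funext z
    rcases z with _ | _ | z <;> simp [writeArgs]
  · rintro i hi hadj s₀ s' ⟨j1, j2, j3⟩ e1 e2 e3 e4 e5 e6
    have hd : i / I.layout.nv < I.layout.nv := Nat.div_lt_of_lt_mul hi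
    have hm : i % I.layout.nv < I.layout.nv := Nat.mod_lt _ I.layout.nv_pos
    have hl := hlen i
    have hsucc := I.layout.edgesBelow_succ Mode.dec.start i
    rw [if_pos hadj] at hsucc
    rw [j1] at e3
    rw [← e1] at j2
    set L := I.layout.edgesBelow Mode.dec.start i
    have hlenc := length_encodeEdges L
    simp only [listEdge, wp_seq, wp_store, wp_assign]
    have a1 : (2 * Reg.cnt + 2 : Expr).eval E s' = (0 :: 0 :: encodeEdges L).length := by
      simp [e3, hlenc]
    have a2 : (Reg.u : Expr).eval E s' = i / I.layout.nv := e5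
    rw [a1, a2]
    set s₁ := s'.setArr .mem (0 :: 0 :: encodeEdges L).length (i / I.layout.nv)
    have a3 : (2 * Reg.cnt + 3 : Expr).eval E s₁ =
        (0 :: 0 :: encodeEdges L ++ [i / I.layout.nv]).length := by
      simp [s₁, e3, hlenc]
    have a4 : (Reg.v : Expr).eval E s₁ = i % I.layout.nv := e6
    rw [a3, a4]
    have a5 : s₁.arr .mem = writeArgs (0 :: 0 :: encodeEdges L ++ [i / I.layout.nv]) 0 := by
      simp only [s₁, State.setArr_arr, if_true, j2]
      exact writeArgs_append _ _
    have b1 : (0 :: 0 :: encodeEdges L).length = 2 * L.length + 2 := by simp [hlenc]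
    have b2 : (0 :: 0 :: encodeEdges L ++ [i / I.layout.nv]).length = 2 * L.length + 3 := by
      simp [hlenc]
    rw [b1, b2]
    have b3 : s₁.reg .cnt = L.length := e3
    refine ⟨by simp [e3]; omega, trivial, by omega, by simp [b3]; omega, trivial, by omega,
      by simp [b3]; omega, ?_, ?_, ?_⟩
    · simp [b3, hsucc]
    · have : encodeEdges (I.layout.edgesBelow Mode.dec.start (i + 1)) =
          encodeEdges L ++ [i / I.layout.nv] ++ [i % I.layout.nv] := by
        rw [hsucc, encodeEdges, List.flatMap_append]
        simp [encodeEdges, Layout.pair, I.layout.vtx_val hd, I.layout.vtx_val hm]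
      rw [this]
      simp only [State.set_arr, State.setArr_arr, if_true, a5, ← b2]
      exact writeArgs_append _ _
    · simp [s₁]; omega
  · rintro i hi hadj s₀ s' ⟨j1, j2, j3⟩ e1 e2 e3 e4
    rw [Layout.edgesBelow_succ, if_neg hadj, List.append_nil, e1, e3]
    exact ⟨j1, j2, by omega⟩
  · rintro s' hF ⟨j1, j2, j3⟩
    exact hQ _ ⟨fun r h => hF.reg r h, fun r h => hF.arr r h⟩ j1 j2 (by simp; omega)

theorem wp_start {μ₀ μ₁ : Memory} {t₀ t₁ T₀ T₁ : ℕ} {Ts : List ℕ}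
    (hE : E.Fits I k b l Z) (hA : A.BoundedBy k a) (hI : I.Const sz gr s)
    (hmem : s.arr .mem = 0)
    (hrun : RunsTo A.init b 0 (writeArgs (I.layout.nv :: I.layout.updates M ::
      (I.layout.initial M).flatMap (fun e => [e.1.val, e.2.val])) 0) t₀ μ₀) (ht₀ : t₀ ≤ T₀)
    (hS : A.Serves b τ (ofEdges (I.layout.initial M)) μ₀
      (I.layout.build M (I.layout.nv * I.layout.nv)) Ts) (hTs : Ts.sum ≤ T₁)
    (hst : A.Steps b μ₀ (I.layout.build M (I.layout.nv * I.layout.nv)) μ₁ t₁)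
    (hl : T₀ + T₁ + 2 * (I.layout.nv * I.layout.nv) ≤ l)
    (hQ : ∀ s', (startCmd A M).Frame s s' → s'.At E A b a μ₁ ([] : List (Op I.layout.nv))
      (s.time + a * (T₀ + T₁ + I.layout.nv * I.layout.nv) + 9 * (I.layout.nv * I.layout.nv) + 20) →
      Q s') :
    WP E (startCmd A M) s Q := by
  have h1 := hE.bound
  have h2 := hE.nv
  have h3 := hE.base
  have h4 := hE.nv_le
  have h5 : I.layout.nv = 2 ^ I.p + 6 * I.m + 8 := rfl
  have h6 : 0 < 2 ^ I.p := Nat.two_pow_pos _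
  have e1 : a * t₀ ≤ a * T₀ := Nat.mul_le_mul_left _ ht₀
  have e2 : a * (T₀ + T₁ + I.layout.nv * I.layout.nv) = a * T₀ +
    a * (T₁ + I.layout.nv * I.layout.nv) := by ring
  have e3 : a * (Ts.sum + I.layout.nv * I.layout.nv) ≤ a * (T₁ + I.layout.nv * I.layout.nv) :=
    Nat.mul_le_mul_left _ (by omega)
  suffices WP E (startCmd A M) s (fun s' => s'.At E A b a μ₁ ([] : List (Op I.layout.nv))
      (s.time + a * (T₀ + T₁ + I.layout.nv * I.layout.nv) +
        9 * (I.layout.nv * I.layout.nv) + 20)) from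
    this.frame.mono fun s' ⟨h, h'⟩ => hQ s' h h'
  have ins : M ≠ .dec → WP E (.store .mem 0 Reg.nv ;;
      .store .mem 1 ((3 * Reg.m + 3 : Expr) * Reg.nv) ;; .assign .lp 0 ;;
      call A.init ;; .assign .lp 0 ;; edgeLoop M (call₂ A.insert Reg.u Reg.v) ;; .assign .lp 0) s
      (fun s' => s'.At E A b a μ₁ ([] : List (Op I.layout.nv))
      (s.time + a * (T₀ + T₁ + I.layout.nv * I.layout.nv) +
        9 * (I.layout.nv * I.layout.nv) + 20)) := by
    intro hM
    have hup : I.layout.updates M = (3 * I.m + 3) * I.layout.nv := by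
      cases M <;> first | rfl | exact absurd rfl hM
    have hin : I.layout.initial M = [] := by
      cases M <;> first | rfl | exact absurd rfl hM
    rw [hup, hin, List.flatMap_nil] at hrun
    have hmul : (3 * I.m + 3) * I.layout.nv ≤ I.layout.nv * I.layout.nv :=
      Nat.mul_le_mul_right _ (by omega)
    rw [wp_seq, wp_store, wp_seq, wp_store]
    refine ⟨by simp; omega, trivial, by simp; omega, by simp; omega,
      by simp [hI.m, hI.nv]; omega, by simp; omega, ?_⟩
    set s₁ := (s.setArr .mem (Expr.eval E s 0) (Expr.eval E s Reg.nv))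
    set s₂ := s₁.setArr .mem (Expr.eval E s₁ 1) (Expr.eval E s₁ ((3 * Reg.m + 3 : Expr) * Reg.nv))
    have hI₂ : I.Const sz gr s₂ := ⟨hI.n, hI.p, hI.m, hI.w, hI.nv, hI.ne, hI.s, hI.grp,
      by simpa [s₂, s₁] using hI.cl⟩
    have hmem₂ : s₂.arr .mem = writeArgs [I.layout.nv, (3 * I.m + 3) * I.layout.nv] 0 := by
      funext z
      rcases z with _ | _ | z <;> simp [s₂, s₁, writeArgs, hmem, hI.m, hI.nv]
    have htime₂ : s₂.time = s.time + 2 := by simp [s₂, s₁]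
    clear_value s₁ s₂
    suffices WP E (.assign .lp 0 ;; call A.init ;; .assign .lp 0) s₂ (fun s' =>
        WP E (edgeLoop M (call₂ A.insert Reg.u Reg.v) ;; .assign .lp 0) s' (fun s' =>
        s'.At E A b a μ₁ ([] : List (Op I.layout.nv)) (s.time +
        a * (T₀ + T₁ + I.layout.nv * I.layout.nv) + 9 * (I.layout.nv * I.layout.nv) + 20))) by
      simpa only [wp_seq] using this
    refine wp_callInit hE hA (hmem₂ ▸ hrun) (by omega) ?_
    intro s₃ hF₃ hat₃
    have hI₃ := hI₂.frame ⟨by simp [constRegs, Cmd.sets, call_sets],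
      by simp [Cmd.setsArr, call_setsArr]⟩ hF₃
    refine wp_insertEdges hM hE hA hI₃ hS hst (by omega) hat₃ ?_
    intro s₄ hat₄
    exact hat₄.congr rfl rfl (by omega)
  cases M with
  | full => exact ins (by simp)
  | inc => exact ins (by simp)
  | dec =>
    -- There are no operations to serve, so the state after the preprocessing is already the start
    -- state.
    obtain ⟨rfl, rfl⟩ := hst
    rw [startCmd, wp_seq, wp_assign]
    refine ⟨by simp; omega, ?_⟩
    rw [wp_seq]
    refine wp_listEdges (sz := sz) (gr := gr) hE ⟨by simpa using hI.n, by simpa using hI.p,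
      by simpa using hI.m, by simpa using hI.w, by simpa using hI.nv, by simpa using hI.ne,
      by simpa using hI.s, by simpa using hI.grp, by simpa using hI.cl⟩ (by simp)
      (by simpa using hmem) ?_
    intro s₁ hF₁ hcnt₁ hmem₁ htime₁
    have hI₁ : s₁.reg .nv = I.layout.nv := by
      rw [hF₁.reg _ (by simp [edgeLoop, Cmd.for, Cmd.sets, listEdge])]; simpa using hI.nv
    rw [wp_seq, wp_store, wp_seq, wp_store]
    refine ⟨by simp; omega, trivial, by simp; omega, by simp; omega, trivial, by simp; omega, ?_⟩
    set s₂ := (s₁.setArr .mem (Expr.eval E s₁ 0) (Expr.eval E s₁ Reg.nv))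
    set s₃ := s₂.setArr .mem (Expr.eval E s₂ 1) (Expr.eval E s₂ Reg.cnt)
    have hmem₃ : s₃.arr .mem = writeArgs (I.layout.nv :: I.layout.updates .dec ::
        encodeEdges (I.layout.initial .dec)) 0 := by
      simp only [s₃, s₂, State.setArr_arr, if_true, Expr.eval_ofNat, hmem₁, Expr.eval_var,
        State.setArr_reg, hI₁, hcnt₁]
      rw [update_writeArgs_zero, update_writeArgs_one]
    have htime₃ : s₃.time = s₁.time + 2 := by simp [s₃, s₂]
    clear_value s₂ s₃
    refine wp_callInit hE hA (hmem₃ ▸ hrun) (by omega) ?_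
    intro s₄ _ hat₄
    refine hat₄.congr rfl rfl ?_
    simp at htime₁
    omega

end Start

end DynSCC

namespace DynSCC

/-! ## Formulas as instances -/

/-- The position of a literal in a word of literals. -/
def litPos {n : ℕ} (l : Literal n) : ℕ := l.1.val + n * (1 - l.2.toNat)

/-- Insert the literal with a given code into a word of literals. -/
def addLit (n w code : ℕ) : ℕ := w ||| 1 <<< (code / 2 + n * (1 - code % 2))

/-- A clause as a word of literals. -/
def clauseWord {n : ℕ} (c : List (Literal n)) : ℕ := (c.map litCode).foldl (addLit n) 0

theorem litCode_spec {n : ℕ} (l : Literal n) :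
    litCode l / 2 + n * (1 - litCode l % 2) = litPos l := by
  obtain ⟨v, b⟩ := l
  cases b <;> simp [litCode, litPos]; omega

theorem litPos_lt {n : ℕ} (l : Literal n) : litPos l < 2 * n := by
  obtain ⟨v, b⟩ := l
  have := v.2
  cases b <;> simp [litPos] <;> omega

theorem testBit_foldl_addLit {n : ℕ} (c : List (Literal n)) : ∀ (w i : ℕ),
    ((c.map litCode).foldl (addLit n) w).testBit i = true ↔
      w.testBit i = true ∨ ∃ l ∈ c, litPos l = i := by
  induction c with
  | nil => simp
  | cons l c ih =>
    intro w i
    rw [List.map_cons, List.foldl_cons, ih, addLit, litCode_spec, Nat.testBit_or,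
      Nat.one_shiftLeft, Nat.testBit_two_pow]
    simp [or_assoc]

theorem testBit_clauseWord {n : ℕ} (c : List (Literal n)) (i : ℕ) :
    (clauseWord c).testBit i = true ↔ ∃ l ∈ c, litPos l = i := by
  rw [clauseWord, testBit_foldl_addLit]; simp

theorem foldl_addLit_lt {n : ℕ} (c : List (Literal n)) :
    (c.map litCode).foldl (addLit n) 0 < 2 ^ (2 * n) := by
  refine Nat.lt_pow_two_of_testBit _ fun i hi => ?_
  by_contra h
  rw [Bool.not_eq_false, testBit_foldl_addLit] at h
  obtain h | ⟨l, -, rfl⟩ := h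
  · simp at h
  · have := litPos_lt l
    omega

theorem clauseWord_and {n : ℕ} (c : List (Literal n)) (w : ℕ) :
    clauseWord c &&& w = 0 ↔ ∀ l ∈ c, w.testBit (litPos l) = false := by
  constructor
  · intro h l hl
    have h1 := congrArg (fun x => x.testBit (litPos l)) h
    simp only [Nat.testBit_and, Nat.zero_testBit] at h1
    rw [(testBit_clauseWord c _).2 ⟨l, hl, rfl⟩] at h1
    simpa using h1
  · intro h
    refine Nat.eq_of_testBit_eq fun i => ?_
    rw [Nat.testBit_and, Nat.zero_testBit]
    cases hc : (clauseWord c).testBit i with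
    | false => rfl
    | true =>
      obtain ⟨l, hl, rfl⟩ := (testBit_clauseWord c i).1 hc
      simp [h l hl]

/-- The instance for a formula. -/
def CNF.inst {n : ℕ} (φ : CNF n) (p : ℕ) : Inst :=
  ⟨n, p, φ.length, fun j => clauseWord (φ.getD j [])⟩

/-- Bit `i` of a word stands for variable `i` and bit `n + i` for its negation. As `2 ^ p - 1 - b`
is the bitwise complement of `b` on `p` bits, the upper half records the variables that `b` makes
false. -/
theorem Inst.testBit_openMask {I : Inst} {b : ℕ} (h : I.p ≤ I.n) (hb : b < 2 ^ I.p) (i : ℕ) :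
    (I.openMask b).testBit i =
      if i < I.n then b.testBit i else decide (i - I.n < I.p) && !b.testBit (i - I.n) := by
  have h1 : b < 2 ^ I.n := hb.trans_le (Nat.pow_le_pow_right (by omega) h)
  rw [Inst.openMask, add_comm, mul_comm, Nat.testBit_two_pow_mul_add _ h1, Nat.sub_sub, add_comm 1,
    Nat.testBit_two_pow_sub_succ hb]

theorem Inst.testBit_linkMask {I : Inst} {x : ℕ} (h : I.p ≤ I.n) (hx : x < 2 ^ (I.n - I.p))
    (i : ℕ) : (I.linkMask x).testBit i =
      if i < I.n + I.p then decide (I.p ≤ i) && x.testBit (i - I.p)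
      else decide (i - (I.n + I.p) < I.n - I.p) && !x.testBit (i - (I.n + I.p)) := by
  have h1 : x * 2 ^ I.p < 2 ^ (I.n + I.p) := by
    calc x * 2 ^ I.p < 2 ^ (I.n - I.p) * 2 ^ I.p := Nat.mul_lt_mul_of_pos_right hx (by positivity)
      _ ≤ _ := by rw [← pow_add]; exact Nat.pow_le_pow_right (by omega) (by omega)
  rw [Inst.linkMask, add_comm, mul_comm (_ - _), Nat.testBit_two_pow_mul_add _ h1, Nat.sub_sub,
    add_comm 1, Nat.testBit_two_pow_sub_succ hx, Nat.testBit_mul_two_pow]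

/-- The two masks concern complementary sets of variables, and `2 ^ p * x + b` is the combined
assignment as a binary number. So a literal is true exactly if its bit belongs to one of the masks.
-/
theorem testBit_masks {I : Inst} {x b : ℕ} (h : I.p ≤ I.n) (hb : b < 2 ^ I.p)
    (hx : x < 2 ^ (I.n - I.p)) (l : Literal I.n) :
    ((I.openMask b).testBit (litPos l) = true ∨ (I.linkMask x).testBit (litPos l) = true) ↔
      (2 ^ I.p * x + b).testBit l.1 = l.2 := by
  rw [I.testBit_openMask h hb, I.testBit_linkMask h hx, Nat.testBit_two_pow_mul_add _ hb]
  obtain ⟨v, t⟩ := l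
  have hv := v.2
  have hbv : I.p ≤ v.val → b.testBit v.val = false := fun hp =>
    Nat.testBit_lt_two_pow (hb.trans_le (Nat.pow_le_pow_right (by omega) hp))
  by_cases hp : v.val < I.p
  · cases t
    · have e1 : litPos (v, false) = v.val + I.n := by simp [litPos]
      have e2 : v.val + I.n < I.n + I.p := by omega
      have e3 : ¬ v.val + I.n < I.n := by omega
      have e4 : I.p ≤ v.val + I.n := by omega
      have e5 : x.testBit (v.val + I.n - I.p) = false :=
        Nat.testBit_lt_two_pow (hx.trans_le (Nat.pow_le_pow_right (by omega) (by omega)))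
      simp only [e1, e2, e3, if_true, if_false, hp, Nat.add_sub_cancel, e5]
      simp
    · have e1 : litPos (v, true) = v.val := by simp [litPos]
      have e2 : v.val < I.n + I.p := by omega
      have e4 : ¬ I.p ≤ v.val := by omega
      simp [e1, hv, e2, e4, hp]
  · have hp' : I.p ≤ v.val := by omega
    cases t
    · have e1 : litPos (v, false) = v.val + I.n := by simp [litPos]
      have e2 : ¬ v.val + I.n < I.n + I.p := by omega
      have e3 : ¬ v.val + I.n < I.n := by omega
      have e4 : v.val + I.n - (I.n + I.p) = v.val - I.p := by omega
      have e5 : v.val - I.p < I.n - I.p := by omega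
      simp only [e1, e2, e3, e4, e5, if_false, hp, Nat.add_sub_cancel]
      simp
    · have e1 : litPos (v, true) = v.val := by simp [litPos]
      have e2 : v.val < I.n + I.p := by omega
      simp [e1, hv, e2, hp, hp', hbv hp']

/-- An assignment of all variables is a number below `2 ^ n`; quotient and remainder by `2 ^ p` are
its parts. A clause that `x` leaves open must not be left open by `b`, which says that the clause
meets one of the two masks. -/
theorem satisfiable_iff {n p : ℕ} (φ : CNF n) (hp : p ≤ n) :
    Satisfiable φ ↔ ∃ x < 2 ^ (n - p), (φ.inst p).Sat x := by
  have key : ∀ x b, x < 2 ^ (n - p) → b < 2 ^ p → ((∀ j < φ.length, (φ.inst p).link x j = true →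
      (φ.inst p).layout.isOpen j b = false) ↔
      ∀ c ∈ φ, ∃ l ∈ c, (2 ^ p * x + b).testBit l.1.val = l.2) := by
    intro x b hx hb
    have h1 : ∀ j < φ.length, ((φ.inst p).link x j = true →
      (φ.inst p).layout.isOpen j b = false) ↔
      ∃ l ∈ φ.getD j [], (2 ^ p * x + b).testBit l.1.val = l.2 := by
      intro j hj
      simp only [Inst.link, Inst.layout, decide_eq_true_eq, decide_eq_false_iff_not]
      change (clauseWord (φ.getD j []) &&& _ = 0 → ¬ clauseWord (φ.getD j []) &&& _ = 0) ↔ _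
      rw [clauseWord_and, clauseWord_and]
      have h2 : ∀ l : Literal n, (((φ.inst p).openMask b).testBit (litPos l) = true ∨
          ((φ.inst p).linkMask x).testBit (litPos l) = true) ↔
          (2 ^ p * x + b).testBit l.1 = l.2 := testBit_masks (I := φ.inst p) hp hb hx
      constructor
      · intro h
        by_contra! h3
        refine h (fun l hl => ?_) fun l hl => ?_
        · by_contra h4
          exact h3 l hl ((h2 l).1 (Or.inr (Bool.eq_true_of_not_eq_false h4)))
        · by_contra h4
          exact h3 l hl ((h2 l).1 (Or.inl (Bool.eq_true_of_not_eq_false h4)))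
      · rintro ⟨l, hl, h3⟩ h4 h5
        rcases (h2 l).2 h3 with h | h
        · rw [h5 l hl] at h; simp at h
        · rw [h4 l hl] at h; simp at h
    constructor
    · intro h c hc
      obtain ⟨j, hj, rfl⟩ := List.getElem_of_mem hc
      have := (h1 j hj).1 (h j hj)
      rwa [List.getD_eq_getElem _ _ hj] at this
    · intro h j hj
      refine (h1 j hj).2 ?_
      rw [List.getD_eq_getElem _ _ hj]
      exact h _ (List.getElem_mem hj)
  constructor
  · rintro ⟨a, ha⟩
    obtain ⟨y, hy, hya⟩ : ∃ y < 2 ^ n, ∀ v : Fin n, y.testBit v.val = a v := by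
      exact ⟨Nat.ofBits a, Nat.ofBits_lt_two_pow a, fun v => Nat.testBit_ofBits_lt a v v.2⟩
    have hdm := Nat.div_add_mod y (2 ^ p)
    refine ⟨y / 2 ^ p, ?_, y % 2 ^ p, Nat.mod_lt _ (by positivity), ?_⟩
    · refine Nat.div_lt_of_lt_mul ?_
      rwa [← pow_add, Nat.add_sub_cancel' hp]
    · refine (key _ _ ?_ (Nat.mod_lt _ (by positivity))).2 fun c hc => ?_
      · refine Nat.div_lt_of_lt_mul ?_
        rwa [← pow_add, Nat.add_sub_cancel' hp]
      · obtain ⟨l, hl, h⟩ := ha c hc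
        exact ⟨l, hl, by rw [hdm, hya, h]⟩
  · rintro ⟨x, hx, b, hb, h⟩
    exact ⟨fun v => (2 ^ p * x + b).testBit v.val, (key x b hx hb).1 h⟩

end DynSCC

namespace DynSCC

/-! ## The program of the reduction: reading the formula -/

/-- The number of the input at the position given by a register; the first ones have been moved. -/
def readAt (r : Reg) : Expr := .inp (r + Reg.sv * .lt r 64)

/-- Read a clause. -/
def parseClause : Cmd :=
  .assign .len (readAt .ptr) ;; .assign .ptr (Reg.ptr + 1) ;; .assign .mask 0 ;;
    .for .i .len (.assign .a (readAt .ptr) ;;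
      .assign .mask (Reg.mask ||| (1 : Expr) <<< (Reg.a / 2 + Reg.n * (1 - Reg.a % 2) : Expr)) ;;
      .assign .ptr (Reg.ptr + 1)) ;;
    .store .clause Reg.j Reg.mask

/-- Read all clauses. -/
def parse : Cmd := .assign .ptr 2 ;; .for .j .m parseClause

/-- The input `xs`, apart from its first two numbers, can be read from the memory. -/
structure Env.Reads (E : Env) (xs : List ℕ) (sv : ℕ) : Prop where
  le : xs.length ≤ E.base
  read : ∀ e, 2 ≤ e → ∀ h : e < xs.length, 64 ≤ e + sv * (if e < 64 then 1 else 0) ∧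
    e + sv * (if e < 64 then 1 else 0) < E.base ∧
    E.inp (e + sv * (if e < 64 then 1 else 0)) = xs[e]

section Parse

variable {E : Env} {xs : List ℕ} {sv n Z : ℕ} {s : State} {Q : State → Prop}

theorem readAt_spec {r : Reg} {e y : ℕ} {ys : List ℕ} (hX : E.Reads xs sv) (hB : E.base < E.bound)
    (hr : s.reg r = e) (hsv : s.reg .sv = sv) (he : 2 ≤ e) (hd : xs.drop e = y :: ys) :
    (readAt r).Ok E s ∧ (readAt r).eval E s = y := by
  have hlt : e < xs.length := by
    by_contra h
    rw [List.drop_eq_nil_of_le (by omega)] at hd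
    simp at hd
  obtain ⟨h1, h2, h3⟩ := hX.read e he hlt
  have hy : xs[e] = y := by
    rw [List.drop_eq_getElem_cons hlt] at hd
    exact (List.cons.inj hd).1
  rw [hy] at h3
  refine ⟨?_, by simpa [readAt, hr, hsv] using h3⟩
  have h64 : 64 < E.bound := by omega
  simp only [readAt, Expr.ok_inp, Expr.ok_add, Expr.ok_mul, Expr.ok_lt, Expr.ok_var, Expr.ok_ofNat,
    Expr.eval_add, Expr.eval_mul, Expr.eval_lt, Expr.eval_var, Expr.eval_ofNat, hr, hsv]
  refine ⟨⟨trivial, ⟨trivial, ⟨trivial, h64⟩, by omega⟩, by omega⟩, h1, h2⟩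

theorem drop_of_drop_append {xs ys zs : List ℕ} {e i : ℕ} (h : xs.drop e = ys ++ zs)
    (hi : ys.length = i) : xs.drop (e + i) = zs := by
  rw [← List.drop_drop, h, ← hi, List.drop_left]

theorem wp_parseClause {c : List (Literal n)} {e j : ℕ} {rest : List ℕ} (hX : E.Reads xs sv)
    (hB : 64 * Z < E.bound) (hZ : E.base ≤ Z) (hZ' : 2 ^ (2 * n) ≤ Z) (hj : j ≤ Z)
    (hn : s.reg .n = n) (hsv : s.reg .sv = sv) (he : 2 ≤ e) (hptr : s.reg .ptr = e)
    (hjr : s.reg .j = j) (hd : xs.drop e = c.length :: (c.map litCode ++ rest))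
    (hQ : ∀ s', parseClause.Frame s s' → s'.reg .ptr = e + (1 + c.length) →
      s'.arr .clause = Function.update (s.arr .clause) j (clauseWord c) →
      s'.time ≤ s.time + 6 + 5 * c.length → Q s') :
    WP E parseClause s Q := by
  have hpos : 0 < 2 ^ (2 * n) := Nat.two_pow_pos _
  have hn2 : 2 * n < 2 ^ (2 * n) := Nat.lt_two_pow_self
  have hlen := hX.le
  have hle := congrArg List.length hd
  simp only [List.length_drop, List.length_cons, List.length_append, List.length_map] at hle
  suffices WP E parseClause s (fun s' => s'.reg .ptr = e + (1 + c.length) ∧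
      s'.arr .clause = Function.update (s.arr .clause) j (clauseWord c) ∧
      s'.time ≤ s.time + 6 + 5 * c.length) from
    this.frame.mono fun s' ⟨hF, h1, h2, h3⟩ => hQ s' hF h1 h2 h3
  obtain ⟨r1, r2⟩ := readAt_spec hX (by omega) hptr hsv he hd
  simp only [parseClause, wp_seq, wp_assign]
  rw [r2]
  refine ⟨r1, by simp [hptr]; omega, by simp; omega, ?_⟩
  have hd1 : xs.drop (e + 1) = c.map litCode ++ rest := by
    rw [← List.drop_drop, hd]; rfl
  refine wp_for (n := c.length) (fun i s' => s'.reg .ptr = e + 1 + i ∧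
    s'.reg .mask = ((c.take i).map litCode).foldl (addLit n) 0 ∧
    s'.time ≤ s.time + 4 + 5 * i) (by simp [Cmd.sets]) (by simp [Cmd.sets]) (by simp) (by simp)
    (by omega) ?_ ?_ ?_
  · simp [hptr]
  · rintro i hi s' hF - ⟨j1, j2, j3⟩
    have hn' : s'.reg .n = n := by
      rw [hF.reg _ (by simp [Cmd.for, Cmd.sets])]; simpa using hn
    have hsv' : s'.reg .sv = sv := by
      rw [hF.reg _ (by simp [Cmd.for, Cmd.sets])]; simpa using hsv
    have hdi : xs.drop (e + 1 + i) = litCode ((c)[i]) :: ((c.drop (i + 1)).map litCode ++ rest) := by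
      have : c.map litCode ++ rest = (c.take i).map litCode ++
          (litCode ((c)[i]) :: ((c.drop (i + 1)).map litCode ++ rest)) := by
        rw [← List.cons_append, ← List.map_cons, ← List.drop_eq_getElem_cons, ← List.append_assoc,
          ← List.map_append, List.take_append_drop]
      rw [this] at hd1
      exact drop_of_drop_append hd1 (by simp; omega)
    obtain ⟨r3, r4⟩ := readAt_spec (s := s'.tick) hX (by omega) j1 hsv' (by omega) hdi
    have hm := foldl_addLit_lt (c.take i)
    have hm' := foldl_addLit_lt (c.take (i + 1))
    have hpl := litPos_lt ((c)[i])
    have hspec := litCode_spec ((c)[i])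
    have hpow : 2 ^ litPos ((c)[i]) ≤ 2 ^ (2 * n) := Nat.pow_le_pow_right (by omega) hpl.le
    have hstep : ((c.take (i + 1)).map litCode).foldl (addLit n) 0 =
        ((c.take i).map litCode).foldl (addLit n) 0 ||| 2 ^ litPos ((c)[i]) := by
      rw [List.take_add_one, List.getElem?_eq_getElem hi, List.map_append, List.foldl_append]
      simp [addLit, hspec, Nat.one_shiftLeft]
    have hlc : litCode ((c)[i]) < 2 * n := by
      have := ((c)[i]).1.2
      have : ((c)[i]).2.toNat ≤ 1 := Bool.toNat_le _
      simp only [litCode]; omega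
    rw [hstep] at hm'
    simp only [wp_seq, wp_assign]
    rw [r4]
    refine ⟨r3, ?_, ?_, ?_, ?_, ?_⟩
    · simp [hn', j2, hspec, -List.map_take]
      omega
    · simp [j1]; omega
    · simp [j1]; omega
    · simp [hn', j2, hspec, hstep, -List.map_take]
    · simp; omega
  · rintro s' hF - ⟨j1, j2, j3⟩
    have hj' : s'.reg .j = j := by
      rw [hF.reg _ (by simp [Cmd.for, Cmd.sets])]; simpa using hjr
    have hcl : s'.arr .clause = s.arr .clause := by
      rw [hF.arr _ (by simp [Cmd.for, Cmd.setsArr])]; simp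
    rw [List.take_length] at j2
    rw [wp_store]
    refine ⟨trivial, trivial, by simp [hj']; omega, by simp [j1]; omega, ?_, by simp; omega⟩
    simp [hj', hcl, j2, clauseWord]

theorem parseClause_sets {r : Reg} (h1 : r ≠ .len) (h2 : r ≠ .ptr) (h3 : r ≠ .mask) (h4 : r ≠ .i)
    (h5 : r ≠ .a) : parseClause.sets r = false := by
  simp [parseClause, Cmd.for, Cmd.sets, *]

/-- Time is charged to the position in the input, which makes the bound linear in the input length
whatever the lengths of the clauses. -/
theorem wp_parse {φ : CNF n} (hX : E.Reads (encodeCNF φ) sv) (hB : 64 * Z < E.bound)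
    (hZ : E.base ≤ Z) (hZ' : 2 ^ (2 * n) ≤ Z) (hφ : φ.length ≤ Z)
    (hn : s.reg .n = n) (hsv : s.reg .sv = sv) (hm : s.reg .m = φ.length)
    (hQ : ∀ s', parse.Frame s s' →
      (∀ j < φ.length, s'.arr .clause j = clauseWord (φ.getD j [])) →
      s'.time ≤ s.time + 10 * (encodeCNF φ).length + 3 → Q s') :
    WP E parse s Q := by
  have hpos : 0 < 2 ^ (2 * n) := Nat.two_pow_pos _
  suffices WP E parse s (fun s' =>
      (∀ j < φ.length, s'.arr .clause j = clauseWord (φ.getD j [])) ∧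
      s'.time ≤ s.time + 10 * (encodeCNF φ).length + 3) from
    this.frame.mono fun s' ⟨hF, h1, h2⟩ => hQ s' hF h1 h2
  rw [parse, wp_seq, wp_assign]
  refine ⟨by simp; omega, ?_⟩
  refine wp_for (n := φ.length) (fun j s' => 2 ≤ s'.reg .ptr ∧
    s'.reg .ptr ≤ (encodeCNF φ).length ∧
    (encodeCNF φ).drop (s'.reg .ptr) = (φ.drop j).flatMap (fun c => c.length :: c.map litCode) ∧
    (∀ i < j, s'.arr .clause i = clauseWord (φ.getD i [])) ∧
    s'.time ≤ s.time + 2 + 10 * s'.reg .ptr)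
    (parseClause_sets (by simp) (by simp) (by simp) (by simp) (by simp))
    (parseClause_sets (by simp) (by simp) (by simp) (by simp) (by simp)) (by simp) (by simpa using hm)
    (by omega) ?_ ?_ ?_
  · simp [encodeCNF]
  · rintro j hj s' hF hj' ⟨i1, i2, i3, i4, i5⟩
    have hn' : s'.reg .n = n := by
      rw [hF.reg _ (by simp [Cmd.for, Cmd.sets, parseClause_sets])]; simpa using hn
    have hsv' : s'.reg .sv = sv := by
      rw [hF.reg _ (by simp [Cmd.for, Cmd.sets, parseClause_sets])]; simpa using hsv
    rw [List.drop_eq_getElem_cons hj, List.flatMap_cons, List.cons_append] at i3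
    refine wp_parseClause (s := s'.tick) hX hB hZ hZ' (by omega) hn' hsv' i1 rfl hj' i3 ?_
    intro s'' hF' k1 k2 k3
    have hle := congrArg List.length i3
    simp only [List.length_drop, List.length_cons, List.length_append, List.length_map] at hle
    simp only [State.tick_time] at k3
    simp only [State.set_reg, State.set_arr, State.set_time, reduceCtorEq, if_false]
    refine ⟨by omega, by omega, ?_, ?_, by omega⟩
    · rw [k1]
      rw [← List.cons_append] at i3
      exact drop_of_drop_append i3 (by simp; omega)
    · intro i hi
      rw [k2]
      rcases Nat.lt_succ_iff_lt_or_eq.1 hi with hi' | rfl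
      · rw [Function.update_of_ne (by omega)]; exact i4 i hi'
      · rw [Function.update_self, List.getD_eq_getElem _ _ hj]
  · rintro s' hF - ⟨i1, i2, i3, i4, i5⟩
    exact ⟨i4, by simp; omega⟩

end Parse

end DynSCC

namespace DynSCC

/-! ## The structured program of the reduction -/

/-- The number of trials of a session. -/
def Mode.size (w : ℕ) : Mode → ℕ
  | .full => w
  | _ => 1

/-- The number of trials of a session, as an expression. -/
def Mode.sizeExpr : Mode → Expr
  | .full => Reg.w
  | _ => 1

/-- Compute the parameters. -/
def setup (M : Mode) (J D : ℕ) : Cmd :=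
  -- Register `out` is cell `0`, which still holds the number of variables. The number of clauses
  -- was in cell `1` and is recovered from the base address, which equals `2 ^ J` times the sum of
  -- both numbers plus `62`.
  .assign .n Reg.out ;; .assign .sv (Expr.base - 64) ;;
    .assign .m ((Reg.sv + 2) / .const (2 ^ J) - Reg.n) ;; .assign .p (Reg.n / .const D) ;;
    .assign .w ((1 : Expr) <<< (Reg.p : Expr)) ;; .assign .nv (Reg.w + 6 * Reg.m + 8) ;;
    .assign .s M.sizeExpr ;;
    .assign .grp ((1 : Expr) <<< (Reg.n - Reg.p : Expr) / Reg.s) ;;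
    .assign .ne (Reg.nv * Reg.nv) ;; .assign .out 0

/-- Decide the satisfiability of a formula. -/
def solve (A : DynAlg) (τ : QueryType) (κ : DeletionKind) (M : Mode) (J D : ℕ) : Cmd :=
  setup M J D ;; parse ;; startCmd A M ;; search A τ κ M

theorem solve_shallow (A : DynAlg) (τ : QueryType) (κ : DeletionKind) (M : Mode) (J D : ℕ) :
    (solve A τ κ M J D).Shallow := by
  have h1 : parse.Shallow := by
    simp [parse, parseClause, Cmd.for, Cmd.Shallow, readAt]
  have h2 : (setup M J D).Shallow := by cases M <;> simp [setup, Cmd.Shallow, Mode.sizeExpr]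
  exact ⟨h2, h1, startCmd_shallow A M, search_shallow A τ κ M⟩

/-- The sessions have equal size because both `w` and the number of trials are powers of two; `2 * p
≤ n` gives divisibility. -/
theorem Mode.size_mul {M : Mode} {n p : ℕ} (h : 2 * p ≤ n) :
    2 ^ (n - p) / M.size (2 ^ p) * M.size (2 ^ p) = 2 ^ (n - p) := by
  refine Nat.div_mul_cancel ?_
  cases M
  · exact pow_dvd_pow _ (by omega)
  · exact one_dvd _
  · exact one_dvd _

theorem Mode.sizeExpr_spec {E : Env} (M : Mode) {s : State} {w : ℕ} (h : s.reg .w = w)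
    (hB : 1 < E.bound) : M.sizeExpr.Ok E s ∧ M.sizeExpr.eval E s = M.size w := by
  cases M
  · exact ⟨trivial, h⟩
  · exact ⟨hB, rfl⟩
  · exact ⟨hB, rfl⟩

theorem parse_sets {r : Reg} (hr : r ∈ Reg.out :: constRegs) : parse.sets r = false := by
  simp [constRegs] at hr
  rcases hr with rfl | rfl | rfl | rfl | rfl | rfl | rfl | rfl | rfl <;>
    simp [parse, Cmd.for, Cmd.sets, parseClause_sets]

theorem wp_set {E : Env} {s : State} {d : Reg} {e : Expr} {c : Cmd} {Q : State → Prop} {v : ℕ}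
    (h1 : e.Ok E s) (h2 : e.eval E s = v) (h : WP E c (s.set d v) Q) :
    WP E (.assign d e ;; c) s Q := by
  rw [wp_seq, wp_assign, h2]; exact ⟨h1, h⟩

/-- The time has three parts: reading the formula, reaching the start state once, and the search,
where the cost of a session is multiplied by the number of sessions. -/
theorem wp_solve {E : Env} {A : DynAlg} {τ : QueryType} {κ : DeletionKind} {M : Mode}
    {n J D k b l Z a T₀ T₁ T₂ : ℕ} {φ : CNF n} {s : State} (hD : 2 ≤ D)
    (hE : E.Fits (φ.inst (n / D)) k b l Z) (hA : A.BoundedBy k a)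
    (hbase : E.base = 2 ^ J * (n + φ.length) + 62) (hpos : 0 < n + φ.length)
    (hD' : D < E.bound)
    (hX : E.Reads (encodeCNF φ) (2 ^ J * (n + φ.length) - 2))
    (hS : A.Supports τ κ M (φ.inst (n / D)).layout b (M.size (2 ^ (n / D))) T₀ T₁ T₂
      (fun g i => (φ.inst (n / D)).link (g * M.size (2 ^ (n / D)) + i)))
    (hl : T₀ + T₁ + T₂ + 4 * ((φ.inst (n / D)).layout.nv * (φ.inst (n / D)).layout.nv) ≤ l)
    (hout : s.reg .out = n) (harr : s.arr .mem = 0) :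
    WP E (solve A τ κ M J D) s (fun s' => s'.Outcome (Satisfiable φ) ∧
      s'.time ≤ s.time + 10 * (encodeCNF φ).length + 40 +
        a * (T₀ + T₁ + (φ.inst (n / D)).layout.nv * (φ.inst (n / D)).layout.nv) +
        9 * ((φ.inst (n / D)).layout.nv * (φ.inst (n / D)).layout.nv) +
        2 ^ (n - n / D) / M.size (2 ^ (n / D)) *
          ((a + 60) * (T₂ + M.size (2 ^ (n / D)) * (2 * φ.length + 2)) + 12)) := by
  obtain ⟨μ₀, μ₁, t₀, t₁, Ts, hrun, ht₀, hserve, hTs, hst, htr⟩ := hS.exists_runs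
  set p := n / D with hp
  set I := φ.inst p with hI
  have h1 := hE.bound
  have h2 := hE.base
  have h3 := hE.nv_le
  have h4 := hE.nv
  have h5 := hE.pow
  have h6 : I.layout.nv = 2 ^ p + 6 * φ.length + 8 := rfl
  have h7 : 0 < 2 ^ p := Nat.two_pow_pos _
  have h8 := hE.room.base
  have hn : I.n = n := rfl
  have hp2 : 2 * p ≤ n := by
    calc 2 * p ≤ D * p := Nat.mul_le_mul_right _ hD
      _ ≤ n := Nat.mul_div_le n D
  have hM := M.size_mul hp2
  have hszw : M.size (2 ^ p) ≤ 2 ^ p := by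
    cases M <;> simp only [Mode.size] <;> omega
  have hsize := fun s' h => M.sizeExpr_spec (E := E) (s := s') (w := 2 ^ p) h (by omega)
  have hfull : M = .full ∨ M.size (2 ^ p) = 1 := by cases M <;> simp [Mode.size]
  set sz := M.size (2 ^ p) with hsz
  set gr := 2 ^ (n - p) / sz with hgr
  have hgrle : gr ≤ 2 ^ (n - p) := Nat.div_le_self _ _
  have h9 : 2 ^ (n - p) ≤ 2 ^ (2 * n) := Nat.pow_le_pow_right (by omega) (by omega)
  have hnZ : 2 * n < 2 ^ (2 * n) := Nat.lt_two_pow_self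
  rw [hn] at h5
  have hH : 2 ^ J ≤ 2 ^ J * (n + φ.length) := Nat.le_mul_of_pos_right _ hpos
  have hdiv : (2 ^ J * (n + φ.length)) / 2 ^ J = n + φ.length :=
    Nat.mul_div_cancel_left _ (Nat.two_pow_pos J)
  set H := 2 ^ J * (n + φ.length) with hHdef
  have hJ : 0 < 2 ^ J := Nat.two_pow_pos J
  rw [solve, wp_seq]
  have hset : WP E (setup M J D) s (fun s' => s' = ⟨s'.reg, s.arr, s.time + 10⟩ ∧
      s'.reg .n = n ∧ s'.reg .sv = H - 2 ∧ s'.reg .m = φ.length ∧ s'.reg .p = p ∧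
      s'.reg .w = 2 ^ p ∧ s'.reg .nv = I.layout.nv ∧ s'.reg .s = sz ∧ s'.reg .grp = gr ∧
      s'.reg .ne = I.layout.nv * I.layout.nv ∧ s'.reg .out = 0) := by
    have q1 : H - 2 + 2 = H := by omega
    have q2 : n + φ.length - n = φ.length := by omega
    have q3 : 2 ^ p ≤ 2 ^ (2 * n) := Nat.pow_le_pow_right (by omega) (by omega)
    have q4 : p ≤ n := by omega
    rw [setup]
    refine wp_set (v := n) trivial hout ?_
    refine wp_set (v := H - 2) (by simp; omega) (by simp [hbase]) ?_
    refine wp_set (v := φ.length) (by simp [q1, hdiv]; omega) (by simp [q1, hdiv]) ?_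
    refine wp_set (v := p) (by simp [← hp]; omega) (by simp [hp]) ?_
    refine wp_set (v := 2 ^ p) (by simp; omega) (by simp) ?_
    refine wp_set (v := I.layout.nv) (by simp; omega) (by simp [h6]) ?_
    refine wp_set (v := sz) (hsize _ (by simp)).1 (hsize _ (by simp)).2 ?_
    refine wp_set (v := gr) (by simp; omega) (by simp [hgr]) ?_
    refine wp_set (v := I.layout.nv * I.layout.nv) (by simp; omega) (by simp) ?_
    rw [wp_assign]
    exact ⟨by simp; omega, rfl, by simp, by simp, by simp, by simp, by simp, by simp, by simp,
      by simp, by simp, by simp⟩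
  refine hset.mono ?_
  rintro s₁ ⟨e0, e1, e2, e3, e4, e5, e6, e7, e8, e9, e10⟩
  have harr₁ : s₁.arr = s.arr := by rw [e0]
  have htime₁ : s₁.time = s.time + 10 := by rw [e0]
  rw [wp_seq]
  refine wp_parse hX h1 h2 h5 (by omega) e1 e2 e3 ?_
  intro s₂ hF₂ hcl htime₂
  have hreg₂ : ∀ r, r ∈ Reg.out :: constRegs → s₂.reg r = s₁.reg r := fun r hr =>
    hF₂.reg r (parse_sets hr)
  have hmem₂ : s₂.arr .mem = 0 := by
    rw [hF₂.arr _ (by simp [parse, parseClause, Cmd.for, Cmd.setsArr]), harr₁, harr]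
  have hI₂ : I.Const sz gr s₂ :=
    ⟨(hreg₂ _ (by simp [constRegs])).trans e1, (hreg₂ _ (by simp [constRegs])).trans e4,
      (hreg₂ _ (by simp [constRegs])).trans e3, (hreg₂ _ (by simp [constRegs])).trans e5,
      (hreg₂ _ (by simp [constRegs])).trans e6, (hreg₂ _ (by simp [constRegs])).trans e9,
      (hreg₂ _ (by simp [constRegs])).trans e7, (hreg₂ _ (by simp [constRegs])).trans e8, hcl⟩
  have hout₂ : s₂.reg .out = 0 := (hreg₂ _ (by simp)).trans e10
  rw [wp_seq]
  refine wp_start hE hA hI₂ hmem₂ hrun ht₀ hserve hTs hst (by omega) ?_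
  intro s₃ hF₃ hat₃
  have hI₃ := hI₂.frame (startCmd_keeps A M) hF₃
  -- The log entries for the arguments of a session are of the order `w` times the number of
  -- clauses, hence within the space `nv * nv` reserved for them.
  have hszl : sz * (2 * I.m + 2) ≤ I.layout.nv * I.layout.nv :=
    Nat.mul_le_mul (by omega) (by rw [h6]; show 2 * φ.length + 2 ≤ _; omega)
  refine wp_search hE hA hI₃ hM hfull htr (by omega) hat₃
    (by rw [hF₃.reg _ (startCmd_sets A M (Or.inr rfl)), hout₂]) ?_
  intro s₄ htime₄ hout₄
  refine ⟨hout₄.congr rfl (satisfiable_iff φ (show p ≤ n by omega)).symm, ?_⟩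
  have : I.m = φ.length := rfl
  rw [this] at htime₄
  omega

end DynSCC

namespace DynSCC

/-! ## The machine program of the reduction -/

/-- Move the contents of the cells from `3` on to the cells to which cell `1` points. -/
def saveCode (k : ℕ) : List Instr :=
  (List.range k).flatMap fun i => [.store 1 (i + 3), .op .add 1 1 2]

/-- Prepare the memory for a structured program: answer `1` and go to line `e` if the input starts
with two zeros; otherwise make room in the first cells. -/
def preamble (J e : ℕ) : List Instr :=
  .op .add 1 1 0 :: (List.replicate J (.op .add 1 1 1) ++
    -- Cell `1` holds `2 ^ J * (n + M)` here, which exceeds `n` unless both numbers are zero. Cell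
    -- `2` is moved first, so that it can hold the constant `1` that advances the pointer for the
    -- other cells.
    ([.jlt 0 1 (J + 5), .const 0 1, .const 1 2, .jlt 0 1 e, .store 1 2, .const 2 1,
      .op .add 1 1 2] ++ saveCode 61))

/-- The machine program for a structured program. -/
def machine (J : ℕ) (c : Cmd) : Program :=
  preamble J (J + 130 + (c.code (J + 130)).length) ++ c.code (J + 130)

theorem length_saveCode (k : ℕ) : (saveCode k).length = 2 * k := by
  induction k with
  | zero => rfl
  | succ k ih =>
    rw [saveCode, List.range_succ, List.flatMap_append, List.length_append]
    change (saveCode k).length + 2 = _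
    omega

theorem length_preamble (J e : ℕ) : (preamble J e).length = J + 130 := by
  simp [preamble, length_saveCode]

theorem codeAt_append (l l' : List Instr) : CodeAt (l ++ l') l.length l' := fun i hi => by
  rw [List.getElem?_append_right (by omega)]; simp

theorem codeAt_self (l l' : List Instr) : CodeAt (l ++ l') 0 l := fun i hi => by
  rw [Nat.zero_add, List.getElem?_append_left hi]

theorem double_leads {P : Program} {B : ℕ} (J : ℕ) : ∀ {p v : ℕ} {μ : Memory},
    CodeAt P p (List.replicate J (.op .add 1 1 1)) → (∀ a, μ a < B) → μ 1 = v → v * 2 ^ J < B →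
    Leads P B p μ J (p + J) (Function.update μ 1 (v * 2 ^ J)) := by
  induction J with
  | zero =>
    intro p v μ _ _ hv _
    rw [pow_zero, mul_one, ← hv, Function.update_eq_self]
    exact Leads.refl
  | succ J ih =>
    intro p v μ hc hμ hv hB
    have h1 : v + v ≤ v * 2 ^ (J + 1) := by
      have := Nat.mul_le_mul_left v (show 2 ≤ 2 ^ (J + 1) by
        rw [pow_succ]; have := Nat.two_pow_pos J; omega)
      omega
    have h2 : v * 2 ^ (J + 1) = (v + v) * 2 ^ J := by ring
    have h3 := ih (p := p + 1) (v := v + v) (μ := Function.update μ 1 (v + v)) hc.tail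
      (update_lt hμ (by omega)) (by simp) (by omega)
    rw [Function.update_idem, ← h2, show p + 1 + J = p + (J + 1) by omega] at h3
    refine Leads.cons hc.head hμ ?_
    have : Instr.nextMem μ (.op .add 1 1 1) = Function.update μ 1 (v + v) := by
      simp [Instr.nextMem, BinOp.eval, hv]
    rw [this]
    exact h3

/-- The memory after `k` moves. -/
def saved (μ : Memory) (H k : ℕ) : Memory := fun x =>
  if x = 1 then H + k else if H ≤ x ∧ x < H + k then μ (x - H + 3) else μ x

theorem save_leads {P : Program} {B p H : ℕ} {μ : Memory} (h2 : μ 2 = 1) (hH : 64 ≤ H)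
    (hμ : ∀ a, μ a < B) : ∀ k ≤ 61, CodeAt P p (saveCode k) → H + k < B →
    Leads P B p (saved μ H 0) (2 * k) (p + 2 * k) (saved μ H k) := by
  intro k
  induction k with
  | zero => intro _ _ _; exact Leads.refl
  | succ k ih =>
    intro hk hc hB
    have hs : saveCode (k + 1) = saveCode k ++ [.store 1 (k + 3), .op .add 1 1 2] := by
      rw [saveCode, List.range_succ, List.flatMap_append]; rfl
    rw [hs] at hc
    have hlt : ∀ j, H + j < B → ∀ a, saved μ H j a < B := by
      intro j hj a
      simp only [saved]
      split_ifs
      · exact hj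
      · exact hμ _
      · exact hμ _
    have hc' := hc.right
    rw [length_saveCode] at hc'
    have m1 : Instr.nextMem (saved μ H k) (.store 1 (k + 3)) =
        Function.update (saved μ H k) (H + k) (μ (k + 3)) := by
      simp only [Instr.nextMem, saved, if_true]
      rw [if_neg (by omega), if_neg (by omega)]
    have m2 : Instr.nextMem (Function.update (saved μ H k) (H + k) (μ (k + 3))) (.op .add 1 1 2) =
        saved μ H (k + 1) := by
      funext x
      have e1 : Function.update (saved μ H k) (H + k) (μ (k + 3)) 1 = H + k := by
        rw [Function.update_of_ne (by omega)]; simp [saved]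
      have e2 : Function.update (saved μ H k) (H + k) (μ (k + 3)) 2 = 1 := by
        rw [Function.update_of_ne (by omega)]
        simp only [saved]
        rw [if_neg (by omega), if_neg (by omega), h2]
      simp only [Instr.nextMem, BinOp.eval, e1, e2]
      by_cases hx : x = 1
      · subst hx; simp [saved]; omega
      · rw [Function.update_of_ne hx]
        by_cases hx' : x = H + k
        · subst hx'
          rw [Function.update_self]
          simp only [saved]
          rw [if_neg hx, if_pos (by omega)]
          congr 1; omega
        · rw [Function.update_of_ne hx']
          simp only [saved, if_neg hx]
          by_cases hx2 : H ≤ x ∧ x < H + k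
          · rw [if_pos hx2, if_pos (by omega)]
          · rw [if_neg hx2, if_neg (by omega)]
    refine (ih (by omega) hc.left (by omega)).trans ?_
    refine Leads.cons hc'.head (hlt k (by omega)) ?_
    rw [m1]
    refine Leads.cons hc'.tail.head (update_lt (hlt k (by omega)) (hμ _)) ?_
    rw [m2]
    exact Leads.refl

theorem writeArgs_lt {xs : List ℕ} {B : ℕ} (h : ∀ x ∈ xs, x < B) (hB : 0 < B) :
    ∀ a, writeArgs xs 0 a < B := by
  intro a
  by_cases ha : a < xs.length
  · simp only [writeArgs]
    rw [List.getD_eq_getElem _ _ ha]; exact h _ (List.getElem_mem ha)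
  · simp only [writeArgs]
    rw [List.getD_eq_default _ _ (by omega)]; exact hB

/-- The empty formula without variables is satisfiable. It is treated apart because the address
computed for the moved cells would be `0`. -/
theorem machine_zero {J B : ℕ} {c : Cmd} (hB : 2 < B) :
    ∃ μ, RunsTo (machine J c) B 0 (writeArgs [0, 0] 0) (J + 5) μ ∧ μ 0 = 1 := by
  have hμ : ∀ a, writeArgs [0, 0] 0 a < B := writeArgs_lt (by simp; omega) (by omega)
  have hz : writeArgs [0, 0] 0 = fun _ => 0 := by
    funext z
    rcases z with _ | _ | z <;> simp [writeArgs]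
  have hc : CodeAt (machine J c) 0 (preamble J (J + 130 + (c.code (J + 130)).length)) :=
    codeAt_self _ _
  have hlen : (machine J c).length = J + 130 + (c.code (J + 130)).length := by
    rw [machine, List.length_append, length_preamble]
  have h1 := double_leads (v := 0) J hc.tail.left hμ (by rw [hz]) (by omega)
  have hc' := hc.tail.right
  rw [List.length_replicate] at hc'
  replace hc' := hc'.left
  rw [zero_mul, hz] at h1
  have e0 : Function.update (fun _ => 0 : Memory) 1 0 = fun _ => 0 := by
    funext z; rw [Function.update_apply]; split_ifs <;> rfl
  rw [e0] at h1
  rw [hz] at hμ ⊢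
  have m0 : Instr.nextMem (fun _ => 0 : Memory) (.op .add 1 1 0) = fun _ => 0 := e0
  have l1 : Leads (machine J c) B 0 (fun _ => 0) (J + 1) (0 + 1 + J) (fun _ => 0) :=
    Leads.cons hc.head hμ (by rw [m0]; exact h1)
  have b1 := update_lt (d := 0) hμ (show 1 < B by omega)
  have b2 := update_lt (d := 1) b1 hB
  refine ⟨Function.update (Function.update (fun _ => 0) 0 1) 1 2,
    (l1 4 _ ?_ : RunsTo _ _ _ _ (J + 1 + 4) _), by simp⟩
  refine .step _ hc'.head hμ ?_
  simp only [Instr.nextPc, Instr.nextMem, lt_irrefl, if_false]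
  refine .step _ hc'.tail.head hμ ?_
  refine .step _ hc'.tail.tail.head b1 ?_
  refine .step _ hc'.tail.tail.tail.head b2 ?_
  refine .halt ?_ b2
  simp [Instr.nextPc, Instr.nextMem, hlen]

/-- A multiple `H` of `n + M` beyond the input is computed by doubling, without knowing the length
of the input. The `62` cells from `2` to `63` are moved to `H` and the following cells: hence the
base `H + 62` and the displacement `H - 2`. -/
theorem machine_run {J B n M : ℕ} {c : Cmd} {xs : List ℕ} (hc : c.Shallow)
    (hx : ∀ x ∈ n :: M :: xs, x < B) (hJ : 0 < J)
    (hH : 64 ≤ 2 ^ J * (n + M)) (hlen : (n :: M :: xs).length ≤ 2 ^ J * (n + M))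
    (hB : 2 ^ J * (n + M) + 62 < B) :
    ∃ ν : Memory, ν 0 = n ∧
      Env.Reads ⟨2 ^ J * (n + M) + 62, B, ν⟩ (n :: M :: xs) (2 ^ J * (n + M) - 2) ∧
      ∀ s', Exec ⟨2 ^ J * (n + M) + 62, B, ν⟩ c ⟨fun r => ν r.cell, fun _ _ => 0, 0⟩ s' →
      ∃ T μ, RunsTo (machine J c) B 0 (writeArgs (n :: M :: xs) 0) T μ ∧ μ 0 = s'.reg .out ∧
        T ≤ J + 130 + (c.code (J + 130)).length * s'.time := by
  set H := 2 ^ J * (n + M) with hHdef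
  set μ₀ := writeArgs (n :: M :: xs) 0 with hμ₀
  have hμ : ∀ a, μ₀ a < B := writeArgs_lt hx (by omega)
  have hc0 : CodeAt (machine J c) 0 (preamble J (J + 130 + (c.code (J + 130)).length)) :=
    codeAt_self _ _
  have hJ2 : 2 ≤ 2 ^ J := by
    calc 2 = 2 ^ 1 := rfl
      _ ≤ 2 ^ J := Nat.pow_le_pow_right (by omega) hJ
  have hle : n + M ≤ H := Nat.le_mul_of_pos_left _ (by omega)
  have hnM : n < H := by
    have : 2 * (n + M) ≤ H := Nat.mul_le_mul_right _ hJ2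
    omega
  have m0 : Instr.nextMem μ₀ (.op .add 1 1 0) = Function.update μ₀ 1 (n + M) := by
    simp [Instr.nextMem, BinOp.eval, hμ₀, writeArgs, Nat.add_comm]
  have b0 := update_lt (d := 1) hμ (show n + M < B by omega)
  have h1 := double_leads (v := n + M) J hc0.tail.left b0 (by simp) (by rw [mul_comm]; omega)
  rw [Function.update_idem, mul_comm, ← hHdef] at h1
  have hc1 := hc0.tail.right
  rw [List.length_replicate] at hc1
  have hc2 := hc1.right
  replace hc1 := hc1.left
  have b1 := update_lt (d := 1) hμ (show H < B by omega)
  set μ₁ := Function.update μ₀ 1 H with hμ₁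
  have m1 : Instr.nextMem μ₁ (.store 1 2) = Function.update μ₁ H (μ₀ 2) := by
    simp [Instr.nextMem, hμ₁]
  have b2 := update_lt (d := H) b1 (hμ 2)
  set μ₂ := Function.update μ₁ H (μ₀ 2) with hμ₂
  have b3 := update_lt (d := 2) b2 (show 1 < B by omega)
  set μ₃ := Function.update μ₂ 2 1 with hμ₃
  have e31 : μ₃ 1 = H := by
    rw [hμ₃, Function.update_of_ne (by omega), hμ₂, Function.update_of_ne (by omega), hμ₁,
      Function.update_self]
  have e32 : μ₃ 2 = 1 := by rw [hμ₃, Function.update_self]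
  have m3 : Instr.nextMem μ₃ (.op .add 1 1 2) = saved μ₃ (H + 1) 0 := by
    funext x
    simp only [Instr.nextMem, BinOp.eval, e31, e32, saved]
    by_cases hx : x = 1
    · subst hx; simp
    · rw [Function.update_of_ne hx, if_neg hx, if_neg (by omega)]
  have h3 := save_leads (P := machine J c) e32 (show 64 ≤ H + 1 by omega) b3 61 le_rfl hc2 (by omega)
  set ν := saved μ₃ (H + 1) 61 with hν
  have hlead : Leads (machine J c) B 0 μ₀ (J + 127) (J + 130) ν := by
    have s1 : Leads (machine J c) B 0 μ₀ (J + 1) (0 + 1 + J) μ₁ := by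
      refine Leads.cons hc0.head hμ ?_
      rw [m0]; exact h1
    have s2 : Leads (machine J c) B (0 + 1 + J) μ₁ 4 (0 + 1 + J + 7) (saved μ₃ (H + 1) 0) := by
      refine Leads.cons hc1.head b1 ?_
      have : Instr.nextPc (0 + 1 + J) μ₁ (.jlt 0 1 (J + 5)) = 0 + 1 + J + 1 + 1 + 1 + 1 := by
        have e0 : μ₁ 0 = n := by simp [hμ₁, hμ₀, writeArgs]
        have e1 : μ₁ 1 = H := by simp [hμ₁]
        simp only [Instr.nextPc, e0, e1, if_pos hnM]; omega
      rw [this]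
      refine Leads.cons hc1.tail.tail.tail.tail.head b1 ?_
      rw [show Instr.nextMem (Instr.nextMem μ₁ (.jlt 0 1 (J + 5))) (.store 1 2) = μ₂ from m1]
      refine Leads.cons hc1.tail.tail.tail.tail.tail.head b2 ?_
      refine Leads.cons hc1.tail.tail.tail.tail.tail.tail.head b3 ?_
      change Leads _ _ _ (Instr.nextMem μ₃ (.op .add 1 1 2)) _ _ _
      rw [m3]
      exact Leads.refl
    have s3 := (s1.trans s2).trans h3
    convert s3 using 1 <;> simp <;> omega
  have hνlt : ∀ a, ν a < B := by
    intro a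
    simp only [hν, saved]
    split_ifs
    · omega
    · exact b3 _
    · exact b3 _
  have f3 : ∀ x, x ≠ 1 → x ≠ 2 → x ≠ H → μ₃ x = μ₀ x := by
    intro x q1 q2 q3
    rw [hμ₃, Function.update_of_ne q2, hμ₂, Function.update_of_ne q3, hμ₁, Function.update_of_ne q1]
  have f1 : ν 1 = H + 62 := by simp [hν, saved]
  have fH : ν H = μ₀ 2 := by
    simp only [hν, saved]
    rw [if_neg (by omega), if_neg (by omega), hμ₃, Function.update_of_ne (by omega), hμ₂,
      Function.update_self]
  have fS : ∀ i, 3 ≤ i → i < 64 → ν (i + (H - 2)) = μ₀ i := by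
    intro i q1 q2
    simp only [hν, saved]
    rw [if_neg (by omega), if_pos (by omega), f3 _ (by omega) (by omega) (by omega)]
    congr 1; omega
  have fO : ∀ x, x ≠ 1 → x ≠ 2 → (x < H ∨ H + 62 ≤ x) → ν x = μ₀ x := by
    intro x q1 q2 q3
    simp only [hν, saved]
    rw [if_neg q1, if_neg (by omega), f3 x q1 q2 (by omega)]
  have hget : ∀ e, ∀ h : e < (n :: M :: xs).length, μ₀ e = (n :: M :: xs)[e] := by
    intro e h
    rw [hμ₀]; simp only [writeArgs]; rw [List.getD_eq_getElem _ _ h]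
  refine ⟨ν, ?_, ⟨by simp only; omega, ?_⟩, ?_⟩
  · rw [fO 0 (by omega) (by omega) (by omega)]; simp [hμ₀, writeArgs]
  · intro e he h
    by_cases h64 : e < 64
    · rw [if_pos h64, mul_one, ← hget e h]
      refine ⟨by omega, by simp only; omega, ?_⟩
      rcases Nat.lt_or_ge e 3 with q | q
      · obtain rfl : e = 2 := by omega
        rw [← fH]; simp only; congr 1; omega
      · exact fS e q h64
    · rw [if_neg h64, mul_zero, add_zero, ← hget e h]
      exact ⟨by omega, by simp only; omega, fO e (by omega) (by omega) (by omega)⟩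
  · intro s' hexec
    have hR : Env.Rep ⟨H + 62, B, ν⟩ ν ⟨fun r => ν r.cell, fun _ _ => 0, 0⟩ := by
      refine ⟨fun r => rfl, f1, fun x hx => ?_, hνlt, by simp only; omega⟩
      simp only [Env.high]
      split_ifs with q
      · rfl
      -- Beyond the moved cells the memory is still zero, so all arrays, in particular the simulated
      -- memory, start with zeros.
      · rw [fO x (by omega) (by omega) (by omega), hμ₀]
        simp only [writeArgs]
        rw [List.getD_eq_default _ _ (by omega)]; rfl
    have hcc : CodeAt (machine J c) (J + 130) (c.code (J + 130)) := by
      have := codeAt_append (preamble J (J + 130 + (c.code (J + 130)).length)) (c.code (J + 130))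
      rwa [length_preamble] at this
    obtain ⟨T, μ', hl, hR', hT⟩ := hexec.leads hc hcc le_rfl hR
    refine ⟨J + 127 + (T + 0), μ', hlead _ _ (hl 0 μ' (.halt ?_ hR'.lt)), hR'.reg .out, ?_⟩
    · rw [machine, List.length_append, length_preamble]
    · simp at hT
      omega

end DynSCC

namespace DynSCC

/-! ## The number of clauses and the length of the input -/

/-- A clause, padded with `none` to length `k`, is a function from `k` positions to `2 * n + 1`
values; clauses are not repeated, so this is injective on the formula. Order and repetition of
literals within a clause do no harm. -/
theorem IsKCNF.length_le {n k : ℕ} {φ : CNF n} (h : IsKCNF k φ) : φ.length ≤ (2 * n + 1) ^ k := by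
  classical
  rw [← List.toFinset_card_of_nodup h.2]
  have h1 : φ.toFinset.card ≤ (Finset.univ : Finset (Fin k → Option (Literal n))).card := by
    refine Finset.card_le_card_of_injOn (fun l i => l[i.val]?) (fun _ _ => Finset.mem_univ _) ?_
    intro c hc c' hc' hcc
    simp only [Finset.mem_coe, List.mem_toFinset] at hc hc'
    refine List.ext_getElem? fun i => ?_
    by_cases hi : i < k
    · exact congrFun hcc ⟨i, hi⟩
    · have q1 := h.1 c hc
      have q2 := h.1 c' hc'
      rw [List.getElem?_eq_none (by omega), List.getElem?_eq_none (by omega)]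
  refine h1.trans_eq ?_
  rw [Finset.card_univ, Fintype.card_fun, Fintype.card_option, Fintype.card_prod, Fintype.card_fin,
    Fintype.card_bool, Fintype.card_fin, mul_comm n 2]

theorem IsKCNF.length_encode_le {n k : ℕ} {φ : CNF n} (h : IsKCNF k φ) :
    (encodeCNF φ).length ≤ 2 + φ.length * (k + 1) := by
  have h1 : ∀ l : CNF n, (∀ c ∈ l, c.length ≤ k) →
      (l.flatMap (fun c => c.length :: c.map litCode)).length ≤ l.length * (k + 1) := by
    intro l
    induction l with
    | nil => simp
    | cons c l ih =>
      intro hl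
      have q1 := ih fun c' hc' => hl c' (List.mem_cons_of_mem _ hc')
      have q2 := hl c List.mem_cons_self
      rw [List.flatMap_cons, List.length_append, List.length_cons, List.length_map,
        List.length_cons, add_mul]
      omega
  have := h1 φ h.1
  simp only [encodeCNF, List.length_cons]
  omega

theorem IsKCNF.encode_le {n k : ℕ} {φ : CNF n} (h : IsKCNF k φ) {x : ℕ} (hx : x ∈ encodeCNF φ) :
    x ≤ 2 * n + φ.length + k := by
  simp only [encodeCNF, List.mem_cons, List.mem_flatMap, List.mem_map] at hx
  rcases hx with rfl | rfl | ⟨c, hc, rfl | ⟨l, -, rfl⟩⟩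
  · omega
  · omega
  · have := h.1 c hc; omega
  · have := l.1.isLt
    have := Bool.toNat_le l.2
    unfold litCode; omega

/-! ## The service of a dynamic algorithm, in terms of the instance -/

/-- A bound for the number of vertices and updates. -/
def Layout.total (D : Layout) : ℕ := 58 * (D.m + 1) ^ 2 * D.w

/-- With `nv ≤ 14 (m + 1) w` the updates are at most `42 (m + 1) ^ 2 w`; the constant `58` is `42 +
14 + 2`. -/
theorem Layout.nv_add_updates_le {D : Layout} (M : Mode) (hw : 0 < D.w) :
    D.nv + D.updates M + 2 ≤ D.total := by
  have h1 := D.updates_le M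
  have h2 : D.nv ≤ 14 * (D.m + 1) * D.w := by unfold Layout.nv; nlinarith
  have h3 : (3 * D.m + 3) * D.nv ≤ (3 * D.m + 3) * (14 * (D.m + 1) * D.w) :=
    Nat.mul_le_mul_left _ h2
  have h4 : (D.m + 1) * D.w ≤ (D.m + 1) ^ 2 * D.w :=
    Nat.mul_le_mul_right _ (Nat.le_self_pow two_ne_zero _)
  have h5 : 0 < (D.m + 1) ^ 2 * D.w := by positivity
  unfold Layout.total
  nlinarith

theorem Layout.total_pos {D : Layout} (hw : 0 < D.w) : 0 < D.total := by
  unfold Layout.total; positivity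

/-- Passing to `δ ≤ 1` makes the exponent `1 - δ` nonnegative, so that the power is monotone in the
base; lowering `ε` to `δ` is harmless because there is at least one update. -/
theorem rpow_updates_le {D : Layout} {M : Mode} {ε δ : ℝ} (hw : 0 < D.w) (hδ : δ ≤ 1)
    (hδε : δ ≤ ε) : (D.updates M : ℝ) ^ (1 - ε) ≤ (D.total : ℝ) ^ (1 - δ) := by
  have h1 : (1 : ℝ) ≤ D.updates M := by exact_mod_cast D.updates_pos M
  have h2 : (D.updates M : ℝ) ≤ D.total := by
    have := D.nv_add_updates_le M hw
    exact_mod_cast (by omega : D.updates M ≤ D.total)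
  exact (Real.rpow_le_rpow_of_exponent_le h1 (by linarith)).trans
    (Real.rpow_le_rpow (by linarith) h2 (by linarith))

/-- The algorithm serves the instances within the stated bounds. -/
def DynAlg.Serviceable (A : DynAlg) (τ : QueryType) (κ : DeletionKind) (M : Mode) (ε : ℝ)
    (C t b : ℕ) : Prop :=
  ∀ (D : Layout), 0 < D.w → ∀ c : ℕ → ℕ → ℕ → Bool, ∃ T₀ T₁ T₂ : ℕ,
    A.Supports τ κ M D ((D.nv + D.updates M + 2) ^ b) (M.size D.w) T₀ T₁ T₂ c ∧
    T₀ ≤ C * D.total ^ t ∧ T₁ ≤ C * D.total ^ t ∧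
    (T₂ : ℝ) ≤ C * ((58 * (D.m + 1) ^ 2 : ℕ) : ℝ) ^ 2 * M.size D.w * (D.w : ℝ) ^ (1 - ε)

theorem rpow_total_le {D : Layout} {δ : ℝ} (hδ : 0 ≤ δ) :
    (D.total : ℝ) ^ (1 - δ) ≤ ((58 * (D.m + 1) ^ 2 : ℕ) : ℝ) * (D.w : ℝ) ^ (1 - δ) := by
  have h1 : (1 : ℝ) ≤ ((58 * (D.m + 1) ^ 2 : ℕ) : ℝ) := by
    exact_mod_cast (by positivity : 0 < 58 * (D.m + 1) ^ 2)
  rw [Layout.total, Nat.cast_mul, Real.mul_rpow (by positivity) (by positivity)]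
  refine mul_le_mul_of_nonneg_right ?_ (by positivity)
  calc ((58 * (D.m + 1) ^ 2 : ℕ) : ℝ) ^ (1 - δ) ≤ ((58 * (D.m + 1) ^ 2 : ℕ) : ℝ) ^ (1 : ℝ) :=
        Real.rpow_le_rpow_of_exponent_le h1 (by linarith)
    _ = _ := Real.rpow_one _

theorem rpow_total_le_self {D : Layout} {δ : ℝ} (hw : 0 < D.w) (hδ : 0 ≤ δ) :
    (D.total : ℝ) ^ (1 - δ) ≤ D.total := by
  have h1 : (1 : ℝ) ≤ D.total := by exact_mod_cast D.total_pos hw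
  calc (D.total : ℝ) ^ (1 - δ) ≤ (D.total : ℝ) ^ (1 : ℝ) :=
        Real.rpow_le_rpow_of_exponent_le h1 (by linarith)
    _ = _ := Real.rpow_one _

theorem preprocessing_le {D : Layout} {M : Mode} {C : ℝ} {t : ℕ} (hw : 0 < D.w) :
    ⌊C * ((D.nv : ℝ) + D.updates M) ^ t⌋₊ ≤ ⌈max C 0⌉₊ * D.total ^ (t + 2) := by
  refine Nat.floor_le_of_le ?_
  have h1 : (D.nv : ℝ) + D.updates M ≤ D.total := by
    have := D.nv_add_updates_le M hw
    exact_mod_cast (by omega : D.nv + D.updates M ≤ D.total)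
  have h2 : (1 : ℝ) ≤ D.total := by exact_mod_cast D.total_pos hw
  push_cast
  calc C * ((D.nv : ℝ) + D.updates M) ^ t ≤ ⌈max C 0⌉₊ * ((D.nv : ℝ) + D.updates M) ^ t :=
        mul_le_mul_of_nonneg_right ((le_max_left _ _).trans (Nat.le_ceil _)) (by positivity)
    _ ≤ ⌈max C 0⌉₊ * (D.total : ℝ) ^ t := by gcongr
    _ ≤ ⌈max C 0⌉₊ * (D.total : ℝ) ^ (t + 2) := by gcongr; exact Nat.le_add_right t 2

theorem cost_le {C x r : ℝ} (hx : 0 ≤ x) (hr : 0 ≤ r)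
    {y : ℝ} (h1 : x ≤ y) {z : ℝ} (h2 : r ≤ z) : x * (C * r) ≤ ⌈max C 0⌉₊ * (y * z) := by
  have h3 : C ≤ ⌈max C 0⌉₊ := (le_max_left _ _).trans (Nat.le_ceil _)
  calc x * (C * r) ≤ x * (⌈max C 0⌉₊ * r) := by gcongr
    _ = ⌈max C 0⌉₊ * (x * r) := by ring
    _ ≤ _ := by
      have h4 := hx.trans h1
      gcongr

/-- Two factors of at most `total` fit into the exponent `t + 2`, the `2` in which also covers the
quadratic loop over all pairs of vertices. -/
theorem start_le {D : Layout} {C x r : ℝ} (t : ℕ) (hw : 0 < D.w) (hx : 0 ≤ x) (hr : 0 ≤ r)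
    (h1 : x ≤ D.total) (h2 : r ≤ D.total) :
    ⌊x * (C * r)⌋₊ ≤ ⌈max C 0⌉₊ * D.total ^ (t + 2) := by
  refine Nat.floor_le_of_le ((cost_le hx hr h1 h2).trans ?_)
  have h3 : (1 : ℝ) ≤ D.total := by exact_mod_cast D.total_pos hw
  push_cast
  rw [← sq]
  gcongr
  omega

theorem natFloor_le {x y : ℝ} (hy : 0 ≤ y) (h : x ≤ y) : (⌊x⌋₊ : ℝ) ≤ y := by
  rcases le_total 0 x with hx | hx
  · exact (Nat.floor_le hx).trans h
  · rwa [Nat.floor_of_nonpos hx, Nat.cast_zero]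

/-- A session costs `total * total ^ (1 - δ)`; one factor `w` of `total` is the number of trials, so
each trial costs `w ^ (1 - δ)` up to a polynomial in the number of clauses. -/
theorem DynAlg.IsFullyDynamic.serviceable {A : DynAlg} {τ : QueryType} {κ : DeletionKind}
    {ε δ : ℝ} (h : A.IsFullyDynamic τ κ ε) (hδ : 0 ≤ δ) (hδ1 : δ ≤ 1) (hδε : δ ≤ ε) :
    ∃ C t b, A.Serviceable τ κ .full δ C (t + 2) b := by
  obtain ⟨C, t, b, h⟩ := h.supports
  refine ⟨⌈max C 0⌉₊, t, b, fun D hw c => ⟨_, _, _, h D c, preprocessing_le hw, ?_, ?_⟩⟩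
  all_goals
    have h1 := rpow_updates_le (M := .full) hw hδ1 hδε
    have h2 : (D.updates .full + D.w : ℝ) ≤ D.total := by
      have q1 := D.nv_add_updates_le .full hw
      have q2 : D.w ≤ D.nv := by unfold Layout.nv; omega
      exact_mod_cast (by omega : D.updates .full + D.w ≤ D.total)
  · exact start_le t hw (by positivity) (by positivity) h2 (h1.trans (rpow_total_le_self hw hδ))
  · have h3 := h1.trans (rpow_total_le hδ)
    have h4 : (D.total : ℝ) = ((58 * (D.m + 1) ^ 2 : ℕ) : ℝ) * D.w := by
      rw [Layout.total, Nat.cast_mul]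
    rw [h4] at h2
    refine natFloor_le (by positivity)
      ((cost_le (by positivity) (by positivity) h2 h3).trans_eq ?_)
    rw [Mode.size]; ring

theorem DynAlg.serviceable_of_supports {A : DynAlg} {τ : QueryType} {κ : DeletionKind} {M : Mode}
    {ε δ C : ℝ} {t b : ℕ} (hs : ∀ w, M.size w = 1)
    (h : ∀ (D : Layout) (c : ℕ → ℕ → ℕ → Bool),
      A.Supports τ κ M D ((D.nv + D.updates M + 2) ^ b) 1
      ⌊C * ((D.nv : ℝ) + D.updates M) ^ t⌋₊
      ⌊((((D.m + 2) * D.nv : ℕ)) : ℝ) * max (C * (D.updates M : ℝ) ^ (1 - ε)) 0⌋₊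
      ⌊((2 * D.m * 1 + 1 : ℕ) : ℝ) * max (C * (D.updates M : ℝ) ^ (1 - ε)) 0⌋₊ c)
    (hδ : 0 ≤ δ) (hδ1 : δ ≤ 1) (hδε : δ ≤ ε) :
    A.Serviceable τ κ M δ ⌈max C 0⌉₊ (t + 2) b := by
  intro D hw c
  have h0 := h D c
  have h1 := rpow_updates_le (M := M) hw hδ1 hδε
  set r := (D.updates M : ℝ) ^ (1 - ε) with hr
  have hr0 : 0 ≤ r := by positivity
  have hm : max (C * r) 0 = max C 0 * r := by
    rw [max_mul_of_nonneg _ _ hr0, zero_mul]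
  have hC : ⌈max C 0⌉₊ = ⌈max (max C 0) 0⌉₊ := by rw [max_eq_left (le_max_right C 0)]
  rw [hm] at h0
  refine ⟨_, _, _, by rw [hs]; exact h0, preprocessing_le hw, ?_, ?_⟩
  · rw [hC]
    refine start_le t hw (by positivity) hr0 ?_ (h1.trans (rpow_total_le_self hw hδ))
    have q1 : (D.m + 2) * D.nv ≤ D.total := by
      have h2 : D.nv ≤ 14 * (D.m + 1) * D.w := by unfold Layout.nv; nlinarith
      have h3 := Nat.mul_le_mul_left (D.m + 2) h2
      have h5 : 0 < (D.m + 1) * D.w := by positivity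
      unfold Layout.total
      nlinarith
    exact_mod_cast q1
  · have q2 : ((2 * D.m * 1 + 1 : ℕ) : ℝ) ≤ ((58 * (D.m + 1) ^ 2 : ℕ) : ℝ) := by
      exact_mod_cast (by nlinarith : 2 * D.m * 1 + 1 ≤ 58 * (D.m + 1) ^ 2)
    refine natFloor_le (by positivity) ?_
    rw [hC]
    refine (cost_le (by positivity) hr0 q2 (h1.trans (rpow_total_le hδ))).trans_eq ?_
    rw [hs, Nat.cast_one]; ring

theorem DynAlg.exists_serviceable {A : DynAlg} {τ : QueryType} {κ : DeletionKind} {ε δ : ℝ}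
    (h : A.IsFullyDynamic τ κ ε ∨ A.IsIncremental τ κ ε ∨ A.IsDecremental τ κ ε)
    (hδ : 0 ≤ δ) (hδ1 : δ ≤ 1) (hδε : δ ≤ ε) :
    ∃ M C t b, A.Serviceable τ κ M δ C (t + 2) b := by
  rcases h with h | h | h
  · exact ⟨_, h.serviceable hδ hδ1 hδε⟩
  · obtain ⟨C, t, b, h⟩ := h.supports
    exact ⟨_, _, t, b, serviceable_of_supports (fun _ => rfl) h hδ hδ1 hδε⟩
  · obtain ⟨C, t, b, h⟩ := h.supports
    exact ⟨_, _, t, b, serviceable_of_supports (fun _ => rfl) h hδ hδ1 hδε⟩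

end DynSCC

namespace DynSCC

/-! ## The running time -/

/-- This fixes the choice `p = ⌊n / (t + 3)⌋`: the start, with exponent `t + 2`, stays below `2 ^ n`
by a constant factor in the exponent. -/
theorem two_pow_pow_le {n t : ℕ} {δ : ℝ} (hδ1 : δ ≤ 1) :
    (((2 ^ (n / (t + 3))) ^ (t + 2) : ℕ) : ℝ) ≤
      (2 : ℝ) ^ ((1 - δ / ((t + 3 : ℕ) : ℝ)) * (n : ℝ)) := by
  have h1 : ((n / (t + 3) : ℕ) : ℝ) ≤ (n : ℝ) / ((t + 3 : ℕ) : ℝ) := Nat.cast_div_le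
  have hpos : (0 : ℝ) < ((t + 3 : ℕ) : ℝ) := by positivity
  have h2 : δ / ((t + 3 : ℕ) : ℝ) ≤ 1 / ((t + 3 : ℕ) : ℝ) := by gcongr
  rw [← pow_mul, Nat.cast_pow, Nat.cast_ofNat, ← Real.rpow_natCast]
  refine Real.rpow_le_rpow_of_exponent_le one_le_two ?_
  push_cast at h1 h2 hpos ⊢
  have h3 : (n : ℝ) / (t + 3) * (t + 2) = (1 - 1 / (t + 3)) * n := by field_simp; ring
  have h4 : ((n / (t + 3) : ℕ) : ℝ) * (t + 2) ≤ (n : ℝ) / (t + 3) * (t + 2) := by gcongr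
  have h5 : (1 - 1 / ((t : ℝ) + 3)) * n ≤ (1 - δ / (t + 3)) * n := by gcongr
  linarith

/-- The exponent is `n - δ p`. The factor `2` makes up for the rounding in `p`, as `n / (t + 3) ≤ p
+ 1` and `δ ≤ 1`. -/
theorem two_pow_mul_rpow_le {n t : ℕ} {δ : ℝ} (hδ : 0 ≤ δ) (hδ1 : δ ≤ 1) :
    ((2 ^ (n - n / (t + 3)) : ℕ) : ℝ) * ((2 ^ (n / (t + 3)) : ℕ) : ℝ) ^ (1 - δ) ≤
      2 * (2 : ℝ) ^ ((1 - δ / ((t + 3 : ℕ) : ℝ)) * (n : ℝ)) := by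
  have hle : n / (t + 3) ≤ n := Nat.div_le_self _ _
  have h0 : (n : ℝ) < (((n / (t + 3) : ℕ) : ℝ) + 1) * ((t + 3 : ℕ) : ℝ) := by
    exact_mod_cast Nat.lt_mul_of_div_lt (Nat.lt_succ_self _) (by omega)
  set p := n / (t + 3) with hp
  have hpos : (0 : ℝ) < ((t + 3 : ℕ) : ℝ) := by positivity
  have h1 : (n : ℝ) / ((t + 3 : ℕ) : ℝ) ≤ p + 1 := by rw [div_le_iff₀ hpos]; exact h0.le
  have h2 : δ * ((n : ℝ) / ((t + 3 : ℕ) : ℝ)) ≤ δ * (p + 1) := by gcongr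
  have h3 : (1 - δ / ((t + 3 : ℕ) : ℝ)) * (n : ℝ) = n - δ * ((n : ℝ) / ((t + 3 : ℕ) : ℝ)) := by
    ring
  rw [Nat.cast_pow, Nat.cast_pow, Nat.cast_ofNat, ← Real.rpow_natCast, ← Real.rpow_natCast,
    ← Real.rpow_mul two_pos.le, ← Real.rpow_add two_pos, ← Real.rpow_one_add' two_pos.le]
  · refine Real.rpow_le_rpow_of_exponent_le one_le_two ?_
    rw [h3, Nat.cast_sub hle]
    nlinarith
  · have q1 : δ / ((t + 3 : ℕ) : ℝ) ≤ 1 := by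
      rw [div_le_one hpos]; push_cast; have : (0 : ℝ) ≤ t := by positivity
      linarith
    have q2 : 0 ≤ (1 - δ / ((t + 3 : ℕ) : ℝ)) * (n : ℝ) :=
      mul_nonneg (by linarith) (Nat.cast_nonneg _)
    linarith

theorem solve_time_le {n t m k len a C T₀ T₁ T₂ nv sz : ℕ} {δ : ℝ} (hδ : 0 ≤ δ) (hδ1 : δ ≤ 1)
    (hlen : len ≤ 2 + m * (k + 1))
    (h0 : T₀ ≤ C * (58 * (m + 1) ^ 2 * 2 ^ (n / (t + 3))) ^ (t + 2))
    (h1 : T₁ ≤ C * (58 * (m + 1) ^ 2 * 2 ^ (n / (t + 3))) ^ (t + 2))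
    (hnv : nv ≤ 58 * (m + 1) ^ 2 * 2 ^ (n / (t + 3)))
    (h2 : (T₂ : ℝ) ≤ C * ((58 * (m + 1) ^ 2 : ℕ) : ℝ) ^ 2 * sz *
      ((2 ^ (n / (t + 3)) : ℕ) : ℝ) ^ (1 - δ))
    (hsz : 0 < sz)
    (hmul : 2 ^ (n - n / (t + 3)) / sz * sz = 2 ^ (n - n / (t + 3))) :
    ((10 * len + 40 + a * (T₀ + T₁ + nv * nv) + 9 * (nv * nv) +
      2 ^ (n - n / (t + 3)) / sz * ((a + 60) * (T₂ + sz * (2 * m + 2)) + 12) : ℕ) : ℝ) ≤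
    ((10 * (k + 3) + 40 + (2 * a * C + a + 9) + 2 * ((a + 60) * (C + 1) + 12) : ℕ) : ℝ) *
      (((58 * (m + 1) ^ 2 : ℕ) : ℝ) ^ (t + 2) *
        (2 : ℝ) ^ ((1 - δ / ((t + 3 : ℕ) : ℝ)) * (n : ℝ))) := by
  have e1 := two_pow_pow_le (n := n) (t := t) hδ1
  have e2 := two_pow_mul_rpow_le (n := n) (t := t) hδ hδ1
  set E := (2 : ℝ) ^ ((1 - δ / ((t + 3 : ℕ) : ℝ)) * (n : ℝ)) with hE
  set X : ℕ := 58 * (m + 1) ^ 2 with hX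
  set w : ℕ := 2 ^ (n / (t + 3)) with hw
  set g : ℕ := 2 ^ (n - n / (t + 3)) / sz with hg
  have hw1 : 1 ≤ w := Nat.one_le_two_pow
  have hX1 : 1 ≤ X := by rw [hX]; nlinarith
  have hmX : m ≤ X := by rw [hX]; nlinarith
  have hmX2 : 2 * m + 2 ≤ X := by rw [hX]; nlinarith
  have hXt : X ^ 2 ≤ X ^ (t + 2) := Nat.pow_le_pow_right hX1 (by omega)
  have hXt1 : X ≤ X ^ (t + 2) := Nat.le_self_pow (by omega) _
  have hE1 : (1 : ℝ) ≤ E := by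
    refine le_trans ?_ e1
    exact_mod_cast Nat.one_le_pow _ _ hw1
  have hu1 : (1 : ℝ) ≤ (w : ℝ) ^ (1 - δ) :=
    Real.one_le_rpow (by exact_mod_cast hw1) (by linarith)
  set u := (w : ℝ) ^ (1 - δ) with hu
  have hY1 : (1 : ℝ) ≤ (X : ℝ) ^ (t + 2) := by exact_mod_cast Nat.one_le_pow _ _ hX1
  have hXY : (X : ℝ) ≤ (X : ℝ) ^ (t + 2) := by exact_mod_cast hXt1
  have hX2Y : (X : ℝ) ^ 2 ≤ (X : ℝ) ^ (t + 2) := by exact_mod_cast hXt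
  set Y := (X : ℝ) ^ (t + 2) with hY
  have hYE : Y ≤ Y * E := le_mul_of_one_le_right (by linarith) hE1
  have hV : ((X * w : ℕ) : ℝ) ^ (t + 2) ≤ Y * E := by
    rw [Nat.cast_mul, mul_pow]
    exact mul_le_mul_of_nonneg_left (by exact_mod_cast e1) (by linarith)
  -- The three estimates concern reading, the start and the search. All are compared with `Y * E`, a
  -- polynomial in the number of clauses times the target.
  have f1 : ((10 * len + 40 : ℕ) : ℝ) ≤ ((10 * (k + 3) + 40 : ℕ) : ℝ) * (Y * E) := by
    have q1 : 10 * len + 40 ≤ (10 * (k + 3) + 40) * X := by nlinarith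
    calc ((10 * len + 40 : ℕ) : ℝ) ≤ ((10 * (k + 3) + 40 : ℕ) : ℝ) * X := by exact_mod_cast q1
      _ ≤ _ := mul_le_mul_of_nonneg_left (hXY.trans hYE) (by positivity)
  have f2 : ((a * (T₀ + T₁ + nv * nv) + 9 * (nv * nv) : ℕ) : ℝ) ≤
      ((2 * a * C + a + 9 : ℕ) : ℝ) * (Y * E) := by
    have q1 : nv * nv ≤ (X * w) ^ (t + 2) := by
      calc nv * nv ≤ (X * w) ^ 2 := by rw [sq]; exact Nat.mul_le_mul hnv hnv
        _ ≤ _ := Nat.pow_le_pow_right (Nat.mul_pos hX1 hw1) (by omega)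
    have q2 : a * (T₀ + T₁ + nv * nv) + 9 * (nv * nv) ≤ (2 * a * C + a + 9) * (X * w) ^ (t + 2) := by
      have := Nat.mul_le_mul_left a (Nat.add_le_add (Nat.add_le_add h0 h1) q1)
      nlinarith
    calc ((a * (T₀ + T₁ + nv * nv) + 9 * (nv * nv) : ℕ) : ℝ) ≤
          ((2 * a * C + a + 9 : ℕ) : ℝ) * ((X * w : ℕ) : ℝ) ^ (t + 2) := by exact_mod_cast q2
      _ ≤ _ := mul_le_mul_of_nonneg_left hV (by positivity)
  have f3 : ((g * ((a + 60) * (T₂ + sz * (2 * m + 2)) + 12) : ℕ) : ℝ) ≤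
      ((2 * ((a + 60) * (C + 1) + 12) : ℕ) : ℝ) * (Y * E) := by
    have q1 : ((sz * (2 * m + 2) : ℕ) : ℝ) ≤ sz * (X ^ 2 * u) := by
      rw [Nat.cast_mul]
      refine mul_le_mul_of_nonneg_left ?_ (by positivity)
      have : ((2 * m + 2 : ℕ) : ℝ) ≤ (X : ℝ) ^ 2 := by
        exact_mod_cast hmX2.trans (Nat.le_self_pow two_ne_zero _)
      exact this.trans (le_mul_of_one_le_right (by positivity) hu1)
    have q2 : (12 : ℝ) ≤ 12 * (sz * (X ^ 2 * u)) := by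
      have r1 : (1 : ℝ) ≤ sz := by exact_mod_cast hsz
      have r2 : (1 : ℝ) ≤ (X : ℝ) ^ 2 := by exact_mod_cast Nat.one_le_pow _ _ hX1
      have := one_le_mul_of_one_le_of_one_le r1 (one_le_mul_of_one_le_of_one_le r2 hu1)
      linarith
    have q3 : (((a + 60) * (T₂ + sz * (2 * m + 2)) + 12 : ℕ) : ℝ) ≤
        (((a + 60) * (C + 1) + 12 : ℕ) : ℝ) * (sz * (X ^ 2 * u)) := by
      rw [Nat.cast_add, Nat.cast_mul, Nat.cast_add T₂]
      calc ((a + 60 : ℕ) : ℝ) * ((T₂ : ℝ) + (sz * (2 * m + 2) : ℕ)) + (12 : ℕ)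
          ≤ ((a + 60 : ℕ) : ℝ) * (C * (X : ℝ) ^ 2 * sz * u + sz * (X ^ 2 * u)) +
            12 * (sz * (X ^ 2 * u)) := by
            refine add_le_add (mul_le_mul_of_nonneg_left (add_le_add h2 q1) (by positivity)) ?_
            exact_mod_cast q2
        _ = _ := by push_cast; ring
    have q4 : (g : ℝ) * sz = ((2 ^ (n - n / (t + 3)) : ℕ) : ℝ) := by exact_mod_cast hmul
    rw [Nat.cast_mul]
    calc (g : ℝ) * (((a + 60) * (T₂ + sz * (2 * m + 2)) + 12 : ℕ) : ℝ)
        ≤ g * ((((a + 60) * (C + 1) + 12 : ℕ) : ℝ) * (sz * (X ^ 2 * u))) := by gcongr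
      _ = (((a + 60) * (C + 1) + 12 : ℕ) : ℝ) * (X ^ 2 * (g * sz * u)) := by ring
      _ ≤ (((a + 60) * (C + 1) + 12 : ℕ) : ℝ) * (Y * (2 * E)) := by
          rw [q4]; gcongr
      _ = _ := by push_cast; ring
  have := add_le_add (add_le_add f1 f2) f3
  rw [← add_mul, ← add_mul] at this
  exact_mod_cast (by push_cast at this ⊢; linarith)

/-! ## The size of the words -/

theorem IsKCNF.total_le {n k : ℕ} {φ : CNF n} (h : IsKCNF k φ) :
    58 * (φ.length + 1) ^ 2 ≤ 58 * 4 ^ (k + 1) * (n + 1) ^ (2 * k) := by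
  have h1 := h.length_le
  have h2 : (2 * n + 1) ^ k ≤ (2 * (n + 1)) ^ k := Nat.pow_le_pow_left (by omega) k
  have h3 : 1 ≤ (2 * (n + 1)) ^ k := Nat.one_le_pow _ _ (by omega)
  have h4 : φ.length + 1 ≤ 2 ^ (k + 1) * (n + 1) ^ k := by
    rw [pow_succ', mul_assoc, ← mul_pow]; omega
  calc 58 * (φ.length + 1) ^ 2 ≤ 58 * (2 ^ (k + 1) * (n + 1) ^ k) ^ 2 := by gcongr
    _ = _ := by
      rw [mul_pow, ← pow_mul, ← pow_mul, show (4 : ℕ) = 2 ^ 2 from rfl, ← pow_mul,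
        mul_comm (k + 1) 2, mul_comm k 2, mul_assoc]

/-- For fixed `k` the polynomial factor is absorbed by finitely many copies of `2 ^ n`, so every
quantity polynomial in the size of the graph fits into `O(n)` bits. -/
theorem exists_word_bound (k : ℕ) : ∃ q, 2 ≤ q ∧ ∀ {n : ℕ} {φ : CNF n}, IsKCNF k φ →
    58 * (φ.length + 1) ^ 2 * 2 ^ n ≤ 2 ^ (q * (n + 1)) := by
  refine ⟨58 * 4 ^ (k + 1) + 2 * k + 2, by omega, fun {n φ} h => ?_⟩
  have h1 : n + 1 ≤ 2 ^ n := Nat.lt_two_pow_self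
  calc 58 * (φ.length + 1) ^ 2 * 2 ^ n
      ≤ 2 ^ (58 * 4 ^ (k + 1)) * (2 ^ n) ^ (2 * k) * 2 ^ n := by
        refine Nat.mul_le_mul_right _ (h.total_le.trans ?_)
        exact Nat.mul_le_mul Nat.lt_two_pow_self.le (Nat.pow_le_pow_left h1 _)
    _ = 2 ^ (58 * 4 ^ (k + 1) + n * (2 * k) + n) := by
        rw [pow_add 2 _ n, pow_add 2 _ (n * (2 * k)), pow_mul 2 n]
    _ ≤ _ := by
        refine Nat.pow_le_pow_right two_pos ?_
        have : 58 * 4 ^ (k + 1) ≤ 58 * 4 ^ (k + 1) * (n + 1) := Nat.le_mul_of_pos_right _ (by omega)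
        nlinarith

end DynSCC

namespace DynSCC

/-! ## The reduction -/

/-- The log needs `Y ^ (t + 2)` cells, the words of the dynamic algorithm are below `Y ^ b`, and
masks and pairs of vertices are below `Y ^ 2`. The power `Y ^ (t + 2 + b)` dominates all of these,
and `R` collects the constants. -/
theorem Env.fits_of_le {E : Env} {I : Inst} {k b b₀ l t H L R Y : ℕ} (hY : 1 ≤ Y)
    (hR : 64 * H + 4 * L + 4 * k + 100 ≤ R) (hb : R * Y ^ (t + 2 + b) < E.bound)
    (hnv : I.layout.nv ≤ Y) (hn : 2 ^ I.n ≤ Y) (hbase : 64 ≤ E.base) (hbase' : E.base ≤ H * Y)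
    (hb₀ : b₀ ≤ Y ^ b) (hl : l ≤ L * Y ^ (t + 2)) (hp : I.p ≤ I.n) :
    E.Fits I k b₀ l (H * Y ^ 2) := by
  have hYt : Y ^ (t + 2) ≤ Y ^ (t + 2 + b) := Nat.pow_le_pow_right hY (by omega)
  have hY2 : Y ^ 2 ≤ Y ^ (t + 2 + b) := Nat.pow_le_pow_right hY (by omega)
  have hYb : Y ^ b ≤ Y ^ (t + 2 + b) := Nat.pow_le_pow_right hY (by omega)
  have hYY : Y ≤ Y ^ 2 := Nat.le_self_pow two_ne_zero _
  have hH : 1 ≤ H := by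
    by_contra hc
    obtain rfl : H = 0 := by omega
    omega
  have hmul := Nat.mul_le_mul_right (Y ^ (t + 2 + b)) hR
  have hG : 1 ≤ Y ^ (t + 2 + b) := Nat.one_le_pow _ _ hY
  have hHY : H * Y ≤ H * Y ^ 2 := Nat.mul_le_mul_left _ hYY
  have hHG : H * Y ^ 2 ≤ H * Y ^ (t + 2 + b) := Nat.mul_le_mul_left _ hY2
  have hLG : L * Y ^ (t + 2) ≤ L * Y ^ (t + 2 + b) := Nat.mul_le_mul_left _ hYt
  have hkG : k ≤ k * Y ^ (t + 2 + b) := Nat.le_mul_of_pos_right _ hG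
  have hYH : Y ^ 2 ≤ H * Y ^ 2 := Nat.le_mul_of_pos_left _ hH
  simp only [add_mul, mul_assoc] at hmul
  refine ⟨⟨hbase, by omega, by omega, by omega⟩, by omega, by omega, ?_, ?_, hp⟩
  · exact (Nat.mul_le_mul hnv hnv).trans (by rw [← sq]; exact hYH)
  · rw [mul_comm, pow_mul]
    exact (Nat.pow_le_pow_left hn 2).trans hYH

/-- `Y` is the size bound with `p` replaced by `n`: crude, but enough for address space. The
conditions on `J` guarantee that the input of `2 + M (k + 1)` numbers at most, and the first `64`
cells, lie below `2 ^ J * (n + M)`. -/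
theorem DynAlg.Serviceable.exists_runsTo {A : DynAlg} {τ : QueryType} {κ : DeletionKind} {M : Mode}
    {δ : ℝ} {C t b k k' a J R Y N n : ℕ} {φ : CNF n} (h : A.Serviceable τ κ M δ C (t + 2) b)
    (hδ : 0 ≤ δ) (hδ1 : δ ≤ 1) (hA : A.BoundedBy k' a) (hJ : 0 < J) (hJ1 : 64 ≤ 2 ^ J)
    (hJ2 : k + 3 ≤ 2 ^ J) (hR : 64 * (2 ^ J * 2 + 62) + 4 * (3 * C + 4) + 4 * k' + k + t + 100 ≤ R)
    (hφ : IsKCNF k φ) (hY : 58 * (φ.length + 1) ^ 2 * 2 ^ n ≤ Y)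
    (hN : R * Y ^ (t + 2 + b) < N) (hpos : 0 < n + φ.length) :
    ∃ T μ, RunsTo (machine J (solve A τ κ M J (t + 3))) N 0 (writeArgs (encodeCNF φ) 0) T μ ∧
      ((Satisfiable φ ∧ μ 0 = 1) ∨ (¬ Satisfiable φ ∧ μ 0 = 0)) ∧
      (T : ℝ) ≤ J + 130 + ((solve A τ κ M J (t + 3)).code (J + 130)).length *
        (((10 * (k + 3) + 40 + (2 * a * C + a + 9) + 2 * ((a + 60) * (C + 1) + 12) : ℕ) : ℝ) *
        (((58 * (φ.length + 1) ^ 2 : ℕ) : ℝ) ^ (t + 2) *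
          (2 : ℝ) ^ ((1 - δ / ((t + 3 : ℕ) : ℝ)) * (n : ℝ)))) := by
  have hw : 0 < 2 ^ (n / (t + 3)) := by positivity
  obtain ⟨T₀, T₁, T₂, hsup, hT₀, hT₁, hT₂⟩ := h (φ.inst (n / (t + 3))).layout hw
    (fun g i => (φ.inst (n / (t + 3))).link (g * M.size (2 ^ (n / (t + 3))) + i))
  have hpn : n / (t + 3) ≤ n := Nat.div_le_self _ _
  have hD := (φ.inst (n / (t + 3))).layout.nv_add_updates_le M hw
  have htot : (φ.inst (n / (t + 3))).layout.total =
      58 * (φ.length + 1) ^ 2 * 2 ^ (n / (t + 3)) := rfl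
  rw [htot] at hT₀ hT₁ hD
  have hm : φ.length ≤ 58 * (φ.length + 1) ^ 2 := by nlinarith
  have hX1 : 1 ≤ 58 * (φ.length + 1) ^ 2 := by nlinarith
  have hlen := hφ.length_encode_le
  have hent := fun x hx => hφ.encode_le (x := x) hx
  have hsz : 0 < M.size (2 ^ (n / (t + 3))) := by cases M <;> simp [Mode.size]
  have hszw : M.size (2 ^ (n / (t + 3))) ≤ 2 ^ (n / (t + 3)) := by
    cases M
    · exact le_rfl
    · exact hw
    · exact hw
  have h2p : 2 * (n / (t + 3)) ≤ n :=
    (Nat.mul_le_mul_right _ (by omega : 2 ≤ t + 3)).trans (Nat.mul_div_le n (t + 3))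
  have htime := solve_time_le (k := k) (a := a) hδ hδ1 hlen hT₀ hT₁
    (by omega : (φ.inst (n / (t + 3))).layout.nv ≤ _) hT₂ hsz (M.size_mul h2p)
  have hT₂' : T₂ ≤ C * (58 * (φ.length + 1) ^ 2 * 2 ^ (n / (t + 3))) ^ 2 := by
    have q1 : ((2 ^ (n / (t + 3)) : ℕ) : ℝ) ^ (1 - δ) ≤ (2 ^ (n / (t + 3)) : ℕ) := by
      have r1 : (1 : ℝ) ≤ (2 ^ (n / (t + 3)) : ℕ) := by exact_mod_cast hw
      calc _ ≤ ((2 ^ (n / (t + 3)) : ℕ) : ℝ) ^ (1 : ℝ) :=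
            Real.rpow_le_rpow_of_exponent_le r1 (by linarith)
        _ = _ := Real.rpow_one _
    have q2 : ((M.size (2 ^ (n / (t + 3))) : ℕ) : ℝ) ≤ (2 ^ (n / (t + 3)) : ℕ) := by
      exact_mod_cast hszw
    have q3 : (T₂ : ℝ) ≤ C * ((58 * (φ.length + 1) ^ 2 : ℕ) : ℝ) ^ 2 *
        (2 ^ (n / (t + 3)) : ℕ) * (2 ^ (n / (t + 3)) : ℕ) := by
      refine hT₂.trans (mul_le_mul (mul_le_mul_of_nonneg_left q2 (by positivity)) q1
        (by positivity) (by positivity))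
    have q4 : T₂ ≤ C * (58 * (φ.length + 1) ^ 2) ^ 2 * 2 ^ (n / (t + 3)) * 2 ^ (n / (t + 3)) := by
      exact_mod_cast q3
    rw [mul_pow _ (2 ^ (n / (t + 3))), sq (2 ^ (n / (t + 3)))]
    refine q4.trans_eq ?_
    simp only [mul_assoc]
  have hVY : 58 * (φ.length + 1) ^ 2 * 2 ^ (n / (t + 3)) ≤ Y :=
    (Nat.mul_le_mul_left _ (Nat.pow_le_pow_right two_pos hpn)).trans hY
  generalize hV : 58 * (φ.length + 1) ^ 2 * 2 ^ (n / (t + 3)) = V at *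
  have hnY : 2 ^ n ≤ Y := (Nat.le_mul_of_pos_left _ hX1).trans hY
  have hXY : 58 * (φ.length + 1) ^ 2 ≤ Y := (Nat.le_mul_of_pos_right _ (by positivity)).trans hY
  have hmY := hm.trans hXY
  have hY1 : 1 ≤ Y := hX1.trans hXY
  have hnY' : n ≤ Y := (Nat.lt_two_pow_self (n := n)).le.trans hnY
  have hYG : Y ≤ Y ^ (t + 2 + b) := Nat.le_self_pow (by omega) _
  have hG : 1 ≤ Y ^ (t + 2 + b) := Nat.one_le_pow _ _ hY1
  have hmul := Nat.mul_le_mul_right (Y ^ (t + 2 + b)) hR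
  have hkG : k ≤ k * Y ^ (t + 2 + b) := Nat.le_mul_of_pos_right _ hG
  have htG : t ≤ t * Y ^ (t + 2 + b) := Nat.le_mul_of_pos_right _ hG
  have hHY : 2 ^ J * (n + φ.length) ≤ 2 ^ J * 2 * Y := by
    rw [mul_assoc]; exact Nat.mul_le_mul_left _ (by omega)
  have hHG : (2 ^ J * 2) * Y ≤ (2 ^ J * 2) * Y ^ (t + 2 + b) := Nat.mul_le_mul_left _ hYG
  have hfit : (encodeCNF φ).length ≤ 2 ^ J * (n + φ.length) := by
    have q1 : (k + 3) * (n + φ.length) ≤ 2 ^ J * (n + φ.length) := Nat.mul_le_mul_right _ hJ2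
    have q2 : φ.length * (k + 1) + 2 ≤ (k + 3) * (n + φ.length) := by nlinarith
    omega
  have h64 : 64 ≤ 2 ^ J * (n + φ.length) := hJ1.trans (Nat.le_mul_of_pos_right _ hpos)
  have hJG : (2 ^ J * 2) * Y ^ (t + 2 + b) ≤ 64 * (2 ^ J * 2 + 62) * Y ^ (t + 2 + b) :=
    Nat.mul_le_mul_right _ (by omega)
  simp only [add_mul] at hmul
  obtain ⟨ν, hν, hreads, hrun⟩ := machine_run (J := J) (B := N) (c := solve A τ κ M J (t + 3))
    (solve_shallow A τ κ M J (t + 3)) (fun x hx => (by have := hent x hx; omega : x < N))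
    hJ h64 hfit (by omega)
  have hVt : V ^ (t + 2) ≤ Y ^ (t + 2) := Nat.pow_le_pow_left hVY _
  have hVt2 : V ^ 2 ≤ V ^ (t + 2) := by
    rcases Nat.eq_zero_or_pos V with h0 | h0
    · omega
    · exact Nat.pow_le_pow_right h0 (by omega)
  have hnvV : (φ.inst (n / (t + 3))).layout.nv ≤ V := by omega
  have hfits := Env.fits_of_le (E := ⟨2 ^ J * (n + φ.length) + 62, N, ν⟩)
    (I := φ.inst (n / (t + 3))) (k := k') (b := b) (t := t) (H := 2 ^ J * 2 + 62)
    (L := 3 * C + 4) (R := R) (Y := Y)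
    (b₀ := ((φ.inst (n / (t + 3))).layout.nv + (φ.inst (n / (t + 3))).layout.updates M + 2) ^ b)
    (l := T₀ + T₁ + T₂ +
      4 * ((φ.inst (n / (t + 3))).layout.nv * (φ.inst (n / (t + 3))).layout.nv))
    hY1 (by omega) hN (by omega) hnY (by change 64 ≤ _ + 62; omega)
    (by change _ + 62 ≤ _; rw [add_mul]; omega) (Nat.pow_le_pow_left (hD.trans hVY) b)
    (by
      have r1 : (φ.inst (n / (t + 3))).layout.nv * (φ.inst (n / (t + 3))).layout.nv ≤ V ^ 2 := by
        rw [sq]; exact Nat.mul_le_mul hnvV hnvV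
      have r2 := Nat.mul_le_mul_left C hVt
      have r3 := Nat.mul_le_mul_left C hVt2
      rw [add_mul, mul_assoc]
      omega) hpn
  obtain ⟨s', hex, hout, hts⟩ := wp_solve (J := J)
    (s := ⟨fun r => ν r.cell, fun _ _ => 0, 0⟩) (by omega : 2 ≤ t + 3) hfits hA rfl hpos
    (by change t + 3 < N; omega) hreads hsup le_rfl hν rfl
  obtain ⟨T, μ, hT, hμ, hle⟩ := hrun s' hex
  refine ⟨T, μ, hT, by rw [hμ]; exact hout.imp And.symm And.symm, ?_⟩
  rw [zero_add] at hts
  have hts' := (Nat.cast_le (α := ℝ)).2 hts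
  have hle' := (Nat.cast_le (α := ℝ)).2 hle
  refine hle'.trans ?_
  rw [Nat.cast_add, Nat.cast_mul, Nat.cast_add, Nat.cast_ofNat]
  exact add_le_add_right (mul_le_mul_of_nonneg_left (hts'.trans htime) (Nat.cast_nonneg _)) _

theorem one_le_two_rpow {n t : ℕ} {δ : ℝ} (hδ1 : δ ≤ 1) :
    (1 : ℝ) ≤ (2 : ℝ) ^ ((1 - δ / ((t + 3 : ℕ) : ℝ)) * (n : ℝ)) :=
  le_trans (by exact_mod_cast Nat.one_le_pow _ _ Nat.one_le_two_pow)
    (two_pow_pow_le (n := n) (t := t) hδ1)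

theorem time_bound {J W S X Xc e u v : ℕ} {T E N : ℝ} (hE : 1 ≤ E) (hN : 1 ≤ N)
    (hX1 : 1 ≤ Xc) (hX : (X : ℝ) ≤ Xc * N ^ e) (hT : T ≤ J + v + W * (S * ((X : ℝ) ^ u * E))) :
    T ≤ (((J + v + W * S) * Xc ^ u : ℕ) : ℝ) * E * N ^ (e * u) := by
  have h1 : (X : ℝ) ^ u ≤ (Xc : ℝ) ^ u * N ^ (e * u) := by
    rw [pow_mul, ← mul_pow]; gcongr
  have h2 : (1 : ℝ) ≤ (Xc : ℝ) ^ u * N ^ (e * u) * E := by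
    refine one_le_mul_of_one_le_of_one_le (one_le_mul_of_one_le_of_one_le ?_ ?_) hE
    · exact one_le_pow₀ (by exact_mod_cast hX1)
    · exact one_le_pow₀ hN
  have h3 : (W : ℝ) * (S * ((X : ℝ) ^ u * E)) ≤ W * (S * ((Xc : ℝ) ^ u * N ^ (e * u) * E)) := by
    gcongr
  have h4 : ((J : ℝ) + v) * 1 ≤ (J + v) * ((Xc : ℝ) ^ u * N ^ (e * u) * E) := by gcongr
  calc T ≤ (J + v) * ((Xc : ℝ) ^ u * N ^ (e * u) * E) +
        W * (S * ((Xc : ℝ) ^ u * N ^ (e * u) * E)) := by linarith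
    _ = _ := by push_cast; ring

/-- The constants `J`, `R` and `q` may depend on `k`, but the saving `δ / (t + 3)` does not; this
order of quantifiers is what refutes SETH. -/
theorem DynAlg.Serviceable.kSATSolvable {A : DynAlg} {τ : QueryType} {κ : DeletionKind} {M : Mode}
    {δ : ℝ} {C t b : ℕ} (h : A.Serviceable τ κ M δ C (t + 2) b) (hδ : 0 ≤ δ) (hδ1 : δ ≤ 1)
    (k : ℕ) : KSATSolvable k (δ / ((t + 3 : ℕ) : ℝ)) := by
  obtain ⟨k', a, hA⟩ := A.exists_boundedBy
  obtain ⟨q, hq, hword⟩ := exists_word_bound k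
  obtain ⟨J, hJ0, hJ1, hJ2⟩ : ∃ J, 0 < J ∧ 64 ≤ 2 ^ J ∧ k + 3 ≤ 2 ^ J := by
    refine ⟨k + 6, by omega, ?_, ?_⟩
    · exact (by norm_num : 64 ≤ 2 ^ 6).trans (Nat.pow_le_pow_right two_pos (by omega))
    · exact (Nat.lt_two_pow_self : k + 3 < 2 ^ (k + 3)).le.trans
        (Nat.pow_le_pow_right two_pos (by omega))
  obtain ⟨R, hR⟩ : ∃ R, 64 * (2 ^ J * 2 + 62) + 4 * (3 * C + 4) + 4 * k' + k + t + 100 ≤ R :=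
    ⟨_, le_rfl⟩
  obtain ⟨Xc, hXc, hX⟩ : ∃ Xc, 1 ≤ Xc ∧ ∀ {n : ℕ} {φ : CNF n}, IsKCNF k φ →
      58 * (φ.length + 1) ^ 2 ≤ Xc * (n + 1) ^ (2 * k) :=
    ⟨58 * 4 ^ (k + 1), Nat.mul_pos (by norm_num) (by positivity), fun h => h.total_le⟩
  refine ⟨machine J (solve A τ κ M J (t + 3)),
    ((J + 130 + ((solve A τ κ M J (t + 3)).code (J + 130)).length *
      (10 * (k + 3) + 40 + (2 * a * C + a + 9) + 2 * ((a + 60) * (C + 1) + 12))) *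
      Xc ^ (t + 2) : ℕ), 2 * k * (t + 2), R + q * (t + 2 + b),
    fun n φ hφ => ?_⟩
  have hN : R * (2 ^ (q * (n + 1))) ^ (t + 2 + b) < 2 ^ ((R + q * (t + 2 + b)) * (n + 1)) := by
    have q1 : R < 2 ^ (R * (n + 1)) := Nat.lt_two_pow_self.trans_le
      (Nat.pow_le_pow_right two_pos (Nat.le_mul_of_pos_right _ (by omega)))
    calc _ < 2 ^ (R * (n + 1)) * (2 ^ (q * (n + 1))) ^ (t + 2 + b) :=
          Nat.mul_lt_mul_of_pos_right q1 (by positivity)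
      _ = _ := by rw [← pow_mul, ← pow_add]; congr 1; ring
  have hX' : ((58 * (φ.length + 1) ^ 2 : ℕ) : ℝ) ≤ Xc * ((n : ℝ) + 1) ^ (2 * k) := by
    exact_mod_cast hX hφ
  have hN1 : (1 : ℝ) ≤ (n : ℝ) + 1 := by linarith [(Nat.cast_nonneg n : (0 : ℝ) ≤ n)]
  -- The general run needs a positive address for the moved cells; for the empty formula without
  -- variables the preamble answers alone.
  rcases Nat.eq_zero_or_pos (n + φ.length) with hnm | hpos
  · obtain ⟨rfl, hm⟩ : n = 0 ∧ φ.length = 0 := by omega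
    obtain rfl : φ = [] := List.length_eq_zero_iff.1 hm
    obtain ⟨μ, hrun, hμ⟩ := machine_zero (J := J) (c := solve A τ κ M J (t + 3))
      (B := 2 ^ ((R + q * (t + 2 + b)) * (0 + 1)))
      (lt_of_le_of_lt (by
        have := Nat.le_mul_of_pos_right R
          (by positivity : 0 < (2 ^ (q * (0 + 1))) ^ (t + 2 + b))
        omega) hN)
    refine ⟨_, μ, hrun, Or.inl ⟨⟨fun _ => false, by simp⟩, hμ⟩, ?_⟩
    refine time_bound (v := 130) (one_le_two_rpow hδ1) hN1 hXc hX' ?_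
    push_cast
    have : (0 : ℝ) ≤ ((solve A τ κ M J (t + 3)).code (J + 130)).length *
        (((10 * (k + 3) + 40 + (2 * a * C + a + 9) + 2 * ((a + 60) * (C + 1) + 12) : ℕ) : ℝ) *
        (((58 * (([] : CNF 0).length + 1) ^ 2 : ℕ) : ℝ) ^ (t + 2) *
          (2 : ℝ) ^ ((1 - δ / ((t + 3 : ℕ) : ℝ)) * ((0 : ℕ) : ℝ)))) := by positivity
    push_cast at this
    linarith
  · obtain ⟨T, μ, hrun, hμ, hT⟩ :=
      h.exists_runsTo hδ hδ1 hA hJ0 hJ1 hJ2 hR hφ (hword hφ) hN hpos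
    exact ⟨T, μ, hrun, hμ, time_bound (v := 130) (one_le_two_rpow hδ1) hN1 hXc hX'
      (by exact_mod_cast hT)⟩

end DynSCC

theorem mainTheorem7 (τ : DynSCC.QueryType) (κ : DynSCC.DeletionKind) (ε : ℝ) (hε : 0 < ε)
    (h : ∃ A : DynSCC.DynAlg,
      A.IsFullyDynamic τ κ ε ∨ A.IsIncremental τ κ ε ∨ A.IsDecremental τ κ ε) :
    ¬ DynSCC.SETH := by
  obtain ⟨A, hA⟩ := h
  -- For `ε > 1` the exponent `1 - ε` would be negative, and the cost would not be monotone in the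
  -- number of updates.
  have hδ : 0 < min ε 1 := lt_min hε one_pos
  obtain ⟨M, C, t, b, hS⟩ :=
    DynSCC.DynAlg.exists_serviceable hA hδ.le (min_le_right _ _) (min_le_left _ _)
  intro hseth
  obtain ⟨k, hk⟩ := hseth (min ε 1 / ((t + 3 : ℕ) : ℝ)) (by positivity)
  exact hk (hS.kSATSolvable hδ.le (min_le_right _ _) k)
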